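/- Let $A$ be a finite alphabet, let $\varepsilon$ be the empty word, and let $U$ be the submonoid of $A^*\times A^*\times A^*$ (with pointwise concatenation) generated by the triples $(a,\varepsilon,a)$ and $(\varepsilon,a,a)$ with $a\in A$. A spliffer over $A$ with finite state set $Q$ is a finite automaton with a set of initial states, a set of final states, and transitions labelled by these generators. Its behaviour is the set of all elements of $U$ that are the product of the labels along a path from an initial to a final state. A spliffer is deterministic if it has exactly one initial state; for every state $q$ and letter $s$ there is at most one transition leaving $q$ whose label has third coordinate $s$; and for every state $q$, either all labels of transitions leaving $q$ have first coordinate $\varepsilon$ or all of them have second coordinate $\varepsilon$. Two spliffers are equivalent if they have the same behaviour. Then the equivalence of two deterministic spliffers over $A$ can be decided in time quadratic in the total number of states: there are a program for a random access machine and constants $C,d$, depending only on $A$, such that for any two deterministic spliffers $\mathcal S_1,\mathcal S_2$ over $A$ with finite state sets $Q_1,Q_2$, given by their transition tables (for arbitrary numberings of the states), the program halts after at most $C\,(|Q_1|+|Q_2|)^2$ steps and answers correctly whether $\mathcal S_1$ and $\mathcal S_2$ are equivalent. Here each addition, truncated subtraction, multiplication, constant assignment, memory read or write with indirect addressing, comparison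 of a branch or loop, and empty instruction counts as one step, and all numbers handled are natural numbers at most $C\,(|Q_1|+|Q_2|)^d$, that is, words of $O(\log(|Q_1|+|Q_2|))$ bits. -/

import Mathlib

/-! ## The shuffling monoid -/

/-- The monoid `A* × A* × A*` with pointwise concatenation; the empty word is `1`. -/
abbrev Triple (A : Type*) : Type _ := FreeMonoid A × FreeMonoid A × FreeMonoid A

/-- The generators `(a, ε, a)` and `(ε, a, a)`, for `a` a letter. -/
def shufflingGenerators (A : Type*) : Set (Triple A) :=
  {g | ∃ a : A, g = (FreeMonoid.of a, 1, FreeMonoid.of a)} ∪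
    {g | ∃ a : A, g = (1, FreeMonoid.of a, FreeMonoid.of a)}

/-- The shuffling monoid `U`: the submonoid of `A* × A* × A*` generated by the
triples `(a, ε, a)` and `(ε, a, a)`. -/
def ShufflingMonoid (A : Type*) : Submonoid (Triple A) :=
  Submonoid.closure (shufflingGenerators A)

namespace ShufflingMonoid

/-- The generator `(a, ε, a)` as an element of `U`. -/
def left {A : Type*} (a : A) : ShufflingMonoid A :=
  ⟨(FreeMonoid.of a, 1, FreeMonoid.of a), Submonoid.subset_closure (Or.inl ⟨a, rfl⟩)⟩

/-- The generator `(ε, a, a)` as an element of `U`. -/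
def right {A : Type*} (a : A) : ShufflingMonoid A :=
  ⟨(1, FreeMonoid.of a, FreeMonoid.of a), Submonoid.subset_closure (Or.inr ⟨a, rfl⟩)⟩

end ShufflingMonoid

/-! ## Spliffers -/

/-- An automaton over `U` with state set `Q` and transitions labelled by generators.
(Finiteness of `A` and `Q` is imposed where spliffers are used.) -/
structure Spliffer (A : Type*) (Q : Type*) where
  trans : Set (Q × ShufflingMonoid A × Q)
  label_mem : ∀ e ∈ trans, (e.2.1 : Triple A) ∈ shufflingGenerators A
  init : Set Q
  final : Set Q

namespace Spliffer

/-- `S.Path p u q`: there is a path from `p` to `q` in the graph of transitions such that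
the product of the labels of its edges is `u`. -/
inductive Path {A Q : Type*} (S : Spliffer A Q) : Q → ShufflingMonoid A → Q → Prop
  | nil (p : Q) : Path S p 1 p
  | cons {p q r : Q} {g u : ShufflingMonoid A} :
      (p, g, q) ∈ S.trans → Path S q u r → Path S p (g * u) r

/-- The behaviour `|S|`: the set of labels of successful computations. -/
def behaviour {A Q : Type*} (S : Spliffer A Q) : Set (ShufflingMonoid A) :=
  {u | ∃ i ∈ S.init, ∃ t ∈ S.final, S.Path i u t}

/-- A spliffer is deterministic if, regarded as a splitter (third coordinate is the input,
first two coordinates are the outputs), it has exactly one initial state, at most one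
transition from each state for each input letter, and all transitions that leave a given
state write to the same tape. -/
structure IsDeterministic {A Q : Type*} (S : Spliffer A Q) : Prop where
  unique_init : ∃ i, S.init = {i}
  unique_trans : ∀ (q : Q) (s : A) (g g' : ShufflingMonoid A) (p p' : Q),
    (q, g, p) ∈ S.trans → (q, g', p') ∈ S.trans →
    (g : Triple A).2.2 = FreeMonoid.of s → (g' : Triple A).2.2 = FreeMonoid.of s →
    g = g' ∧ p = p'
  same_tape : ∀ (q : Q) (g g' : ShufflingMonoid A) (p p' : Q),
    (q, g, p) ∈ S.trans → (q, g', p') ∈ S.trans →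
    ((g : Triple A).1 = 1 ∧ (g' : Triple A).1 = 1) ∨
      ((g : Triple A).2.1 = 1 ∧ (g' : Triple A).2.1 = 1)

open Classical in
/-- Entry of the transition table: `0` if no transition labelled `g` leaves the state `q`,
and otherwise `1 +` the number of its target (which is unique in a deterministic spliffer). -/
noncomputable def entry {A Q : Type*} {n : ℕ} (e : Q ≃ Fin n) (S : Spliffer A Q) (q : Q)
    (g : ShufflingMonoid A) : ℕ :=
  if h : ∃ p, (q, g, p) ∈ S.trans then (e h.choose : ℕ) + 1 else 0

open Classical in
/-- The record of a state `q`: is it initial (`1` or `0`), is it final (`1` or `0`), and then,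
for each letter `a` in turn, the table entries for the labels `(a, ε, a)` and `(ε, a, a)`. -/
noncomputable def stateRecord {A Q : Type*} {k n : ℕ} (α : A ≃ Fin k) (e : Q ≃ Fin n)
    (S : Spliffer A Q) (q : Q) : List ℕ :=
  [if q ∈ S.init then 1 else 0, if q ∈ S.final then 1 else 0] ++
    (List.ofFn fun a : Fin k =>
      [S.entry e q (ShufflingMonoid.left (α.symm a)),
        S.entry e q (ShufflingMonoid.right (α.symm a))]).flatten

/-- The transition table of a (deterministic) spliffer, for a numbering `α` of the alphabet
and a numbering `e` of the states: the number of states, then the records of all states.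
This is a list of `1 + n * (2 + 2 * k)` numbers. -/
noncomputable def encode {A Q : Type*} {k n : ℕ} (α : A ≃ Fin k) (e : Q ≃ Fin n)
    (S : Spliffer A Q) : List ℕ :=
  n :: (List.ofFn fun q : Fin n => S.stateRecord α e (e.symm q)).flatten

end Spliffer

/-! ## Random access machines with bounded words and unit cost -/

namespace RAM

/-- A configuration: the contents of the registers and of the memory cells. -/
structure State where
  reg : ℕ → ℕ
  mem : ℕ → ℕ

/-- Write `v` into register `r`. -/
def State.setReg (s : State) (r v : ℕ) : State := ⟨Function.update s.reg r v, s.mem⟩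

/-- Write `v` into the memory cell `i`. -/
def State.setMem (s : State) (i v : ℕ) : State := ⟨s.reg, Function.update s.mem i v⟩

/-- Programs of the machine. The arguments are register names, except for the constant `c`
in `const r c`. -/
inductive Program where
  | skip : Program
  /-- `r := c` -/
  | const (r c : ℕ) : Program
  /-- `r := x + y` -/
  | add (r x y : ℕ) : Program
  /-- `r := max (x - y) 0` -/
  | sub (r x y : ℕ) : Program
  /-- `r := x * y` -/
  | mul (r x y : ℕ) : Program
  /-- `r := mem[x]` -/
  | load (r x : ℕ) : Program
  /-- `mem[x] := y` -/
  | store (x y : ℕ) : Program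
  | seq (P P' : Program) : Program
  /-- if `x < y` then `P` else `P'` -/
  | ite (x y : ℕ) (P P' : Program) : Program
  /-- while `x < y` do `P` -/
  | while (x y : ℕ) (P : Program) : Program

/-- `Exec W P s t s'`: on a machine whose words hold the numbers `0, …, W`, the program `P`,
started in the configuration `s`, halts in the configuration `s'` after exactly `t` steps.
Every instruction and every test of a branch or of a loop is one step. A computation that
produces a number larger than `W` is not an execution. -/
inductive Exec (W : ℕ) : Program → State → ℕ → State → Prop
  | skip (s : State) : Exec W .skip s 1 s
  | const (s : State) (r c : ℕ) : c ≤ W → Exec W (.const r c) s 1 (s.setReg r c)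
  | add (s : State) (r x y : ℕ) : s.reg x + s.reg y ≤ W →
      Exec W (.add r x y) s 1 (s.setReg r (s.reg x + s.reg y))
  | sub (s : State) (r x y : ℕ) :
      Exec W (.sub r x y) s 1 (s.setReg r (s.reg x - s.reg y))
  | mul (s : State) (r x y : ℕ) : s.reg x * s.reg y ≤ W →
      Exec W (.mul r x y) s 1 (s.setReg r (s.reg x * s.reg y))
  | load (s : State) (r x : ℕ) : s.mem (s.reg x) ≤ W →
      Exec W (.load r x) s 1 (s.setReg r (s.mem (s.reg x)))
  | store (s : State) (x y : ℕ) :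
      Exec W (.store x y) s 1 (s.setMem (s.reg x) (s.reg y))
  | seq {P P' : Program} {s s' s'' : State} {t t' : ℕ} :
      Exec W P s t s' → Exec W P' s' t' s'' → Exec W (.seq P P') s (t + t') s''
  | ite_true {x y : ℕ} {P P' : Program} {s s' : State} {t : ℕ} :
      s.reg x < s.reg y → Exec W P s t s' → Exec W (.ite x y P P') s (1 + t) s'
  | ite_false {x y : ℕ} {P P' : Program} {s s' : State} {t : ℕ} :
      ¬ s.reg x < s.reg y → Exec W P' s t s' → Exec W (.ite x y P P') s (1 + t) s'
  | while_true {x y : ℕ} {P : Program} {s s' s'' : State} {t t' : ℕ} :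
      s.reg x < s.reg y → Exec W P s t s' → Exec W (.while x y P) s' t' s'' →
      Exec W (.while x y P) s (1 + t + t') s''
  | while_false {x y : ℕ} {P : Program} {s : State} :
      ¬ s.reg x < s.reg y → Exec W (.while x y P) s 1 s

/-- The machine is deterministic: the running time and the final configuration are determined
by the program and the initial configuration. -/
theorem Exec.unique {W : ℕ} {P : Program} {s s₁ s₂ : State} {t₁ t₂ : ℕ}
    (h₁ : Exec W P s t₁ s₁) (h₂ : Exec W P s t₂ s₂) : t₁ = t₂ ∧ s₁ = s₂ := by
  induction h₁ generalizing t₂ s₂ with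
  | skip | const | add | sub | mul | load | store => cases h₂; exact ⟨rfl, rfl⟩
  | seq _ _ ih ih' =>
    cases h₂ with
    | seq a b =>
      obtain ⟨rfl, rfl⟩ := ih a
      obtain ⟨rfl, rfl⟩ := ih' b
      exact ⟨rfl, rfl⟩
  | ite_true h _ ih =>
    cases h₂ with
    | ite_true _ a => obtain ⟨rfl, rfl⟩ := ih a; exact ⟨rfl, rfl⟩
    | ite_false h' _ => exact absurd h h'
  | ite_false h _ ih =>
    cases h₂ with
    | ite_true h' _ => exact absurd h' h
    | ite_false _ a => obtain ⟨rfl, rfl⟩ := ih a; exact ⟨rfl, rfl⟩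
  | while_true h _ _ ih ih' =>
    cases h₂ with
    | while_true _ a b =>
      obtain ⟨rfl, rfl⟩ := ih a
      obtain ⟨rfl, rfl⟩ := ih' b
      exact ⟨rfl, rfl⟩
    | while_false h' => exact absurd h h'
  | while_false h =>
    cases h₂ with
    | while_true h' _ _ => exact absurd h' h
    | while_false _ => exact ⟨rfl, rfl⟩

/-- The initial configuration on an input list: the list is in the first memory cells, and
all other cells and all registers contain `0`. -/
def initial (input : List ℕ) : State where
  reg := fun _ => 0
  mem := fun i => input.getD i 0

end RAM

/-! In a deterministic spliffer the third coordinate drives the computation: each letter read is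
copied to one of two tapes, selected by the state and the letter. Put both machines into one table
over states `0, …, n`, where `0` is a dead state. The behaviours agree exactly when the two initial
states accept the same words and every accepted word gives the same two outputs
(`Spliffer.behaviour_eq_iff`).

Linearly many test words suffice. As in the Hopcroft–Karp algorithm, the pair of initial states
generates a partition of the states: a queued word `w` that leads to two states with different
labels merges their classes, enters `M`, and sends its successors `wa` to the queue. There are at
most `n` merges, so the set `W` of queued words has size `O(n)`. Each state `c` that accepts
something gets a word `X c` of at most `n + 1` letters leading to a final state. The test for `w ∈
W` compares finality of the two states reached and, if their class label `l` accepts something, the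
outputs on `w` followed by `X l`, the same continuation on both sides.

If the machines are equivalent, states with a common label accept the same words, so `X l` is
accepted from both and the outputs agree (`Equivalent.passes`). Conversely (`equivalent_of_passes`),
let `g c` be, in the free group, what `c` writes on a fixed tape on `X (L c)`. Suppose `u ∈ M` leads
to `x` and `y`. Dividing the test for `ua` by the test for `u` shows that the element `(g c)⁻¹ *
chunk c a * g (δ c a)` is the same for `c = x` and `c = y`. Equality of this element is an
equivalence relation in `c`, so it spreads to all states with a common label. Multiplying along any
word, through classes that accept something, gives the test equation for that word; at a final label
`X` is empty, so the outputs themselves agree.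

For the time bound, finding the words `X`, relabelling naively after merges, and running the tests
are each quadratic. Output words are nodes of a trie, so appending a letter and comparing two words
cost constant time, and the prefix `w` is never reread. For the word size, the algorithm is written
in a language whose steps raise numbers only by a constant (`Cmd.exec_compile`): after `O(n²)` steps
all numbers are `O(n²)`, and array addresses are quartic in them, whence the exponent `8`
(`wordBound_le`). -/

/-! ## A language of array programs -/

namespace RAM

/-- The variables of the program. -/
inductive Var
  | pos | base | size | i | n | c | x | y | a
  | start₁ | start₂ | old | cnt | head | tail | p | q | r | u₁ | v₁ | u₂ | v₂ | ids | ok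
  deriving DecidableEq

/-- The two-dimensional arrays of the program. -/
inductive Arr
  | code | delta | tape | fin | rank | next | lab
  | wp | wq | wu₁ | wv₁ | wu₂ | wv₂ | child
  deriving DecidableEq

/-- Expressions. Their values exceed the values of variables and array entries by at most
a constant, so that a program cannot produce large numbers quickly. -/
inductive Expr
  | var (v : Var)
  | lit (c : ℕ)
  | succ (e : Expr)
  | get (j : Arr) (e e' : Expr)

/-- Commands. -/
inductive Cmd
  | skip
  | assign (v : Var) (e : Expr)
  | write (j : Arr) (e e' e'' : Expr)
  | input (v w : Var)
  | seq (c c' : Cmd)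
  | ite (e e' : Expr) (c c' : Cmd)
  | while (e e' : Expr) (c : Cmd)

infixr:60 " ;; " => Cmd.seq

/-- Configurations of array programs: variables, arrays, and an input list that is
only read, of which `len` entries are accessible. -/
structure Store where
  reg : Var → ℕ
  arr : Arr → ℕ → ℕ → ℕ
  inp : ℕ → ℕ
  len : ℕ

/-- Change one entry of a matrix. -/
def update₂ (f : ℕ → ℕ → ℕ) (x y v : ℕ) : ℕ → ℕ → ℕ :=
  fun x' y' => if x' = x ∧ y' = y then v else f x' y'

/-- Assign `a` to the variable `v`. -/
def Store.setReg (s : Store) (v : Var) (a : ℕ) : Store :=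
  { s with reg := Function.update s.reg v a }

/-- Write `a` into the entry `(x, y)` of the array `j`. -/
def Store.setArr (s : Store) (j : Arr) (x y a : ℕ) : Store :=
  { s with arr := Function.update s.arr j (update₂ (s.arr j) x y a) }

/-- The value of an expression. -/
def Expr.eval (s : Store) : Expr → ℕ
  | var v => s.reg v
  | lit c => c
  | succ e => e.eval s + 1
  | get j e e' => s.arr j (e.eval s) (e'.eval s)

/-- Big-step semantics of commands, counting steps. -/
inductive Cmd.Exec : Cmd → Store → ℕ → Store → Prop
  | skip (s : Store) : Exec .skip s 1 s
  | assign (s : Store) (v : Var) (e : Expr) : Exec (.assign v e) s 1 (s.setReg v (e.eval s))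
  | write (s : Store) (j : Arr) (e e' e'' : Expr) :
      Exec (.write j e e' e'') s 1 (s.setArr j (e.eval s) (e'.eval s) (e''.eval s))
  | input (s : Store) (v w : Var) : s.reg w < s.len →
      Exec (.input v w) s 1 (s.setReg v (s.inp (s.reg w)))
  | seq {c c' : Cmd} {s s' s'' : Store} {t t' : ℕ} :
      Exec c s t s' → Exec c' s' t' s'' → Exec (.seq c c') s (t + t') s''
  | ite_true {e e' : Expr} {c c' : Cmd} {s s' : Store} {t : ℕ} :
      e.eval s < e'.eval s → Exec c s t s' → Exec (.ite e e' c c') s (1 + t) s'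
  | ite_false {e e' : Expr} {c c' : Cmd} {s s' : Store} {t : ℕ} :
      ¬ e.eval s < e'.eval s → Exec c' s t s' → Exec (.ite e e' c c') s (1 + t) s'
  | while_true {e e' : Expr} {c : Cmd} {s s' s'' : Store} {t t' : ℕ} :
      e.eval s < e'.eval s → Exec c s t s' → Exec (.while e e' c) s' t' s'' →
      Exec (.while e e' c) s (1 + t + t') s''
  | while_false {e e' : Expr} {c : Cmd} {s : Store} :
      ¬ e.eval s < e'.eval s → Exec (.while e e' c) s 1 s

/-! ### Frames -/

/-- The variables that a command may change. -/
def Cmd.Mod : Cmd → Var → Prop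
  | .assign v _ => fun w => w = v
  | .input v _ => fun w => w = v
  | .seq c c' => fun w => c.Mod w ∨ c'.Mod w
  | .ite _ _ c c' => fun w => c.Mod w ∨ c'.Mod w
  | .while _ _ c => c.Mod
  | _ => fun _ => False

/-- The arrays that a command may change. -/
def Cmd.ModArr : Cmd → Arr → Prop
  | .write j _ _ _ => fun i => i = j
  | .seq c c' => fun w => c.ModArr w ∨ c'.ModArr w
  | .ite _ _ c c' => fun w => c.ModArr w ∨ c'.ModArr w
  | .while _ _ c => c.ModArr
  | _ => fun _ => False

/-- `s'` differs from `s` only in what `c` may change. -/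
structure Frame (c : Cmd) (s s' : Store) : Prop where
  inp : s'.inp = s.inp
  len : s'.len = s.len
  reg : ∀ v, ¬ c.Mod v → s'.reg v = s.reg v
  arr : ∀ j, ¬ c.ModArr j → s'.arr j = s.arr j

theorem Frame.refl (c : Cmd) (s : Store) : Frame c s s :=
  ⟨rfl, rfl, fun _ _ => rfl, fun _ _ => rfl⟩

theorem Frame.trans {c : Cmd} {s s' s'' : Store} (h : Frame c s s') (h' : Frame c s' s'') :
    Frame c s s'' :=
  ⟨h'.inp.trans h.inp, h'.len.trans h.len, fun v hv => (h'.reg v hv).trans (h.reg v hv),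
    fun v hv => (h'.arr v hv).trans (h.arr v hv)⟩

theorem Frame.mono {c c' : Cmd} {s s' : Store} (h : Frame c s s')
    (h₁ : ∀ v, c.Mod v → c'.Mod v) (h₂ : ∀ j, c.ModArr j → c'.ModArr j) : Frame c' s s' :=
  ⟨h.inp, h.len, fun v hv => h.reg v (mt (h₁ v) hv), fun v hv => h.arr v (mt (h₂ v) hv)⟩

/-- What a command leaves alone is read off its syntax. Specifications therefore mention only what
changes, and `simp` on `Mod` and `ModArr` supplies the rest. -/
theorem Cmd.Exec.frame {c : Cmd} {s s' : Store} {t : ℕ} (h : c.Exec s t s') :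
    Frame c s s' := by
  induction h with
  | skip s => exact Frame.refl _ _
  | assign s v e =>
    exact ⟨rfl, rfl, fun w hw => Function.update_of_ne hw _ _, fun _ _ => rfl⟩
  | write s j e e' e'' =>
    exact ⟨rfl, rfl, fun _ _ => rfl, fun i hi => Function.update_of_ne hi _ _⟩
  | input s v w _ =>
    exact ⟨rfl, rfl, fun w hw => Function.update_of_ne hw _ _, fun _ _ => rfl⟩
  | seq _ _ ih ih' =>
    exact (ih.mono (fun _ => Or.inl) fun _ => Or.inl).trans
      (ih'.mono (fun _ => Or.inr) fun _ => Or.inr)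
  | ite_true _ _ ih => exact ih.mono (fun _ => Or.inl) fun _ => Or.inl
  | ite_false _ _ ih => exact ih.mono (fun _ => Or.inr) fun _ => Or.inr
  | while_true _ _ _ ih ih' =>
    exact Frame.trans (ih.mono (c' := .while _ _ _) (fun _ => id) fun _ => id) ih'
  | while_false => exact Frame.refl _ _

/-! ### Weakest preconditions -/

/-- `c`, started in `s`, halts after some number `t` of steps in some `s'` with `Q t s'`. -/
def Wp (c : Cmd) (Q : ℕ → Store → Prop) (s : Store) : Prop :=
  ∃ t s', c.Exec s t s' ∧ Q t s'

/-- The rule for applying a specification inside a larger proof; the frame is handed to the consumer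
for free. -/
theorem Wp.mono {c : Cmd} {Q Q' : ℕ → Store → Prop} {s : Store} (h : Wp c Q s)
    (h' : ∀ t s', Frame c s s' → Q t s' → Q' t s') : Wp c Q' s := by
  obtain ⟨t, s', he, hq⟩ := h
  exact ⟨t, s', he, h' t s' he.frame hq⟩

theorem wp_skip {Q : ℕ → Store → Prop} {s : Store} : Wp .skip Q s ↔ Q 1 s := by
  constructor
  · rintro ⟨t, s', he, hq⟩
    cases he
    exact hq
  · exact fun h => ⟨_, _, .skip s, h⟩

theorem wp_assign {v : Var} {e : Expr} {Q : ℕ → Store → Prop} {s : Store} :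
    Wp (.assign v e) Q s ↔ Q 1 (s.setReg v (e.eval s)) := by
  constructor
  · rintro ⟨t, s', he, hq⟩
    cases he
    exact hq
  · exact fun h => ⟨_, _, .assign s v e, h⟩

theorem wp_write {j : Arr} {e e' e'' : Expr} {Q : ℕ → Store → Prop} {s : Store} :
    Wp (.write j e e' e'') Q s ↔ Q 1 (s.setArr j (e.eval s) (e'.eval s) (e''.eval s)) := by
  constructor
  · rintro ⟨t, s', he, hq⟩
    cases he
    exact hq
  · exact fun h => ⟨_, _, .write s j e e' e'', h⟩

theorem wp_input {v w : Var} {Q : ℕ → Store → Prop} {s : Store} :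
    Wp (.input v w) Q s ↔ s.reg w < s.len ∧ Q 1 (s.setReg v (s.inp (s.reg w))) := by
  constructor
  · rintro ⟨t, s', he, hq⟩
    cases he with
    | input _ _ _ h => exact ⟨h, hq⟩
  · exact fun h => ⟨_, _, .input s v w h.1, h.2⟩

theorem wp_seq {c c' : Cmd} {Q : ℕ → Store → Prop} {s : Store} :
    Wp (.seq c c') Q s ↔ Wp c (fun t s' => Wp c' (fun t' s'' => Q (t + t') s'') s') s := by
  constructor
  · rintro ⟨t, s', he, hq⟩
    cases he with
    | seq h h' => exact ⟨_, _, h, _, _, h', hq⟩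
  · rintro ⟨t, s', h, t', s'', h', hq⟩
    exact ⟨_, _, .seq h h', hq⟩

theorem wp_ite {e e' : Expr} {c c' : Cmd} {Q : ℕ → Store → Prop} {s : Store} :
    Wp (.ite e e' c c') Q s ↔
      (e.eval s < e'.eval s → Wp c (fun t s' => Q (1 + t) s') s) ∧
      (¬ e.eval s < e'.eval s → Wp c' (fun t s' => Q (1 + t) s') s) := by
  constructor
  · rintro ⟨t, s', he, hq⟩
    cases he with
    | ite_true h h' => exact ⟨fun _ => ⟨_, _, h', hq⟩, fun hn => absurd h hn⟩
    | ite_false h h' => exact ⟨fun hn => absurd hn h, fun _ => ⟨_, _, h', hq⟩⟩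
  · rintro ⟨h, h'⟩
    by_cases hc : e.eval s < e'.eval s
    · obtain ⟨t, s', he, hq⟩ := h hc
      exact ⟨_, _, .ite_true hc he, hq⟩
    · obtain ⟨t, s', he, hq⟩ := h' hc
      exact ⟨_, _, .ite_false hc he, hq⟩

/-- The rule for loops: `I m s` is an invariant that holds `m` steps in reserve. -/
theorem Wp.loop {e e' : Expr} {c : Cmd} {Q : ℕ → Store → Prop} {s₀ : Store}
    (I : ℕ → Store → Prop) {m₀ : ℕ} (h₀ : I m₀ s₀)
    (step : ∀ m s, Frame c s₀ s → I m s → e.eval s < e'.eval s →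
      Wp c (fun t s' => ∃ m', I m' s' ∧ t + 1 + m' ≤ m) s)
    (post : ∀ m t s, Frame c s₀ s → I m s → ¬ e.eval s < e'.eval s → t + m ≤ m₀ + 1 → Q t s) :
    Wp (.while e e' c) Q s₀ := by
  suffices H : ∀ m s, Frame c s₀ s → I m s →
      Wp (.while e e' c) (fun t s' => ∃ m', Frame c s₀ s' ∧ I m' s' ∧
        ¬ e.eval s' < e'.eval s' ∧ t + m' ≤ m + 1) s by
    obtain ⟨t, s', he, m', hf, hi, hc, ht⟩ := H m₀ s₀ (Frame.refl _ _) h₀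
    exact ⟨t, s', he, post m' t s' hf hi hc ht⟩
  intro m
  induction m using Nat.strong_induction_on with
  | _ m ih =>
    intro s hf hi
    by_cases hc : e.eval s < e'.eval s
    · obtain ⟨t, s', he, m', hi', ht⟩ := step m s hf hi hc
      obtain ⟨t', s'', he', m'', hf'', hi'', hc'', ht'⟩ :=
        ih m' (by omega) s' (hf.trans he.frame) hi'
      exact ⟨_, _, .while_true hc he he', m'', hf'', hi'', hc'', by omega⟩
    · exact ⟨_, _, .while_false hc, m, hf, hi, hc, by omega⟩

/-- Run `c` if the values of two expressions differ. -/
def Cmd.ifNe (e e' : Expr) (c : Cmd) : Cmd := .ite e e' c (.ite e' e c .skip)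

/-- The body starts after one test or after two, according to which value is smaller, so the
postcondition is required at both times. -/
theorem wp_ifNe {e e' : Expr} {c : Cmd} {Q : ℕ → Store → Prop} {s : Store}
    (h : e.eval s ≠ e'.eval s → Wp c (fun t s' => Q (1 + t) s' ∧ Q (1 + (1 + t)) s') s)
    (h' : e.eval s = e'.eval s → Q 3 s) : Wp (.ifNe e e' c) Q s := by
  rw [Cmd.ifNe, wp_ite]
  refine ⟨fun hc => (h hc.ne).mono fun t s' _ hq => hq.1, fun hc => ?_⟩
  rw [wp_ite]
  refine ⟨fun hc' => (h hc'.ne').mono fun t s' _ hq => hq.2, fun hc' => ?_⟩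
  rw [wp_skip]
  exact h' (by omega)

end RAM

/-! ### Compilation -/

namespace RAM

/-- An injective polynomial. -/
def pair (x y : ℕ) : ℕ := (x + y) * (x + y) + x

/-- With `s = x + y`, the value lies between `s²` and `s² + s < (s + 1)²`, so it determines `s` and
then `x`. -/
theorem pair_inj {x y x' y' : ℕ} (h : pair x y = pair x' y') : x = x' ∧ y = y' := by
  unfold pair at h
  have h₁ : x + y = x' + y' := by
    rcases lt_trichotomy (x + y) (x' + y') with hlt | heq | hgt
    · nlinarith
    · exact heq
    · nlinarith
  rw [h₁] at h
  omega

/-- The address of an array entry, if arrays are stored from the address `o` on. -/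
def addr (o : ℕ) (j : Arr) (x y : ℕ) : ℕ := pair (pair x y) j.ctorIdx + o

theorem addr_inj {o : ℕ} {j j' : Arr} {x y x' y' : ℕ} (h : addr o j x y = addr o j' x' y') :
    j = j' ∧ x = x' ∧ y = y' := by
  obtain ⟨h₁, h₂⟩ := pair_inj (Nat.add_right_cancel h)
  refine ⟨?_, pair_inj h₁⟩
  rw [← Arr.ofNat_ctorIdx j, ← Arr.ofNat_ctorIdx j', h₂]

/-- The machine register that holds a variable. -/
def Var.loc (v : Var) : ℕ := 2 * v.ctorIdx + 2

theorem Var.loc_inj {v w : Var} (h : v.loc = w.loc) : v = w := by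
  rw [← Var.ofNat_ctorIdx v, ← Var.ofNat_ctorIdx w]
  congr 1
  unfold Var.loc at h
  omega

/-- The machine state `σ` represents the store `s`; arrays are stored from address `o` on. -/
structure Rep (o : ℕ) (s : Store) (σ : State) : Prop where
  off : σ.reg 1 = o
  len : s.len ≤ o
  reg : ∀ v, σ.reg (Var.loc v) = s.reg v
  arr : ∀ j x y, σ.mem (addr o j x y) = s.arr j x y
  inp : ∀ i < s.len, σ.mem i = s.inp i

/-- All numbers in the store are at most `B`. -/
structure Store.Le (s : Store) (B : ℕ) : Prop where
  reg : ∀ v, s.reg v ≤ B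
  arr : ∀ j x y, s.arr j x y ≤ B
  inp : ∀ i < s.len, s.inp i ≤ B

theorem Store.Le.mono {s : Store} {B B' : ℕ} (h : s.Le B) (hB : B ≤ B') : s.Le B' :=
  ⟨fun v => (h.reg v).trans hB, fun j x y => (h.arr j x y).trans hB,
    fun i hi => (h.inp i hi).trans hB⟩

/-- A bound for the growth of numbers in the evaluation of an expression. -/
def Expr.cost : Expr → ℕ
  | var _ => 1
  | lit c => c + 1
  | succ e => e.cost + 1
  | get j e e' => e.cost + e'.cost + j.ctorIdx + 1

theorem Expr.eval_le {s : Store} {B : ℕ} (h : s.Le B) (e : Expr) : e.eval s ≤ B + e.cost := by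
  induction e with
  | var v => exact (h.reg v).trans (by omega)
  | lit c => simp only [eval, cost]; omega
  | succ e ih => simp only [eval, cost]; omega
  | get j e e' _ _ => exact (h.arr j _ _).trans (by omega)

/-- The word size that suffices for addressing if all numbers are at most `V`. -/
def wordBound (o V : ℕ) : ℕ := pair (pair V V + V) (pair V V + V) + o + V

theorem pair_mono {x y x' y' : ℕ} (h : x ≤ x') (h' : y ≤ y') : pair x y ≤ pair x' y' := by
  unfold pair
  gcongr

theorem wordBound_mono {o V V' : ℕ} (h : V ≤ V') : wordBound o V ≤ wordBound o V' := by
  have h₁ : pair V V + V ≤ pair V' V' + V' := Nat.add_le_add (pair_mono h h) h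
  have := pair_mono h₁ h₁
  unfold wordBound
  omega

/-- Compute in register `2 * d + 1` the address of the entry of the array `j` whose indices
are in the registers `2 * d + 1` and `2 * d + 3`. -/
def combine (d : ℕ) (j : Arr) : Program :=
  .seq (.add (2 * d + 3) (2 * d + 1) (2 * d + 3))
    (.seq (.mul (2 * d + 3) (2 * d + 3) (2 * d + 3))
    (.seq (.add (2 * d + 1) (2 * d + 3) (2 * d + 1))
    (.seq (.const (2 * d + 3) j.ctorIdx)
    (.seq (.add (2 * d + 3) (2 * d + 1) (2 * d + 3))
    (.seq (.mul (2 * d + 3) (2 * d + 3) (2 * d + 3))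
    (.seq (.add (2 * d + 1) (2 * d + 3) (2 * d + 1))
    (.add (2 * d + 1) (2 * d + 1) 1)))))))

/-- Evaluate an expression into register `2 * d + 1`, without changing the registers below
and those that hold variables. -/
def Expr.compile (d : ℕ) : Expr → Program
  | var v => .seq (.const (2 * d + 1) 0) (.add (2 * d + 1) (2 * d + 1) v.loc)
  | lit c => .const (2 * d + 1) c
  | succ e => .seq (e.compile d) (.seq (.const (2 * d + 3) 1)
      (.add (2 * d + 1) (2 * d + 1) (2 * d + 3)))
  | get j e e' => .seq (.seq (.seq (e.compile d) (e'.compile (d + 1))) (combine d j))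
      (.load (2 * d + 1) (2 * d + 1))

/-- `σ'` has the same memory as `σ`, and the same variables and registers below `2 * d + 1`. -/
structure Keeps (d : ℕ) (σ σ' : State) : Prop where
  mem : σ'.mem = σ.mem
  reg : ∀ r, r < 2 * d + 1 ∨ r % 2 = 0 → σ'.reg r = σ.reg r

theorem Keeps.refl (d : ℕ) (σ : State) : Keeps d σ σ := ⟨rfl, fun _ _ => rfl⟩

theorem Keeps.trans {d d' : ℕ} {σ σ' σ'' : State} (h : Keeps d σ σ') (h' : Keeps d' σ' σ'')
    (hd : d ≤ d') : Keeps d σ σ'' :=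
  ⟨h'.mem.trans h.mem, fun r hr => (h'.reg r (by omega)).trans (h.reg r hr)⟩

theorem Keeps.setReg {d d' : ℕ} {σ σ' : State} (h : Keeps d σ σ') (hd : d ≤ d') (v : ℕ) :
    Keeps d σ (σ'.setReg (2 * d' + 1) v) := by
  refine ⟨h.mem, fun r hr => ?_⟩
  rw [← h.reg r hr]
  exact Function.update_of_ne (by omega) _ _

theorem Keeps.rep {o d : ℕ} {s : Store} {σ σ' : State} (h : Keeps d σ σ') (hd : 1 ≤ d)
    (hr : Rep o s σ) : Rep o s σ' where
  off := (h.reg 1 (by omega)).trans hr.off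
  len := hr.len
  reg v := (h.reg _ (by unfold Var.loc; omega)).trans (hr.reg v)
  arr j x y := by rw [h.mem]; exact hr.arr j x y
  inp i hi := by rw [h.mem]; exact hr.inp i hi

@[simp] theorem State.setReg_reg (s : State) (r v x : ℕ) :
    (s.setReg r v).reg x = if x = r then v else s.reg x := by
  simp [State.setReg, Function.update_apply]

@[simp] theorem State.setReg_mem (s : State) (r v : ℕ) : (s.setReg r v).mem = s.mem := rfl

/-- The eight instructions evaluate the nested polynomial `addr`. Every intermediate value is
dominated by `wordBound o V`, which is why that bound has its shape. -/
theorem exec_combine {W o V d : ℕ} {j : Arr} {σ : State} {x y : ℕ} (hd : 1 ≤ d)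
    (hx : σ.reg (2 * d + 1) = x) (hy : σ.reg (2 * d + 3) = y) (ho : σ.reg 1 = o)
    (hxV : x ≤ V) (hyV : y ≤ V) (hj : j.ctorIdx ≤ V) (hW : wordBound o V ≤ W) :
    ∃ σ', Exec W (combine d j) σ 8 σ' ∧ Keeps d σ σ' ∧
      σ'.reg (2 * d + 1) = addr o j x y := by
  have h₁ : pair x y ≤ pair V V := pair_mono hxV hyV
  have h₂ : pair (pair x y) j.ctorIdx ≤ pair (pair V V + V) (pair V V + V) :=
    pair_mono (by omega) (by omega)
  have h₃ : pair V V + V ≤ pair (pair V V + V) (pair V V + V) := by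
    conv_rhs => unfold pair
    exact Nat.le_add_left _ _
  unfold wordBound at hW
  have h₄ : (x + y) * (x + y) + x = pair x y := rfl
  have h₅ : (pair x y + j.ctorIdx) * (pair x y + j.ctorIdx) + pair x y =
    pair (pair x y) j.ctorIdx := rfl
  have h₆ : V + V ≤ pair V V + V := by
    have : V ≤ pair V V := Nat.le_add_left _ _
    omega
  have n₁ : d ≠ 0 := by omega
  refine ⟨_, .seq (.add _ _ _ _ ?_) (.seq (t' := 6) (.mul _ _ _ _ ?_)
    (.seq (t' := 5) (.add _ _ _ _ ?_) (.seq (t' := 4) (.const _ _ _ ?_)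
    (.seq (t' := 3) (.add _ _ _ _ ?_) (.seq (t' := 2) (.mul _ _ _ _ ?_)
    (.seq (t' := 1) (.add _ _ _ _ ?_) (.add _ _ _ _ ?_))))))), ?_, ?_⟩
  · rw [hx, hy]; omega
  · simp [hx, hy]; omega
  · simp [hx, hy]; omega
  · omega
  · simp [hx, hy, h₄]; omega
  · simp [hx, hy, h₄]; omega
  · simp [hx, hy, h₄]; omega
  · simp [hx, hy, h₄, h₅, n₁, ho]; omega
  · have e : 2 * d + 3 = 2 * (d + 1) + 1 := by ring
    rw [e]
    iterate 2 refine Keeps.setReg ?_ le_rfl _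
    iterate 3 refine Keeps.setReg ?_ (Nat.le_succ d) _
    refine Keeps.setReg ?_ le_rfl _
    iterate 2 refine Keeps.setReg ?_ (Nat.le_succ d) _
    exact Keeps.refl _ _
  · simp [hx, hy, h₄, h₅, n₁, ho, addr]

theorem le_wordBound (o V : ℕ) : V ≤ wordBound o V := Nat.le_add_left _ _

/-- Odd registers from `2 * d + 1` on serve as an evaluation stack. The second index of an array
access is computed at depth `d + 1`, so the first survives; variables occupy even registers. -/
theorem Expr.exec_compile {W o V B : ℕ} {s : Store} (hB : s.Le B) (hW : wordBound o V ≤ W)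
    (e : Expr) (hV : B + e.cost ≤ V) {d : ℕ} (hd : 1 ≤ d) {σ : State} (hr : Rep o s σ) :
    ∃ t σ', Exec W (e.compile d) σ t σ' ∧ t ≤ 10 * e.cost ∧ Keeps d σ σ' ∧
      σ'.reg (2 * d + 1) = e.eval s := by
  have hVW := (le_wordBound o V).trans hW
  induction e generalizing d σ with
  | var v =>
    have h := hB.reg v
    simp only [cost] at hV
    have hl : v.loc ≠ 2 * d + 1 := by unfold Var.loc; omega
    refine ⟨_, _, .seq (.const _ _ _ (by omega)) (.add _ _ _ _ ?_), by simp [cost], ?_, ?_⟩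
    · simp [hl, hr.reg]; omega
    · exact ((Keeps.refl _ _).setReg le_rfl _).setReg le_rfl _
    · simp [hl, hr.reg, eval]
  | lit c =>
    simp only [cost] at hV
    refine ⟨_, _, .const _ _ _ (by omega), by simp [cost]; omega, ?_, ?_⟩
    · exact (Keeps.refl _ _).setReg le_rfl _
    · simp [eval]
  | succ e ih =>
    have hl := e.eval_le hB
    simp only [cost] at hV
    obtain ⟨t, σ', he, ht, hk, hv⟩ := ih (by omega) hd hr
    refine ⟨_, _, .seq he (.seq (.const _ _ _ (by omega)) (.add _ _ _ _ ?_)),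
      by simp [cost]; omega, ?_, ?_⟩
    · simp [hv]; omega
    · exact (hk.setReg (Nat.le_succ d) _).setReg le_rfl _
    · simp [hv, eval]
  | get j e e' ih ih' =>
    have hl := e.eval_le hB
    have hl' := e'.eval_le hB
    simp only [cost] at hV
    obtain ⟨t, σ₁, he, ht, hk, hv⟩ := ih (by omega) hd hr
    have hr₁ := hk.rep hd hr
    obtain ⟨t', σ₂, he', ht', hk', hv'⟩ := ih' (by omega) (Nat.le_succ_of_le hd) hr₁
    have hr₂ := hk'.rep (Nat.le_succ_of_le hd) hr₁
    obtain ⟨σ₃, he₃, hk₃, hv₃⟩ := exec_combine hd ((hk'.reg _ (by omega)).trans hv) hv' hr₂.off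
      (V := V) (j := j) (by omega) (by omega) (by omega) hW
    have hr₃ := hk₃.rep hd hr₂
    refine ⟨_, _, .seq (.seq (.seq he he') he₃) (.load _ _ _ ?_), by simp [cost]; omega, ?_, ?_⟩
    · rw [hv₃, hr₃.arr]
      have := hB.arr j (e.eval s) (e'.eval s)
      omega
    · exact ((hk.trans hk' (Nat.le_succ d)).trans hk₃ le_rfl).setReg le_rfl _
    · simp [hv₃, hr₃.arr, eval]

/-- The code of a command. -/
def Cmd.compile : Cmd → Program
  | skip => .skip
  | assign v e => .seq (e.compile 1) (.seq (.const 5 0) (.add v.loc 3 5))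
  | write j e e' e'' => .seq (.seq (.seq (e.compile 1) (e'.compile 2)) (combine 1 j))
      (.seq (e''.compile 2) (.store 3 5))
  | input v w => .load v.loc w.loc
  | seq c c' => .seq c.compile c'.compile
  | ite e e' c c' => .seq (.seq (e.compile 1) (e'.compile 2)) (.ite 3 5 c.compile c'.compile)
  | .while e e' c => .seq (.seq (e.compile 1) (e'.compile 2))
      (.while 3 5 (.seq c.compile (.seq (e.compile 1) (e'.compile 2))))

/-- A bound for the time and the growth of numbers in one step of a command. -/
def Cmd.cost : Cmd → ℕ
  | skip => 1
  | assign _ e => 10 * e.cost + 2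
  | write j e e' e'' => 10 * (e.cost + e'.cost + e''.cost + j.ctorIdx + 1)
  | input _ _ => 1
  | seq c c' => c.cost + c'.cost
  | ite e e' c c' => 10 * (e.cost + e'.cost) + 1 + c.cost + c'.cost
  | .while e e' c => 10 * (e.cost + e'.cost) + 1 + c.cost

theorem exec_compile_two {W o V B : ℕ} {s : Store} (hB : s.Le B) (hW : wordBound o V ≤ W)
    (e e' : Expr) (hV : B + e.cost ≤ V) (hV' : B + e'.cost ≤ V) {σ : State} (hr : Rep o s σ) :
    ∃ t σ', Exec W (.seq (e.compile 1) (e'.compile 2)) σ t σ' ∧ t ≤ 10 * (e.cost + e'.cost) ∧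
      Keeps 1 σ σ' ∧ σ'.reg 3 = e.eval s ∧ σ'.reg 5 = e'.eval s := by
  obtain ⟨t, σ₁, he, ht, hk, hv⟩ := e.exec_compile hB hW hV le_rfl hr
  obtain ⟨t', σ₂, he', ht', hk', hv'⟩ := e'.exec_compile hB hW hV' (d := 2) (by omega)
    (hk.rep le_rfl hr)
  exact ⟨_, _, .seq he he', by omega, hk.trans hk' (by omega),
    (hk'.reg 3 (by omega)).trans hv, hv'⟩

theorem Rep.setReg {o : ℕ} {s : Store} {σ : State} (hr : Rep o s σ) (v : Var) (a : ℕ) :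
    Rep o (s.setReg v a) (σ.setReg v.loc a) where
  off := by
    have : 1 ≠ v.loc := by unfold Var.loc; omega
    simp [this, hr.off]
  len := hr.len
  reg w := by
    by_cases h : w = v
    · simp [h, Store.setReg]
    · have : w.loc ≠ v.loc := fun h' => h (Var.loc_inj h')
      simp [this, Store.setReg, h, hr.reg]
  arr := hr.arr
  inp := hr.inp

theorem Rep.setArr {o : ℕ} {s : Store} {σ : State} (hr : Rep o s σ) (j : Arr) (x y a : ℕ) :
    Rep o (s.setArr j x y a) (σ.setMem (addr o j x y) a) where
  off := hr.off
  len := hr.len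
  reg := hr.reg
  arr j' x' y' := by
    by_cases h : addr o j' x' y' = addr o j x y
    · obtain ⟨rfl, rfl, rfl⟩ := addr_inj h
      simp [State.setMem, Store.setArr, update₂]
    · have h' : (State.setMem σ (addr o j x y) a).mem (addr o j' x' y') = s.arr j' x' y' :=
        (Function.update_of_ne h _ _).trans (hr.arr _ _ _)
      rw [h']
      by_cases hj : j' = j
      · subst hj
        have : ¬ (x' = x ∧ y' = y) := fun ⟨hx, hy⟩ => h (by rw [hx, hy])
        simp [Store.setArr, update₂, this]
      · simp [Store.setArr, hj]
  inp i hi := by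
    refine (Function.update_of_ne ?_ _ _).trans (hr.inp i hi)
    have := hr.len
    have h₂ : o ≤ addr o j x y := Nat.le_add_left _ _
    change i < s.len at hi
    omega

theorem Store.Le.setReg {s : Store} {B : ℕ} (h : s.Le B) (v : Var) {a : ℕ} (ha : a ≤ B) :
    (s.setReg v a).Le B := by
  refine ⟨fun w => ?_, h.arr, h.inp⟩
  simp only [Store.setReg, Function.update_apply]
  split
  exacts [ha, h.reg w]

theorem Store.Le.setArr {s : Store} {B : ℕ} (h : s.Le B) (j : Arr) (x y : ℕ) {a : ℕ}
    (ha : a ≤ B) : (s.setArr j x y a).Le B := by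
  refine ⟨h.reg, fun i x' y' => ?_, h.inp⟩
  simp only [Store.setArr, Function.update_apply]
  split
  · unfold update₂
    split
    exacts [ha, h.arr _ _ _]
  · exact h.arr _ _ _

/-- One source step costs at most `Z` machine steps and raises the largest number by at most `Z`, so
`B + Z * t` bounds every number in a run of `t` steps. The bound `B` is generalized in the
induction, since the second half of a sequence starts from the larger bound left by the first. -/
theorem Cmd.exec_compile {W o Z : ℕ} {c : Cmd} {s s' : Store} {t B : ℕ} (h : c.Exec s t s')
    (hZ : c.cost ≤ Z) (hB : s.Le B) (hW : wordBound o (B + Z * t) ≤ W) {σ : State}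
    (hr : Rep o s σ) :
    s'.Le (B + Z * t) ∧
      ∃ t' σ', RAM.Exec W c.compile σ t' σ' ∧ t' ≤ Z * t ∧ Rep o s' σ' := by
  have hVW := (le_wordBound o _).trans hW
  induction h generalizing B σ with
  | skip s =>
    exact ⟨hB.mono (by omega), _, _, .skip _, by simpa [cost] using hZ, hr⟩
  | assign s v e =>
    simp only [cost] at hZ
    have hl := e.eval_le hB
    obtain ⟨t, σ₁, he, ht, hk, hv⟩ := e.exec_compile hB hW (by omega) le_rfl hr
    refine ⟨(hB.mono (by omega)).setReg v (by omega), _, _,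
      .seq he (.seq (.const _ _ _ (by omega)) (.add _ _ _ _ ?_)), by omega, ?_⟩
    · simp only [State.setReg_reg]
      norm_num
      rw [hv]
      omega
    · have hk' : Keeps 1 σ (σ₁.setReg 5 0) := hk.setReg (d' := 2) (by omega) 0
      have := (hk'.rep le_rfl hr).setReg v (e.eval s)
      convert this using 2
      simp [hv]
  | write s j e e' e'' =>
    simp only [cost] at hZ
    have hl := e.eval_le hB
    have hl' := e'.eval_le hB
    have hl'' := e''.eval_le hB
    obtain ⟨t, σ₁, he, ht, hk, hv, hv'⟩ := exec_compile_two hB hW e e' (by omega) (by omega) hr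
    have hr₁ := hk.rep le_rfl hr
    obtain ⟨σ₂, he₂, hk₂, hv₂⟩ := exec_combine le_rfl hv hv' hr₁.off
      (V := B + Z * 1) (j := j) (by omega) (by omega) (by omega) hW
    have hr₂ := hk₂.rep le_rfl hr₁
    obtain ⟨t₃, σ₃, he₃, ht₃, hk₃, hv₃⟩ := e''.exec_compile hB hW (by omega)
      (d := 2) (by omega) hr₂
    have hr₃ := hk₃.rep (by omega) hr₂
    refine ⟨(hB.mono (by omega)).setArr j _ _ (by omega), _, _,
      .seq (.seq he he₂) (.seq he₃ (.store _ _ _)), by omega, ?_⟩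
    have h₃ : σ₃.reg 3 = addr o j (e.eval s) (e'.eval s) := (hk₃.reg 3 (by omega)).trans hv₂
    have h₅ : σ₃.reg 5 = e''.eval s := hv₃
    rw [h₃, h₅]
    exact hr₃.setArr _ _ _ _
  | input s v w hi =>
    simp only [cost] at hZ
    have hv : σ.mem (σ.reg w.loc) = s.inp (s.reg w) := by rw [hr.reg, hr.inp _ hi]
    have hl := hB.inp _ hi
    refine ⟨(hB.mono (by omega)).setReg v (by omega), _, _, .load _ _ _ (by omega), by omega, ?_⟩
    rw [hv]
    exact hr.setReg _ _
  | @seq c c' s s' s'' t t' _ _ ih ih' =>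
    simp only [cost] at hZ
    rw [Nat.mul_add, ← Nat.add_assoc] at hW hVW
    obtain ⟨hB₁, t₁, σ₁, he₁, ht₁, hr₁⟩ := ih (by omega) hB
      ((wordBound_mono (by omega)).trans hW) hr (by omega)
    obtain ⟨hB₂, t₂, σ₂, he₂, ht₂, hr₂⟩ := ih' (by omega) hB₁ hW hr₁ (by omega)
    exact ⟨hB₂.mono (by rw [Nat.mul_add]; omega), _, _, .seq he₁ he₂,
      by rw [Nat.mul_add]; omega, hr₂⟩
  | @ite_true e e' c c' s s' t hc _ ih =>
    simp only [cost] at hZ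
    rw [Nat.mul_add] at hW hVW
    obtain ⟨t₀, σ₀, he, ht, hk, hv, hv'⟩ := exec_compile_two hB hW e e' (by omega) (by omega) hr
    obtain ⟨hB₁, t₁, σ₁, he₁, ht₁, hr₁⟩ := ih (by omega) hB
      ((wordBound_mono (by omega)).trans hW) (hk.rep le_rfl hr) (by omega)
    exact ⟨hB₁.mono (by rw [Nat.mul_add]; omega), _, _,
      .seq he (.ite_true (by rw [hv, hv']; exact hc) he₁), by rw [Nat.mul_add]; omega, hr₁⟩
  | @ite_false e e' c c' s s' t hc _ ih =>
    simp only [cost] at hZ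
    rw [Nat.mul_add] at hW hVW
    obtain ⟨t₀, σ₀, he, ht, hk, hv, hv'⟩ := exec_compile_two hB hW e e' (by omega) (by omega) hr
    obtain ⟨hB₁, t₁, σ₁, he₁, ht₁, hr₁⟩ := ih (by omega) hB
      ((wordBound_mono (by omega)).trans hW) (hk.rep le_rfl hr) (by omega)
    exact ⟨hB₁.mono (by rw [Nat.mul_add]; omega), _, _,
      .seq he (.ite_false (by rw [hv, hv']; exact hc) he₁), by rw [Nat.mul_add]; omega, hr₁⟩
  | @while_true e e' c s s' s'' t t' hc _ _ ih ih' =>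
    have hZ' := hZ
    simp only [cost] at hZ
    rw [Nat.mul_add, Nat.mul_add] at hW hVW
    obtain ⟨t₀, σ₀, he, ht, hk, hv, hv'⟩ := exec_compile_two hB hW e e' (by omega) (by omega) hr
    obtain ⟨hB₁, t₁, σ₁, he₁, ht₁, hr₁⟩ := ih (by omega) hB
      ((wordBound_mono (by omega)).trans hW) (hk.rep le_rfl hr) (by omega)
    obtain ⟨hB₂, t₂, σ₂, he₂, ht₂, hr₂⟩ := ih' hZ' hB₁
      ((wordBound_mono (by omega)).trans hW) hr₁ (by omega)
    -- The compiled loop evaluates its test before the loop and again at the end of the body. The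
    -- code of the remaining iterations is split here, so that its initial test evaluation can close
    -- the current body.
    cases he₂ with
    | seq ha hb =>
      exact ⟨hB₂.mono (by rw [Nat.mul_add, Nat.mul_add]; omega), _, _,
        .seq he (.while_true (by rw [hv, hv']; exact hc) (.seq he₁ ha) hb),
        by rw [Nat.mul_add, Nat.mul_add]; omega, hr₂⟩
  | @while_false e e' c s hc =>
    simp only [cost] at hZ
    obtain ⟨t₀, σ₀, he, ht, hk, hv, hv'⟩ := exec_compile_two hB hW e e' (by omega) (by omega) hr
    exact ⟨hB.mono (by omega), _, _, .seq he (.while_false (by rw [hv, hv']; exact hc)),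
      by omega, hk.rep le_rfl hr⟩

end RAM

/-! ## Equivalence of two states of a transducer by test words -/

namespace FreeGroup

/-- The element of the free group given by a positive word. -/
def ofList (l : List ℕ) : FreeGroup ℕ := FreeGroup.mk (l.map fun a => (a, true))

theorem ofList_append (l l' : List ℕ) : ofList (l ++ l') = ofList l * ofList l' := by
  simp [ofList]

/-- A positive word contains no cancelling pair, so it is its own reduced form. -/
theorem ofList_injective : Function.Injective ofList := by
  have h : ∀ l, (ofList l).toWord = l.map fun a => (a, true) := by
    intro l
    rw [ofList, toWord_mk]
    refine IsReduced.reduce_eq ?_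
    rw [IsReduced, List.isChain_map]
    exact List.isChain_iff_getElem.2 fun i hi _ => rfl
  intro l l' hl
  have h' := (h l).symm.trans ((congrArg toWord hl).trans (h l'))
  exact List.map_injective_iff.2 (fun a b hab => congrArg Prod.fst hab) h'

end FreeGroup

namespace Transducer

/-- The state that is reached from `c` by reading `w`. -/
def run (δ : ℕ → ℕ → ℕ) (c : ℕ) (w : List ℕ) : ℕ := w.foldl δ c

/-- What is written on tape `b` when the letter `a` is read in state `c`; the first tape is
`true`, and it is selected by `τ c a = 0`. -/
def chunk (τ : ℕ → ℕ → ℕ) (b : Bool) (c a : ℕ) : List ℕ :=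
  if decide (τ c a = 0) = b then [a] else []

/-- What is written on tape `b` when the word `w` is read from state `c`. -/
def out (δ τ : ℕ → ℕ → ℕ) (b : Bool) : ℕ → List ℕ → List ℕ
  | _, [] => []
  | c, a :: w => chunk τ b c a ++ out δ τ b (δ c a) w

variable {δ τ : ℕ → ℕ → ℕ}

@[simp] theorem run_nil (c : ℕ) : run δ c [] = c := rfl

@[simp] theorem run_cons (c a : ℕ) (w : List ℕ) : run δ c (a :: w) = run δ (δ c a) w := rfl

theorem run_append (c : ℕ) (w w' : List ℕ) : run δ c (w ++ w') = run δ (run δ c w) w' :=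
  List.foldl_append

@[simp] theorem out_nil (b : Bool) (c : ℕ) : out δ τ b c [] = [] := rfl

theorem out_cons (b : Bool) (c a : ℕ) (w : List ℕ) :
    out δ τ b c (a :: w) = chunk τ b c a ++ out δ τ b (δ c a) w := rfl

theorem out_append (b : Bool) (c : ℕ) (w w' : List ℕ) :
    out δ τ b c (w ++ w') = out δ τ b c w ++ out δ τ b (run δ c w) w' := by
  induction w generalizing c with
  | nil => rfl
  | cons a w ih => simp [out_cons, ih]

theorem out_snoc (b : Bool) (c : ℕ) (w : List ℕ) (a : ℕ) :
    out δ τ b c (w ++ [a]) = out δ τ b c w ++ chunk τ b (run δ c w) a := by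
  simp [out_append, out_cons]

/-- The words over the alphabet `{0, …, k - 1}`. -/
def Letters (k : ℕ) (w : List ℕ) : Prop := ∀ a ∈ w, a < k

theorem Letters.append {k : ℕ} {w w' : List ℕ} (h : Letters k w) (h' : Letters k w') :
    Letters k (w ++ w') := fun a ha => (List.mem_append.1 ha).elim (h a) (h' a)

theorem Letters.singleton {k a : ℕ} (h : a < k) : Letters k [a] := by
  intro x hx
  rw [List.mem_singleton.1 hx]
  exact h

theorem letters_append {k : ℕ} {w w' : List ℕ} :
    Letters k (w ++ w') ↔ Letters k w ∧ Letters k w' := by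
  simp [Letters, or_imp, forall_and]

/-- The states `i₁` and `i₂` accept the same words, with the same outputs. -/
def Equivalent (k : ℕ) (δ τ : ℕ → ℕ → ℕ) (F : ℕ → ℕ) (i₁ i₂ : ℕ) : Prop :=
  ∀ w, Letters k w → (0 < F (run δ i₁ w) ↔ 0 < F (run δ i₂ w)) ∧
    (0 < F (run δ i₁ w) → ∀ b, out δ τ b i₁ w = out δ τ b i₂ w)

/-- Pairs of states that are reached from `i₁` and `i₂` by a word of `M`. -/
def Merged (δ : ℕ → ℕ → ℕ) (i₁ i₂ : ℕ) (M : Set (List ℕ)) (x y : ℕ) : Prop :=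
  ∃ w ∈ M, x = run δ i₁ w ∧ y = run δ i₂ w

/-- The partition `L` of the states `0, …, n` is generated by the pairs for words of `M`,
and every successor of such a pair is represented in `W` and respects `L`. -/
structure Closed (k n : ℕ) (δ : ℕ → ℕ → ℕ) (i₁ i₂ : ℕ) (L : ℕ → ℕ) (W M : Set (List ℕ)) :
    Prop where
  lab_le : ∀ x ≤ n, L x ≤ n
  lab_lab : ∀ x ≤ n, L (L x) = L x
  nil : [] ∈ W
  sub : M ⊆ W
  snoc : ∀ w ∈ M, ∀ a < k, w ++ [a] ∈ W
  letters : ∀ w ∈ W, Letters k w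
  same : ∀ w ∈ W, L (run δ i₁ w) = L (run δ i₂ w)
  gen : ∀ x ≤ n, ∀ y ≤ n, L x = L y → Relation.EqvGen (Merged δ i₁ i₂ M) x y

/-- `0 < R c` says that `c` accepts some word, and then `X c` is such a word. -/
structure Ranked (k n : ℕ) (δ : ℕ → ℕ → ℕ) (F R : ℕ → ℕ) (X : ℕ → List ℕ) : Prop where
  letters : ∀ c ≤ n, 0 < R c → Letters k (X c)
  accept : ∀ c ≤ n, 0 < R c → 0 < F (run δ c (X c))
  final : ∀ c ≤ n, 0 < F c → 0 < R c ∧ X c = []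
  pred : ∀ c ≤ n, ∀ a < k, 0 < R (δ c a) → 0 < R c

/-- The test for the word `w`. -/
def Passes (δ τ : ℕ → ℕ → ℕ) (F : ℕ → ℕ) (i₁ i₂ : ℕ) (L R : ℕ → ℕ) (X : ℕ → List ℕ)
    (w : List ℕ) : Prop :=
  F (run δ i₁ w) = F (run δ i₂ w) ∧ (0 < R (L (run δ i₁ w)) → ∀ b,
    out δ τ b i₁ (w ++ X (L (run δ i₁ w))) = out δ τ b i₂ (w ++ X (L (run δ i₁ w))))

variable {k n i₁ i₂ : ℕ} {F L R : ℕ → ℕ} {X : ℕ → List ℕ} {W M : Set (List ℕ)}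

theorem run_le (hδ : ∀ x ≤ n, ∀ a < k, δ x a ≤ n) {x : ℕ} (hx : x ≤ n) {w : List ℕ}
    (hw : Letters k w) : run δ x w ≤ n := by
  induction w generalizing x with
  | nil => exact hx
  | cons a w ih =>
    exact ih (hδ x hx a (hw a (by simp))) fun b hb => hw b (by simp [hb])

/-- Converse to `Ranked.accept`: final states have positive rank, and this propagates backwards
along letters by `Ranked.pred`. -/
theorem Ranked.of_run (hR : Ranked k n δ F R X) (hδ : ∀ x ≤ n, ∀ a < k, δ x a ≤ n) {x : ℕ}
    (hx : x ≤ n) {w : List ℕ} (hw : Letters k w) (h : 0 < F (run δ x w)) : 0 < R x := by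
  induction w generalizing x with
  | nil => exact (hR.final x hx h).1
  | cons a w ih =>
    have ha : a < k := hw a (by simp)
    exact hR.pred x hx a ha (ih (hδ x hx a ha) (fun b hb => hw b (by simp [hb])) h)

/-- No test gives a false alarm. Merged pairs are reached by a common word and hence accept the same
words, so the continuation chosen for the label is also accepted after `w`. The bound on `F` turns
equal positivity into equal values. -/
theorem Equivalent.passes (he : Equivalent k δ τ F i₁ i₂) (hF : ∀ c ≤ n, F c ≤ 1)
    (hδ : ∀ x ≤ n, ∀ a < k, δ x a ≤ n) (h₁ : i₁ ≤ n) (h₂ : i₂ ≤ n)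
    (hC : Closed k n δ i₁ i₂ L W M) (hR : Ranked k n δ F R X) {w : List ℕ} (hw : w ∈ W) :
    Passes δ τ F i₁ i₂ L R X w := by
  have hl := hC.letters w hw
  have hp := run_le hδ h₁ hl
  have hq := run_le hδ h₂ hl
  refine ⟨?_, fun hr b => ?_⟩
  · have := (he w hl).1
    have := hF _ hp
    have := hF _ hq
    omega
  · have hn := hC.lab_le _ hp
    have hX := hR.letters _ hn hr
    have hlang : ∀ x y, Relation.EqvGen (Merged δ i₁ i₂ M) x y → ∀ v, Letters k v →
        (0 < F (run δ x v) ↔ 0 < F (run δ y v)) := by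
      intro x y h v hv
      induction h with
      | rel x y h =>
        obtain ⟨u, hu, rfl, rfl⟩ := h
        rw [← run_append, ← run_append]
        exact (he _ ((hC.letters u (hC.sub hu)).append hv)).1
      | refl => rfl
      | symm x y _ ih => exact ih.symm
      | trans x y z _ _ ih ih' => exact ih.trans ih'
    refine (he _ (hl.append hX)).2 ?_ b
    rw [run_append, hlang _ _ (hC.gen _ hp _ hn (hC.lab_lab _ hp).symm) _ hX]
    exact hR.accept _ hn hr

/-- What the state `c` writes when it reads the word chosen for its class. -/
def potential (δ τ : ℕ → ℕ → ℕ) (L : ℕ → ℕ) (X : ℕ → List ℕ) (b : Bool) (c : ℕ) :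
    FreeGroup ℕ :=
  FreeGroup.ofList (out δ τ b c (X (L c)))

/-- The heart of the correctness proof. The tests are equations between products in the free group;
division localizes them to single transitions, and the local equations are transitive over the
generated partition. -/
theorem equivalent_of_passes (hδ : ∀ x ≤ n, ∀ a < k, δ x a ≤ n) (h₁ : i₁ ≤ n) (h₂ : i₂ ≤ n)
    (hC : Closed k n δ i₁ i₂ L W M) (hR : Ranked k n δ F R X)
    (hT : ∀ w ∈ W, Passes δ τ F i₁ i₂ L R X w) : Equivalent k δ τ F i₁ i₂ := by
  -- The partition respects finality and all letters, because its generating pairs do: their words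
  -- and all one-letter extensions belong to `W`.
  have hcong : ∀ x y, Relation.EqvGen (Merged δ i₁ i₂ M) x y →
      F x = F y ∧ ∀ a < k, L (δ x a) = L (δ y a) := by
    intro x y h
    induction h with
    | rel x y h =>
      obtain ⟨u, hu, rfl, rfl⟩ := h
      refine ⟨(hT u (hC.sub hu)).1, fun a ha => ?_⟩
      simpa [run_append] using hC.same _ (hC.snoc u hu a ha)
    | refl => exact ⟨rfl, fun _ _ => rfl⟩
    | symm x y _ ih => exact ⟨ih.1.symm, fun a ha => (ih.2 a ha).symm⟩
    | trans x y z _ _ ih ih' =>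
      exact ⟨ih.1.trans ih'.1, fun a ha => (ih.2 a ha).trans (ih'.2 a ha)⟩
  have hgen := hC.gen
  have hlang : ∀ v, Letters k v → ∀ x ≤ n, ∀ y ≤ n, L x = L y → F (run δ x v) = F (run δ y v) := by
    intro v
    induction v with
    | nil => exact fun _ x hx y hy h => (hcong x y (hgen x hx y hy h)).1
    | cons a v ih =>
      intro hv x hx y hy h
      have ha : a < k := hv a (by simp)
      exact ih (fun b hb => hv b (by simp [hb])) _ (hδ x hx a ha) _ (hδ y hy a ha)
        ((hcong x y (hgen x hx y hy h)).2 a ha)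
  have hfin : ∀ x ≤ n, ∀ y ≤ n, L x = L y → F x = F y := hlang [] (by simp [Letters])
  -- Acceptance is a property of classes by `hlang`. A word accepted from the label of `δ x a`, with
  -- `a` in front, is thus accepted from the label of `x`.
  have hlive : ∀ x ≤ n, ∀ a < k, 0 < R (L (δ x a)) → 0 < R (L x) := by
    intro x hx a ha h
    have hd := hδ x hx a ha
    have hm := hC.lab_le _ hd
    have hacc := hR.accept _ hm h
    have hX := hR.letters _ hm h
    rw [hlang _ hX _ hm _ hd (hC.lab_lab _ hd)] at hacc
    have hX' : Letters k (a :: X (L (δ x a))) := (Letters.singleton ha).append hX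
    refine hR.of_run hδ (hC.lab_le x hx) hX' ?_
    rw [hlang _ hX' _ (hC.lab_le x hx) _ hx (hC.lab_lab x hx)]
    exact hacc
  -- Both runs of a test continue with the same word because the two states have the same label.
  -- This is what lets each side be written with the potential of its own state.
  have htest : ∀ w ∈ W, 0 < R (L (run δ i₁ w)) → ∀ b,
      FreeGroup.ofList (out δ τ b i₁ w) * potential δ τ L X b (run δ i₁ w) =
        FreeGroup.ofList (out δ τ b i₂ w) * potential δ τ L X b (run δ i₂ w) := by
    intro w hw hr b
    have := congrArg FreeGroup.ofList ((hT w hw).2 hr b)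
    rw [out_append, out_append, FreeGroup.ofList_append, FreeGroup.ofList_append] at this
    rw [potential, potential, ← hC.same w hw]
    exact this
  -- The local equation. For a generating pair it is the test for `u` inverted times the test for
  -- `ua`; inverses are the reason for working in the free group.
  have hkey : ∀ x y, Relation.EqvGen (Merged δ i₁ i₂ M) x y → ∀ a < k,
      L (δ x a) = L (δ y a) ∧ (0 < R (L (δ x a)) → ∀ b,
      (potential δ τ L X b x)⁻¹ * FreeGroup.ofList (chunk τ b x a) *
          potential δ τ L X b (δ x a) =
        (potential δ τ L X b y)⁻¹ * FreeGroup.ofList (chunk τ b y a) *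
          potential δ τ L X b (δ y a)) := by
    intro x y h a ha
    induction h with
    | rel x y h =>
      obtain ⟨u, hu, rfl, rfl⟩ := h
      have hu' := hC.sub hu
      have ht := htest _ (hC.snoc u hu a ha)
      have hs := hC.same _ (hC.snoc u hu a ha)
      simp only [run_append, run_cons, run_nil, out_snoc, FreeGroup.ofList_append] at ht hs
      refine ⟨hs, fun hr b => ?_⟩
      -- The test for `u` also compares outputs, since the class before the letter accepts a word if
      -- the class after it does.
      have h₃ := htest u hu' (hlive _ (run_le hδ h₁ (hC.letters u hu')) a ha hr) b
      have h₄ := ht hr b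
      have h₅ := congrArg₂ (fun g g' => g⁻¹ * g') h₃ h₄
      simpa [mul_assoc] using h₅
    | refl => exact ⟨rfl, fun _ _ => rfl⟩
    | symm x y _ ih => exact ⟨ih.1.symm, fun hr b => (ih.2 (ih.1 ▸ hr) b).symm⟩
    | trans x y z _ _ ih ih' =>
      exact ⟨ih.1.trans ih'.1, fun hr b => (ih.2 hr b).trans (ih'.2 (ih.1 ▸ hr) b)⟩
  -- The test equations extend from `W` to every word: multiplying the equation for `w` by the local
  -- equation for `a` telescopes to the one for `wa`.
  have hall : ∀ w, Letters k w → L (run δ i₁ w) = L (run δ i₂ w) ∧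
      (0 < R (L (run δ i₁ w)) → ∀ b,
        FreeGroup.ofList (out δ τ b i₁ w) * potential δ τ L X b (run δ i₁ w) =
          FreeGroup.ofList (out δ τ b i₂ w) * potential δ τ L X b (run δ i₂ w)) := by
    intro w
    induction w using List.reverseRecOn with
    | nil => exact fun _ => ⟨hC.same _ hC.nil, htest _ hC.nil⟩
    | append_singleton w a ih =>
      intro hw
      obtain ⟨hw, hw'⟩ := letters_append.1 hw
      have ha : a < k := hw' a (by simp)
      have hp := run_le hδ h₁ hw
      have hq := run_le hδ h₂ hw
      obtain ⟨hL, ih⟩ := ih hw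
      obtain ⟨hL', hk⟩ := hkey _ _ (hgen _ hp _ hq hL) a ha
      simp only [run_append, run_cons, run_nil, out_snoc, FreeGroup.ofList_append]
      refine ⟨hL', fun hr b => ?_⟩
      have h₃ := ih (hlive _ hp a ha hr) b
      have h₄ := hk hr b
      have h₅ := congrArg₂ (· * ·) h₃ h₄
      simpa [mul_assoc] using h₅
  intro w hw
  obtain ⟨hL, hall⟩ := hall w hw
  have hp := run_le hδ h₁ hw
  have hq := run_le hδ h₂ hw
  have hF' : F (run δ i₁ w) = F (run δ i₂ w) := hfin _ hp _ hq hL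
  refine ⟨by rw [hF'], fun hf b => ?_⟩
  have hf' : 0 < F (L (run δ i₁ w)) := by
    rw [hfin _ (hC.lab_le _ hp) _ hp (hC.lab_lab _ hp)]
    exact hf
  -- The label is itself final, so its chosen word is empty and both potentials are trivial.
  obtain ⟨hr, hX⟩ := hR.final _ (hC.lab_le _ hp) hf'
  have := hall hr b
  rw [potential, potential, ← hL, hX, out_nil, out_nil] at this
  exact FreeGroup.ofList_injective (mul_right_cancel this)

end Transducer

/-! ## Words as nodes of a trie -/

/-- `Node f x w`: in the trie with the child table `f`, in which `0` is the root and also the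
mark for missing children, the word `w` leads to the node `x`. -/
inductive Node (f : ℕ → ℕ → ℕ) : ℕ → List ℕ → Prop
  | root : Node f 0 []
  | child {x : ℕ} {w : List ℕ} (a : ℕ) : Node f x w → f x a ≠ 0 → Node f (f x a) (w ++ [a])

/-- The nodes are among `0, …, m`, and every node has at most one parent. -/
structure IsTrie (f : ℕ → ℕ → ℕ) (m : ℕ) : Prop where
  le : ∀ x a, f x a ≤ m
  inj : ∀ x a y b, f x a ≠ 0 → f x a = f y b → x = y ∧ a = b

/-- Parents are unique, so a node can be followed back to the root in one way only. Together with
`Node.eq`, this makes comparison of words a comparison of two numbers. -/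
theorem IsTrie.word_eq {f : ℕ → ℕ → ℕ} {m : ℕ} (h : IsTrie f m) {x : ℕ} {w w' : List ℕ}
    (hw : Node f x w) (hw' : Node f x w') : w = w' := by
  induction hw generalizing w' with
  | root =>
    generalize hx : 0 = x at hw'
    cases hw' with
    | root => rfl
    | child a _ hne => exact absurd hx.symm hne
  | @child y w a hy hne ih =>
    generalize hx : f y a = x at hw'
    cases hw' with
    | root => exact absurd hx hne
    | @child z v b hz _ =>
      obtain ⟨rfl, rfl⟩ := h.inj _ _ _ _ hne hx
      rw [ih hz]

theorem Node.eq {f : ℕ → ℕ → ℕ} {x y : ℕ} {w : List ℕ} (hx : Node f x w) (hy : Node f y w) :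
    x = y := by
  induction hx generalizing y with
  | root =>
    generalize hw : [] = w at hy
    cases hy with
    | root => rfl
    | child => simp at hw
  | @child z w a hz _ ih =>
    generalize hw : w ++ [a] = w' at hy
    cases hy with
    | root => simp at hw
    | @child z' v b hz' _ =>
      obtain ⟨rfl, hab⟩ := List.append_inj' hw rfl
      obtain rfl : a = b := by simpa using hab
      rw [ih hz']

namespace RAM

open Transducer

theorem Node.update {f : ℕ → ℕ → ℕ} {x a v : ℕ} (h : f x a = 0) {y : ℕ} {w : List ℕ}
    (hy : Node f y w) : Node (update₂ f x a v) y w := by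
  induction hy with
  | root => exact .root
  | @child z w b _ hne ih =>
    have : update₂ f x a v z b = f z b := by
      unfold update₂
      rw [if_neg]
      rintro ⟨rfl, rfl⟩
      exact hne h
    rw [← this] at hne ⊢
    exact .child b ih hne

/-- The number `m + 1` is not yet in the table, so the new node has one parent. -/
theorem IsTrie.update {f : ℕ → ℕ → ℕ} {m : ℕ} (h : IsTrie f m) (x a : ℕ) :
    IsTrie (update₂ f x a (m + 1)) (m + 1) := by
  constructor
  · intro y b
    have := h.le y b
    unfold update₂
    split <;> omega
  · intro y b z c hne heq
    have h₁ := h.le y b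
    have h₂ := h.le z c
    unfold update₂ at hne heq
    split at heq <;> split at heq
    · omega
    · omega
    · omega
    · rw [if_neg ‹_›] at hne
      exact h.inj _ _ _ _ hne heq

@[simp] theorem Store.setReg_reg (s : Store) (v w : Var) (a : ℕ) :
    (s.setReg v a).reg w = if w = v then a else s.reg w := by
  simp [Store.setReg, Function.update_apply]

@[simp] theorem Store.setReg_arr (s : Store) (v : Var) (a : ℕ) : (s.setReg v a).arr = s.arr := rfl

@[simp] theorem Store.setReg_inp (s : Store) (v : Var) (a : ℕ) : (s.setReg v a).inp = s.inp := rfl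

@[simp] theorem Store.setReg_len (s : Store) (v : Var) (a : ℕ) : (s.setReg v a).len = s.len := rfl

@[simp] theorem Store.setArr_reg (s : Store) (j : Arr) (x y a : ℕ) :
    (s.setArr j x y a).reg = s.reg := rfl

@[simp] theorem Store.setArr_arr (s : Store) (j i : Arr) (x y a : ℕ) :
    (s.setArr j x y a).arr i = if i = j then update₂ (s.arr j) x y a else s.arr i := by
  unfold Store.setArr
  simp only [Function.update_apply]

@[simp] theorem Store.setArr_inp (s : Store) (j : Arr) (x y a : ℕ) :
    (s.setArr j x y a).inp = s.inp := rfl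

@[simp] theorem Store.setArr_len (s : Store) (j : Arr) (x y a : ℕ) :
    (s.setArr j x y a).len = s.len := rfl

attribute [simp] Expr.eval

/-! ## Following a letter in two copies of a transducer -/

/-- Replace the node in `u` by its child for the letter in `a`, which is created if it does
not exist. -/
def appendLetter (u : Var) : Cmd :=
  .ite (.get .child (.var u) (.var .a)) (.lit 1)
    (.assign .ids (.succ (.var .ids)) ;; .write .child (.var u) (.var .a) (.var .ids)) .skip ;;
  .assign u (.get .child (.var u) (.var .a))

/-- Existing nodes keep their words as the trie grows. This monotonicity keeps the nodes stored in
the queue valid. -/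
theorem appendLetter_spec {u : Var} (hu : u ≠ .ids) {s : Store} {w : List ℕ}
    (hT : IsTrie (s.arr .child) (s.reg .ids)) (hn : Node (s.arr .child) (s.reg u) w) :
    Wp (appendLetter u) (fun t s' => t ≤ 4 ∧ IsTrie (s'.arr .child) (s'.reg .ids) ∧
      (∀ x v, Node (s.arr .child) x v → Node (s'.arr .child) x v) ∧
      Node (s'.arr .child) (s'.reg u) (w ++ [s.reg .a])) s := by
  rw [appendLetter, wp_seq, wp_ite]
  constructor
  · intro h
    have h0 : s.arr .child (s.reg u) (s.reg .a) = 0 := by simpa using h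
    have hm : ∀ x v, Node (s.arr .child) x v → Node (update₂ (s.arr .child) (s.reg u) (s.reg .a)
      (s.reg .ids + 1)) x v := fun x v hx => Node.update h0 hx
    simp only [wp_seq, wp_assign, wp_write, Expr.eval, Store.setReg_reg, Store.setReg_arr,
      Store.setArr_arr, Store.setArr_reg, if_true, hu, if_false, reduceCtorEq, Ne.symm hu]
    refine ⟨by omega, IsTrie.update hT _ _, hm, ?_⟩
    refine .child _ (hm _ _ hn) ?_
    simp [update₂]
  · intro h
    have h0 : s.arr .child (s.reg u) (s.reg .a) ≠ 0 := by simpa using h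
    simp only [wp_skip, wp_assign, Expr.eval, Store.setReg_reg, Store.setReg_arr, if_true,
      Ne.symm hu, if_false]
    exact ⟨by omega, hT, fun _ _ => id, .child _ hn h0⟩

/-- Append the letter in `a` to the word in `u` or in `v`, depending on the tape that is
selected in the state in `d`. -/
def emit (d u v : Var) : Cmd :=
  .ite (.get .tape (.var d) (.var .a)) (.lit 1) (appendLetter u) (appendLetter v)

theorem emit_spec {d u v : Var} (hu : u ≠ .ids) (hv : v ≠ .ids)
    (huv : u ≠ v) {s : Store} {w w' : List ℕ}
    (hT : IsTrie (s.arr .child) (s.reg .ids)) (hn : Node (s.arr .child) (s.reg u) w)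
    (hn' : Node (s.arr .child) (s.reg v) w') :
    Wp (emit d u v) (fun t s' => t ≤ 5 ∧ IsTrie (s'.arr .child) (s'.reg .ids) ∧
      (∀ x v, Node (s.arr .child) x v → Node (s'.arr .child) x v) ∧
      Node (s'.arr .child) (s'.reg u) (w ++ chunk (s.arr .tape) true (s.reg d) (s.reg .a)) ∧
      Node (s'.arr .child) (s'.reg v) (w' ++ chunk (s.arr .tape) false (s.reg d) (s.reg .a)))
      s := by
  rw [emit, wp_ite]
  constructor
  · intro h
    have h0 : s.arr .tape (s.reg d) (s.reg .a) = 0 := by simpa using h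
    refine (appendLetter_spec hu hT hn).mono fun t s' hf h => ⟨by omega, h.2.1, h.2.2.1, ?_⟩
    have hv' := hf.reg v (by simp [appendLetter, Cmd.Mod, huv.symm, hv])
    simp only [chunk, h0, decide_true, if_true, reduceCtorEq, if_false, List.append_nil, hv']
    exact ⟨h.2.2.2, h.2.2.1 _ _ hn'⟩
  · intro h
    have h0 : s.arr .tape (s.reg d) (s.reg .a) ≠ 0 := by simpa using h
    refine (appendLetter_spec hv hT hn').mono fun t s' hf h => ⟨by omega, h.2.1, h.2.2.1, ?_⟩
    have hu' := hf.reg u (by simp [appendLetter, Cmd.Mod, huv, hu])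
    simp only [chunk, h0, decide_false, if_true, reduceCtorEq, if_false, List.append_nil, hu']
    exact ⟨h.2.2.1 _ _ hn, h.2.2.2⟩

/-- The word `w` leads from `i₁` and `i₂` to `p` and `q`, and the words written on the tapes
are represented by nodes. -/
structure Track (δ τ : ℕ → ℕ → ℕ) (i₁ i₂ : ℕ) (f : ℕ → ℕ → ℕ) (w : List ℕ)
    (p q u₁ v₁ u₂ v₂ : ℕ) : Prop where
  p_eq : p = run δ i₁ w
  q_eq : q = run δ i₂ w
  u₁ : Node f u₁ (out δ τ true i₁ w)
  v₁ : Node f v₁ (out δ τ false i₁ w)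
  u₂ : Node f u₂ (out δ τ true i₂ w)
  v₂ : Node f v₂ (out δ τ false i₂ w)

theorem Track.mono {δ τ f g : ℕ → ℕ → ℕ} {i₁ i₂ p q u₁ v₁ u₂ v₂ : ℕ} {w : List ℕ}
    (h : Track δ τ i₁ i₂ f w p q u₁ v₁ u₂ v₂) (hfg : ∀ x v, Node f x v → Node g x v) :
    Track δ τ i₁ i₂ g w p q u₁ v₁ u₂ v₂ :=
  ⟨h.p_eq, h.q_eq, hfg _ _ h.u₁, hfg _ _ h.v₁, hfg _ _ h.u₂, hfg _ _ h.v₂⟩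

/-- The variables `p`, `q`, `u₁`, `v₁`, `u₂`, `v₂` describe the situation after reading `w`. -/
def Store.Tracks (s : Store) (i₁ i₂ : ℕ) (w : List ℕ) : Prop :=
  Track (s.arr .delta) (s.arr .tape) i₁ i₂ (s.arr .child) w
    (s.reg .p) (s.reg .q) (s.reg .u₁) (s.reg .v₁) (s.reg .u₂) (s.reg .v₂)

/-- Read the letter in `a`. -/
def stepPair : Cmd :=
  emit .p .u₁ .v₁ ;; emit .q .u₂ .v₂ ;;
  .assign .p (.get .delta (.var .p) (.var .a)) ;;
  .assign .q (.get .delta (.var .q) (.var .a))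

/-- Both letters are emitted before either state moves, because the selected tape depends on the
state that is left. -/
theorem stepPair_spec {s : Store} {i₁ i₂ : ℕ} {w : List ℕ}
    (hT : IsTrie (s.arr .child) (s.reg .ids)) (h : s.Tracks i₁ i₂ w) :
    Wp stepPair (fun t s' => t ≤ 12 ∧ IsTrie (s'.arr .child) (s'.reg .ids) ∧
      (∀ x v, Node (s.arr .child) x v → Node (s'.arr .child) x v) ∧
      s'.Tracks i₁ i₂ (w ++ [s.reg .a])) s := by
  rw [stepPair, wp_seq]
  refine (emit_spec (by simp) (by simp) (by simp) hT h.u₁ h.v₁).mono ?_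
  rintro t s₁ hf₁ ⟨ht, hT₁, hm₁, hu₁, hv₁⟩
  rw [wp_seq]
  have e₁ := hf₁.reg .u₂ (by simp [emit, appendLetter, Cmd.Mod])
  have e₂ := hf₁.reg .v₂ (by simp [emit, appendLetter, Cmd.Mod])
  refine (emit_spec (by simp) (by simp) (by simp) hT₁
    (by rw [e₁]; exact hm₁ _ _ h.u₂) (by rw [e₂]; exact hm₁ _ _ h.v₂)).mono ?_
  rintro t' s₂ hf₂ ⟨ht', hT₂, hm₂, hu₂, hv₂⟩
  have e₃ := hf₁.arr .tape (by simp [emit, appendLetter, Cmd.ModArr])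
  have e₄ := hf₁.arr .delta (by simp [emit, appendLetter, Cmd.ModArr])
  have e₅ := hf₂.arr .tape (by simp [emit, appendLetter, Cmd.ModArr])
  have e₆ := hf₂.arr .delta (by simp [emit, appendLetter, Cmd.ModArr])
  have e₇ := hf₁.reg .a (by simp [emit, appendLetter, Cmd.Mod])
  have e₈ := hf₂.reg .a (by simp [emit, appendLetter, Cmd.Mod])
  have e₉ := hf₁.reg .p (by simp [emit, appendLetter, Cmd.Mod])
  have e₁₀ := hf₁.reg .q (by simp [emit, appendLetter, Cmd.Mod])
  have e₁₁ := hf₂.reg .p (by simp [emit, appendLetter, Cmd.Mod])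
  have e₁₂ := hf₂.reg .q (by simp [emit, appendLetter, Cmd.Mod])
  have e₁₃ := hf₂.reg .u₁ (by simp [emit, appendLetter, Cmd.Mod])
  have e₁₄ := hf₂.reg .v₁ (by simp [emit, appendLetter, Cmd.Mod])
  simp only [wp_seq, wp_assign]
  refine ⟨by omega, hT₂, fun x v hx => hm₂ _ _ (hm₁ _ _ hx), ?_⟩
  rw [h.p_eq] at e₉ hu₁ hv₁
  rw [e₁₀, h.q_eq, e₃, e₇] at hu₂ hv₂
  rw [h.q_eq] at e₁₀
  constructor <;>
    simp only [Expr.eval, Store.setReg_reg, Store.setReg_arr, reduceCtorEq, if_true, if_false,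
      e₃, e₄, e₅, e₆, e₇, e₈, e₉, e₁₀, e₁₁, e₁₂, e₁₃, e₁₄, run_append, run_cons, run_nil,
      out_snoc]
  exacts [hm₂ _ _ hu₁, hm₂ _ _ hv₁, hu₂, hv₂]

end RAM

namespace RAM

/-! ## Counting loops -/

/-- Run `c` for `v = 0, 1, …` as long as `v < e`. -/
def Cmd.for (v : Var) (e : Expr) (c : Cmd) : Cmd :=
  .assign v (.lit 0) ;; .while (.var v) e (c ;; .assign v (.succ (.var v)))

/-- A round costs the body, the increment and the test, hence `K + 2`; the extra `2` pays for the
initial assignment and the failing test. -/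
theorem Wp.for {v : Var} {e : Expr} {c : Cmd} {Q : ℕ → Store → Prop} {s₀ : Store} (N K : ℕ)
    (J : ℕ → Store → Prop) (hv : ¬ c.Mod v) (h₀ : J 0 (s₀.setReg v 0))
    (hN : ∀ s, Frame (.for v e c) s₀ s → e.eval s = N)
    (step : ∀ i s, i < N → Frame (.for v e c) s₀ s → J i s → s.reg v = i →
      Wp c (fun t s' => t ≤ K ∧ J (i + 1) (s'.setReg v (i + 1))) s)
    (post : ∀ t s, Frame (.for v e c) s₀ s → J N s → t ≤ N * (K + 2) + 2 → Q t s) :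
    Wp (.for v e c) Q s₀ := by
  have hfr : ∀ s, Frame (.while (.var v) e (c ;; .assign v (.succ (.var v)))) (s₀.setReg v 0) s →
      Frame (.for v e c) s₀ s := fun s hf => by
    refine Frame.trans (s' := s₀.setReg v 0) ⟨rfl, rfl, fun w hw => ?_, fun _ _ => rfl⟩
      (hf.mono (fun w hw => Or.inr hw) fun w hw => Or.inr hw)
    have : w ≠ v := fun h => hw (Or.inl h)
    simp [this]
  have hfr' : ∀ s, Frame (c ;; .assign v (.succ (.var v))) (s₀.setReg v 0) s →
      Frame (.for v e c) s₀ s :=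
    fun s hf => hfr s (hf.mono (fun w hw => hw) fun w hw => hw)
  rw [Cmd.for, wp_seq, wp_assign]
  refine Wp.loop (fun m s => ∃ i ≤ N, s.reg v = i ∧ J i s ∧ m = (N - i) * (K + 2))
    ⟨0, Nat.zero_le _, by simp [Expr.eval], by simpa [Expr.eval] using h₀, rfl⟩ ?_ ?_
  · rintro m s hf ⟨i, hi, hvi, hJ, rfl⟩ hlt
    have hf' := hfr' s (hf.mono (fun w hw => hw) fun w hw => hw)
    simp only [Expr.eval] at hlt
    rw [hN s hf', hvi] at hlt
    rw [wp_seq]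
    refine (step i s hlt hf' hJ hvi).mono ?_
    rintro t s' hf'' ⟨ht, hJ'⟩
    rw [wp_assign]
    have hv' : s'.reg v = i := (hf''.reg v hv).trans hvi
    refine ⟨_, ⟨i + 1, hlt, by simp [Expr.eval, hv'], by simpa [Expr.eval, hv'] using hJ', rfl⟩, ?_⟩
    obtain ⟨d, rfl⟩ := Nat.exists_eq_add_of_lt hlt
    have h₁ : i + d + 1 - i = d + 1 := by omega
    have h₂ : i + d + 1 - (i + 1) = d := by omega
    rw [h₁, h₂, Nat.succ_mul]
    omega
  · rintro m t s hf ⟨i, hi, hvi, hJ, rfl⟩ hlt ht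
    have hf' := hfr' s (hf.mono (fun w hw => hw) fun w hw => hw)
    simp only [Expr.eval] at hlt
    rw [hN s hf', hvi] at hlt
    obtain rfl : i = N := by omega
    exact post _ _ hf' hJ (by simp at ht ⊢; omega)

@[simp] theorem update₂_apply (f : ℕ → ℕ → ℕ) (x y v x' y' : ℕ) :
    update₂ f x y v x' y' = if x' = x ∧ y' = y then v else f x' y' := rfl

/-! ## Reading the input -/

/-- The next input number is assigned to `v`. -/
def next (v : Var) : Cmd := .input v .pos ;; .assign .pos (.succ (.var .pos))

theorem wp_next {v : Var} (hv : v ≠ .pos) {Q : ℕ → Store → Prop} {s : Store} :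
    Wp (next v) Q s ↔ s.reg .pos < s.len ∧
      Q 2 ((s.setReg v (s.inp (s.reg .pos))).setReg .pos (s.reg .pos + 1)) := by
  simp [next, wp_seq, wp_input, wp_assign, Expr.eval, hv.symm]

/-- Read the two table entries of the state `c` for the letter `a`. -/
def loadLetter : Cmd :=
  next .x ;; next .y ;;
  .ite (.lit 0) (.var .x)
    (.write .delta (.var .c) (.var .a) (.get .code (.var .x) (.lit 0)) ;;
      .write .tape (.var .c) (.var .a) (.lit 0))
    (.write .delta (.var .c) (.var .a) (.get .code (.var .y) (.lit 0)) ;;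
      .write .tape (.var .c) (.var .a) (.lit 1))

/-- Read the record of the state `c`; if it is initial, assign it to `st`. -/
def loadState (k : ℕ) (st : Var) : Cmd :=
  .assign .c (.succ (.var .c)) ;;
  next .x ;; .ite (.lit 0) (.var .x) (.assign st (.var .c)) .skip ;;
  next .x ;; .write .fin (.var .c) (.lit 0) (.var .x) ;;
  .for .a (.lit k) loadLetter

/-- Assign the codes `base + 1, …, base + n` to the states of a machine. -/
def loadCodes : Cmd :=
  .assign .c (.var .base) ;;
  .for .i (.var .n) (.assign .c (.succ (.var .c)) ;;
    .write .code (.succ (.var .i)) (.lit 0) (.var .c))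

/-- Read the table of a machine. -/
def loadMachine (k : ℕ) (st : Var) : Cmd :=
  next .n ;; loadCodes ;; .assign .c (.var .base) ;; .for .i (.var .n) (loadState k st) ;;
  .assign .base (.var .c)

/-- Expressions have no addition, so the shift of table entries by `base` is tabulated in `code`.
Entry `0` is left alone: it sends a missing transition to the dead state `0`. -/
theorem loadCodes_spec (s : Store) :
    Wp loadCodes (fun t s' => t ≤ s.reg .n * 4 + 3 ∧ s'.arr .code 0 0 = s.arr .code 0 0 ∧
      ∀ i < s.reg .n, s'.arr .code (i + 1) 0 = s.reg .base + i + 1) s := by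
  rw [loadCodes, wp_seq, wp_assign]
  refine Wp.for (s.reg .n) 2 (fun i s' => s'.reg .c = s.reg .base + i ∧
    s'.arr .code 0 0 = s.arr .code 0 0 ∧
    ∀ j < i, s'.arr .code (j + 1) 0 = s.reg .base + j + 1) (by simp [Cmd.Mod]) ?_ ?_ ?_ ?_
  · simp [Expr.eval]
  · intro s' hf
    simp [Expr.eval, hf.reg .n (by simp [Cmd.Mod, Cmd.for])]
  · rintro i s' hi hf ⟨h₁, h₂, h₃⟩ hv
    simp only [wp_seq, wp_assign, wp_write, Expr.eval]
    refine ⟨le_rfl, ?_, ?_, ?_⟩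
    · simp [h₁]; omega
    · simp [h₂]
    · intro j hj
      simp only [Store.setReg_arr, Store.setArr_arr, Store.setReg_reg]
      by_cases h : j = i
      · simp [h, hv, h₁]
      · simp [h, hv, h₃ j (by omega)]
  · rintro t s' hf ⟨h₁, h₂, h₃⟩ ht
    exact ⟨by omega, h₂, h₃⟩

/-- The input from address `o` on is the table of a machine with `n` states and `k` letters. -/
structure TableAt (inp : ℕ → ℕ) (len o k n : ℕ) (ini fin : ℕ → ℕ) (lft rgt : ℕ → ℕ → ℕ) :
    Prop where
  num : inp o = n
  ini : ∀ i < n, inp (o + 1 + i * (2 * k + 2)) = ini i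
  fin : ∀ i < n, inp (o + 1 + i * (2 * k + 2) + 1) = fin i
  lft : ∀ i < n, ∀ a < k, inp (o + 1 + i * (2 * k + 2) + 2 + 2 * a) = lft i a
  rgt : ∀ i < n, ∀ a < k, inp (o + 1 + i * (2 * k + 2) + 2 + 2 * a + 1) = rgt i a
  len : o + 1 + n * (2 * k + 2) ≤ len

/-- The target of a transition, in terms of the table entries `l`, `r` for the two tapes. -/
def target (base l r : ℕ) : ℕ := if 0 < l then base + l else if 0 < r then base + r else 0

/-- The tape of a transition, in terms of the table entry for the first tape. -/
def side (l : ℕ) : ℕ := if 0 < l then 0 else 1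

/-- The entries of the state tables for the state `c`. -/
structure StateAt (s : Store) (k c base fin : ℕ) (lft rgt : ℕ → ℕ) : Prop where
  fin : s.arr .fin c 0 = fin
  delta : ∀ a < k, s.arr .delta c a = target base (lft a) (rgt a)
  tape : ∀ a < k, s.arr .tape c a = side (lft a)

theorem loadLetters_spec {s : Store} {k n base : ℕ} {lft rgt : ℕ → ℕ}
    (hl : ∀ a < k, s.inp (s.reg .pos + 2 * a) = lft a)
    (hr : ∀ a < k, s.inp (s.reg .pos + 2 * a + 1) = rgt a)
    (hl' : ∀ a < k, lft a ≤ n) (hr' : ∀ a < k, rgt a ≤ n)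
    (hlen : s.reg .pos + 2 * k ≤ s.len)
    (hcode₀ : s.arr .code 0 0 = 0) (hcode : ∀ i < n, s.arr .code (i + 1) 0 = base + i + 1) :
    Wp (.for .a (.lit k) loadLetter) (fun t s' => t ≤ k * 9 + 2 ∧
      s'.reg .pos = s.reg .pos + 2 * k ∧
      (∀ a < k, s'.arr .delta (s.reg .c) a = target base (lft a) (rgt a)) ∧
      (∀ a < k, s'.arr .tape (s.reg .c) a = side (lft a)) ∧
      ∀ c ≠ s.reg .c, s'.arr .delta c = s.arr .delta c ∧ s'.arr .tape c = s.arr .tape c) s := by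
  refine Wp.for k 7 (fun i s' => s'.reg .pos = s.reg .pos + 2 * i ∧
      (∀ a < i, s'.arr .delta (s.reg .c) a = target base (lft a) (rgt a)) ∧
      (∀ a < i, s'.arr .tape (s.reg .c) a = side (lft a)) ∧
      ∀ c ≠ s.reg .c, s'.arr .delta c = s.arr .delta c ∧ s'.arr .tape c = s.arr .tape c)
      (by simp [Cmd.Mod, loadLetter, next]) ?_ ?_ ?_ ?_
  · simp
  · simp [Expr.eval]
  · rintro i s' hi hf ⟨h₁, h₂, h₃, h₄⟩ hv
    have ec := hf.reg .c (by simp [Cmd.Mod, Cmd.for, loadLetter, next])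
    have ecode := hf.arr .code (by simp [Cmd.ModArr, Cmd.for, loadLetter, next])
    have hcode' : ∀ l, 0 < l → l ≤ n → s.arr .code l 0 = base + l := by
      intro l hl hln
      have := hcode (l - 1) (by omega)
      rw [show l - 1 + 1 = l by omega] at this
      rw [this]
      omega
    have i₁ := hl i hi
    have i₂ := hr i hi
    simp only [loadLetter, wp_seq, wp_next (v := .x) (by simp), wp_next (v := .y) (by simp), wp_ite,
      wp_write, Expr.eval, Store.setReg_reg, Store.setReg_arr, Store.setReg_inp, Store.setReg_len,
      Store.setArr_arr, Store.setArr_reg, reduceCtorEq, if_true, if_false, h₁, hf.inp, hf.len,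
      i₁, i₂, ec, ecode, hv]
    refine ⟨by omega, by omega, fun hpos => ⟨by omega, by omega, ?_, ?_, ?_⟩,
      fun hpos => ⟨by omega, by omega, ?_, ?_, ?_⟩⟩
    · intro b hb
      by_cases hbi : b = i
      · simp [hbi, target, hpos, hcode' _ hpos (hl' i hi)]
      · simp [hbi, h₂ b (by omega)]
    · intro b hb
      by_cases hbi : b = i
      · simp [hbi, side, hpos]
      · simp [hbi, h₃ b (by omega)]
    · intro c hc
      rw [← (h₄ c hc).1, ← (h₄ c hc).2]
      constructor <;> funext b <;> simp [hc]
    · intro b hb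
      by_cases hbi : b = i
      · rcases Nat.eq_zero_or_pos (rgt i) with h0 | h0
        · simp [hbi, target, hpos, h0, hcode₀]
        · simp [hbi, target, hpos, h0, hcode' _ h0 (hr' i hi)]
      · simp [hbi, h₂ b (by omega)]
    · intro b hb
      by_cases hbi : b = i
      · simp [hbi, side, hpos]
      · simp [hbi, h₃ b (by omega)]
    · intro c hc
      rw [← (h₄ c hc).1, ← (h₄ c hc).2]
      constructor <;> funext b <;> simp [hc]
  · rintro t s' hf ⟨h₁, h₂, h₃, h₄⟩ ht
    exact ⟨by omega, h₁, h₂, h₃, h₄⟩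

theorem loadState_spec {s : Store} {k n base ini fin : ℕ} {st : Var} {lft rgt : ℕ → ℕ}
    (hst : st = .start₁ ∨ st = .start₂)
    (hi : s.inp (s.reg .pos) = ini) (hf : s.inp (s.reg .pos + 1) = fin)
    (hl : ∀ a < k, s.inp (s.reg .pos + 2 + 2 * a) = lft a)
    (hr : ∀ a < k, s.inp (s.reg .pos + 2 + 2 * a + 1) = rgt a)
    (hl' : ∀ a < k, lft a ≤ n) (hr' : ∀ a < k, rgt a ≤ n)
    (hlen : s.reg .pos + (2 * k + 2) ≤ s.len)
    (hcode₀ : s.arr .code 0 0 = 0) (hcode : ∀ i < n, s.arr .code (i + 1) 0 = base + i + 1) :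
    Wp (loadState k st) (fun t s' => t ≤ k * 9 + 10 ∧ s'.reg .pos = s.reg .pos + (2 * k + 2) ∧
      s'.reg .c = s.reg .c + 1 ∧ s'.reg st = (if 0 < ini then s.reg .c + 1 else s.reg st) ∧
      StateAt s' k (s.reg .c + 1) base fin lft rgt ∧
      ∀ c ≠ s.reg .c + 1, s'.arr .fin c 0 = s.arr .fin c 0 ∧
        s'.arr .delta c = s.arr .delta c ∧ s'.arr .tape c = s.arr .tape c) s := by
  have hst' : st ≠ .pos ∧ st ≠ .c ∧ st ≠ .x ∧ st ≠ .y ∧ st ≠ .a := by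
    rcases hst with rfl | rfl <;> simp
  obtain ⟨n₁, n₂, n₃, n₄, n₅⟩ := hst'
  have hrest : ∀ s₁ : Store, s₁.reg .pos = s.reg .pos + 1 → s₁.reg .c = s.reg .c + 1 →
      s₁.arr = s.arr → s₁.inp = s.inp → s₁.len = s.len →
      Wp (next .x ;; .write .fin (.var .c) (.lit 0) (.var .x) ;; .for .a (.lit k) loadLetter)
      (fun t s' => t ≤ k * 9 + 5 ∧ s'.reg .pos = s.reg .pos + (2 * k + 2) ∧
      s'.reg .c = s.reg .c + 1 ∧ s'.reg st = s₁.reg st ∧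
      StateAt s' k (s.reg .c + 1) base fin lft rgt ∧
      ∀ c ≠ s.reg .c + 1, s'.arr .fin c 0 = s.arr .fin c 0 ∧
        s'.arr .delta c = s.arr .delta c ∧ s'.arr .tape c = s.arr .tape c) s₁ := by
    intro s₁ e₁ e₂ e₃ e₄ e₅
    rw [wp_seq, wp_next (by simp), e₁, e₄, e₅, hf]
    refine ⟨by omega, ?_⟩
    rw [wp_seq, wp_write]
    simp only [Expr.eval, Store.setReg_reg, reduceCtorEq, if_true, if_false, e₂]
    refine (loadLetters_spec (n := n) (base := base) (lft := lft) (rgt := rgt)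
      ?_ ?_ hl' hr' ?_ ?_ ?_).mono ?_
    · simpa [e₄] using hl
    · simpa [e₄] using hr
    · simp [e₅]; omega
    · simpa [e₃] using hcode₀
    · simpa [e₃] using hcode
    · simp only [Store.setReg_reg, Store.setReg_arr, Store.setArr_reg, Store.setArr_arr,
        reduceCtorEq, if_true, if_false, e₂, e₃]
      rintro t s' hfr ⟨ht, h₁, h₂, h₃, h₄⟩
      have ec := hfr.reg .c (by simp [Cmd.Mod, Cmd.for, loadLetter, next])
      have est := hfr.reg st (by simp [Cmd.Mod, Cmd.for, loadLetter, next, *])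
      have efin := hfr.arr .fin (by simp [Cmd.ModArr, Cmd.for, loadLetter, next])
      refine ⟨by omega, by omega, by simpa [e₂] using ec, by simpa [n₁, n₃] using est,
        ⟨by simp [efin], h₂, h₃⟩, fun c hc => ⟨?_, h₄ c hc⟩⟩
      simp [efin, hc, e₃]
  rw [loadState, wp_seq, wp_assign, wp_seq, wp_next (by simp)]
  simp only [Store.setReg_reg, Store.setReg_inp, Store.setReg_len, reduceCtorEq, if_false,
    hi]
  refine ⟨by omega, ?_⟩
  rw [wp_seq, wp_ite]
  simp only [Expr.eval, Store.setReg_reg, reduceCtorEq, if_true, if_false, wp_assign, wp_skip]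
  constructor
  · intro hpos
    refine Wp.mono (hrest _ ?_ ?_ ?_ ?_ ?_) ?_
    · simp [n₁.symm]
    · simp [n₂.symm]
    iterate 3 rfl
    rintro t s' hfr ⟨ht, h₁, h₂, h₃, h₄⟩
    exact ⟨by omega, h₁, h₂, by simpa [hpos] using h₃, h₄⟩
  · intro hpos
    refine Wp.mono (hrest _ ?_ ?_ ?_ ?_ ?_) ?_
    · simp
    · simp
    iterate 3 rfl
    rintro t s' hfr ⟨ht, h₁, h₂, h₃, h₄⟩
    exact ⟨by omega, h₁, h₂, by simpa [hpos, n₁, n₂, n₃] using h₃, h₄⟩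

/-- The machine fills the rows after `base` and leaves all others untouched, so two machines can be
loaded one after the other into the same tables. -/
theorem loadMachine_spec {s : Store} {k n : ℕ} {st : Var} {ini fin : ℕ → ℕ} {lft rgt : ℕ → ℕ → ℕ}
    (hst : st = .start₁ ∨ st = .start₂)
    (hT : TableAt s.inp s.len (s.reg .pos) k n ini fin lft rgt)
    (hl : ∀ i < n, ∀ a < k, lft i a ≤ n) (hr : ∀ i < n, ∀ a < k, rgt i a ≤ n)
    (hcode : s.arr .code 0 0 = 0) {i₀ : ℕ} (hi₀ : i₀ < n) (hini : 0 < ini i₀)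
    (hini' : ∀ i < n, 0 < ini i → i = i₀) :
    Wp (loadMachine k st) (fun t s' => t ≤ n * (k * 9 + 16) + 10 ∧
      s'.reg .pos = s.reg .pos + 1 + n * (2 * k + 2) ∧ s'.reg .base = s.reg .base + n ∧
      s'.reg st = s.reg .base + i₀ + 1 ∧ s'.arr .code 0 0 = 0 ∧
      (∀ i < n, StateAt s' k (s.reg .base + i + 1) (s.reg .base) (fin i) (lft i) (rgt i)) ∧
      ∀ c, c ≤ s.reg .base ∨ s.reg .base + n < c → s'.arr .fin c 0 = s.arr .fin c 0 ∧
        s'.arr .delta c = s.arr .delta c ∧ s'.arr .tape c = s.arr .tape c) s := by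
  have hlen := hT.len
  rw [loadMachine, wp_seq, wp_next (by simp)]
  refine ⟨by omega, ?_⟩
  rw [wp_seq]
  refine (loadCodes_spec _).mono ?_
  simp only [Store.setReg_reg, Store.setReg_arr, reduceCtorEq, if_true, if_false, hT.num]
  rintro t₁ s₁ hf₁ ⟨ht₁, hc₁, hc₁'⟩
  rw [wp_seq, wp_assign, wp_seq]
  have en := hf₁.reg .n (by simp [Cmd.Mod, Cmd.for, loadCodes])
  have ebase := hf₁.reg .base (by simp [Cmd.Mod, Cmd.for, loadCodes])
  have epos := hf₁.reg .pos (by simp [Cmd.Mod, Cmd.for, loadCodes])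
  have efin := hf₁.arr .fin (by simp [Cmd.ModArr, Cmd.for, loadCodes])
  have edelta := hf₁.arr .delta (by simp [Cmd.ModArr, Cmd.for, loadCodes])
  have etape := hf₁.arr .tape (by simp [Cmd.ModArr, Cmd.for, loadCodes])
  have einp := hf₁.inp
  have elen := hf₁.len
  simp only [Store.setReg_reg, Store.setReg_arr, Store.setReg_inp, Store.setReg_len, reduceCtorEq,
    if_true, if_false] at en ebase epos efin edelta etape einp elen
  have hmod : ∀ v, (v = .n ∨ v = .base) → ¬ (Cmd.for .i (.var .n) (loadState k st)).Mod v := by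
    rintro v (rfl | rfl) <;> rcases hst with rfl | rfl <;>
      simp [Cmd.Mod, Cmd.for, loadState, loadLetter, next]
  have hmod' : ∀ v, (v = .n ∨ v = .i) → ¬ (loadState k st).Mod v := by
    rintro v (rfl | rfl) <;> rcases hst with rfl | rfl <;>
      simp [Cmd.Mod, Cmd.for, loadState, loadLetter, next]
  have hst' : st ≠ .c ∧ st ≠ .i ∧ st ≠ .base := by
    rcases hst with rfl | rfl <;> simp
  -- The value of `st` is known only once record `i₀` has been read; uniqueness of the initial state
  -- keeps it from being overwritten later.
  refine Wp.for n (k * 9 + 10) (fun i s' => s'.reg .pos = s.reg .pos + 1 + i * (2 * k + 2) ∧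
    s'.reg .c = s.reg .base + i ∧ (i₀ < i → s'.reg st = s.reg .base + i₀ + 1) ∧
    (∀ j < i, StateAt s' k (s.reg .base + j + 1) (s.reg .base) (fin j) (lft j) (rgt j)) ∧
      ∀ c, c ≤ s.reg .base ∨ s.reg .base + i < c → s'.arr .fin c 0 = s.arr .fin c 0 ∧
        s'.arr .delta c = s.arr .delta c ∧ s'.arr .tape c = s.arr .tape c)
      (hmod' _ (by simp)) ?_ ?_ ?_ ?_
  · simp [epos, ebase, efin, edelta, etape]
  · intro s' hf
    simpa [en] using hf.reg .n (hmod _ (by simp))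
  · rintro i s' hi hf ⟨h₁, h₂, h₃, h₄, h₅⟩ hv
    have ecode := hf.arr .code
      (by simp [Cmd.ModArr, Cmd.for, loadState, loadLetter, next])
    have einp' := hf.inp
    have elen' := hf.len
    simp only [Store.setReg_arr, Store.setReg_inp, Store.setReg_len] at ecode einp' elen'
    rw [einp] at einp'
    rw [elen] at elen'
    have hle : (i + 1) * (2 * k + 2) ≤ n * (2 * k + 2) := Nat.mul_le_mul_right _ hi
    rw [Nat.succ_mul] at hle
    refine (loadState_spec (n := n) (base := s.reg .base) (ini := ini i) (fin := fin i)
      (lft := lft i) (rgt := rgt i) hst ?_ ?_ ?_ ?_ (hl i hi) (hr i hi) ?_ ?_ ?_).mono ?_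
    · rw [einp', h₁, hT.ini i hi]
    · rw [einp', h₁, hT.fin i hi]
    · rw [einp', h₁]; exact hT.lft i hi
    · rw [einp', h₁]; exact hT.rgt i hi
    · rw [elen', h₁]; omega
    · rw [ecode, hc₁, hcode]
    · rw [ecode]; exact hc₁'
    · rintro t s'' hf' ⟨ht, g₁, g₂, g₃, g₄, g₅⟩
      rw [h₂] at g₂ g₃ g₄ g₅
      refine ⟨ht, ?_, ?_, ?_, ?_, ?_⟩
      · simp [g₁, h₁, Nat.succ_mul]; omega
      · simp [g₂]; omega
      · intro hlt
        simp only [Store.setReg_reg, hst'.2.1, if_false, g₃]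
        by_cases hii : i = i₀
        · rw [hii, if_pos hini]
        · rw [if_neg fun h => hii (hini' i hi h)]
          exact h₃ (by omega)
      · intro j hj
        by_cases hji : j = i
        · subst hji
          exact ⟨g₄.fin, g₄.delta, g₄.tape⟩
        · obtain ⟨q₁, q₂, q₃⟩ := g₅ (s.reg .base + j + 1) (by omega)
          have := h₄ j (by omega)
          exact ⟨q₁.trans this.fin, fun a ha => (congrFun q₂ a).trans (this.delta a ha),
            fun a ha => (congrFun q₃ a).trans (this.tape a ha)⟩
      · intro c hc
        obtain ⟨q₁, q₂, q₃⟩ := g₅ c (by omega)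
        obtain ⟨p₁, p₂, p₃⟩ := h₅ c (by omega)
        exact ⟨q₁.trans p₁, q₂.trans p₂, q₃.trans p₃⟩
  · rintro t s' hf ⟨h₁, h₂, h₃, h₄, h₅⟩ ht
    have ecode := hf.arr .code
      (by simp [Cmd.ModArr, Cmd.for, loadState, loadLetter, next])
    rw [wp_assign]
    refine ⟨?_, ?_, ?_, ?_, ?_, ?_, ?_⟩
    · have e₁ : n * (k * 9 + 16) = n * (k * 9 + 10 + 2) + n * 4 := by ring
      omega
    · simp [h₁]
    · simp [h₂]
    · simpa [hst'.2.2] using h₃ hi₀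
    · simpa [hc₁, hcode] using congrFun (congrFun ecode 0) 0
    · exact fun i hi => ⟨(h₄ i hi).fin, (h₄ i hi).delta, (h₄ i hi).tape⟩
    · exact h₅

end RAM

namespace RAM

open Transducer

/-! ## States from which a final state can be reached -/

/-- Mark the state `c` if it is not marked and the letter `a` leads to a marked state. -/
def markLetter : Cmd :=
  .ite (.get .rank (.var .c) (.lit 0)) (.lit 1)
    (.ite (.lit 0) (.get .rank (.get .delta (.var .c) (.var .a)) (.lit 0))
      (.write .rank (.var .c) (.lit 0) (.var .cnt) ;; .write .next (.var .c) (.lit 0) (.var .a) ;;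
        .assign .cnt (.succ (.var .cnt)))
      .skip)
    .skip

/-- Mark the state `c` if it is not marked, and it is final or a letter leads to a
marked state. -/
def markState (k : ℕ) : Cmd :=
  .ite (.get .rank (.var .c) (.lit 0)) (.lit 1)
    (.ite (.lit 0) (.get .fin (.var .c) (.lit 0))
      (.write .rank (.var .c) (.lit 0) (.var .cnt) ;; .assign .cnt (.succ (.var .cnt)))
      (.for .a (.lit k) markLetter))
    .skip

/-- Mark all states from which a final state can be reached, by positive numbers that
decrease along the letters in the array `next`. -/
def rankStates (k : ℕ) : Cmd :=
  .assign .old (.lit 0) ;; .assign .cnt (.lit 1) ;;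
  .while (.var .old) (.var .cnt)
    (.assign .old (.var .cnt) ;; .for .c (.var .size) (markState k))

/-- The invariant of the marking: `R` are the marks, `N` the chosen letters, and `m` is the next
mark. -/
structure Marking (n k : ℕ) (δ : ℕ → ℕ → ℕ) (F R N : ℕ → ℕ) (m : ℕ) : Prop where
  lt : ∀ c, R c < m
  step : ∀ c ≤ n, 0 < R c →
    0 < F c ∨ (F c = 0 ∧ N c < k ∧ 0 < R (δ c (N c)) ∧ R (δ c (N c)) < R c)
  count : m = 1 + ((Finset.range (n + 1)).filter fun c => 0 < R c).card

theorem Marking.le {n k m : ℕ} {δ : ℕ → ℕ → ℕ} {F R N : ℕ → ℕ} (h : Marking n k δ F R N m) :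
    m ≤ n + 2 := by
  have h₁ := h.count
  have h₂ := Finset.card_filter_le (Finset.range (n + 1)) fun c => 0 < R c
  rw [Finset.card_range] at h₂
  omega

/-- The new mark `m` exceeds all earlier ones, so marks decrease along the newly chosen letter.
Links that already exist end in marked states, hence not in `c`, and are unaffected. -/
theorem Marking.mark {n k m : ℕ} {δ : ℕ → ℕ → ℕ} {F R N R' N' : ℕ → ℕ}
    (h : Marking n k δ F R N m) {c : ℕ} (hc : c ≤ n) (h0 : R c = 0)
    (hR : ∀ x, R' x = if x = c then m else R x) (hN : ∀ x, x ≠ c → N' x = N x)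
    (hs : 0 < F c ∨ (F c = 0 ∧ N' c < k ∧ 0 < R (δ c (N' c)))) :
    Marking n k δ F R' N' (m + 1) := by
  have hm : 0 < m := by have := h.count; omega
  constructor
  · intro x
    have := h.lt x
    rw [hR]
    split <;> omega
  · intro x hx hpos
    by_cases hxc : x = c
    · subst hxc
      refine hs.imp_right fun ⟨hF, hk, hr⟩ => ⟨hF, hk, ?_⟩
      have hne : δ x (N' x) ≠ x := fun he => by rw [he, h0] at hr; omega
      rw [hR, hR x, if_neg hne, if_pos rfl]
      exact ⟨hr, h.lt _⟩
    · rw [hR, if_neg hxc] at hpos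
      refine (h.step x hx hpos).imp_right fun ⟨hF, hk, hr, hr'⟩ => ?_
      have hne : δ x (N x) ≠ c := fun he => by rw [he, h0] at hr; omega
      rw [hN x hxc, hR, hR x, if_neg hne, if_neg hxc]
      exact ⟨hF, hk, hr, hr'⟩
  · have : ((Finset.range (n + 1)).filter fun c => 0 < R' c) =
        insert c ((Finset.range (n + 1)).filter fun c => 0 < R c) := by
      ext x
      simp only [Finset.mem_filter, Finset.mem_insert, Finset.mem_range, hR]
      by_cases hx : x = c
      · simp [hx, hm]; omega
      · simp [hx]
    rw [this, Finset.card_insert_of_notMem (by simp [h0]), h.count]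
    omega

/-- The marking that is stored in `s`. -/
def Store.Marks (s : Store) (n k : ℕ) : Prop :=
  Marking n k (s.arr .delta) (s.arr .fin · 0) (s.arr .rank · 0) (s.arr .next · 0) (s.reg .cnt)

theorem markLetter_spec {s : Store} {n k : ℕ} (h : s.Marks n k) (hc : s.reg .c ≤ n)
    (ha : s.reg .a < k) (hF : s.arr .fin (s.reg .c) 0 = 0) :
    Wp markLetter (fun t s' => t ≤ 5 ∧ s'.Marks n k ∧ (s.reg .cnt < s'.reg .cnt ∨
      s'.reg .cnt = s.reg .cnt ∧ s'.arr .rank = s.arr .rank ∧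
        (0 < s.arr .rank (s.arr .delta (s.reg .c) (s.reg .a)) 0 →
          0 < s.arr .rank (s.reg .c) 0))) s := by
  simp only [markLetter, wp_ite, wp_seq, wp_write, wp_assign, wp_skip, Expr.eval]
  refine ⟨fun h0 => ⟨fun h1 => ⟨by omega, ?_, Or.inl (by simp)⟩, fun h1 =>
    ⟨by omega, h, Or.inr ⟨trivial, trivial, fun h2 => absurd h2 h1⟩⟩⟩, fun h0 =>
    ⟨by omega, h, Or.inr ⟨trivial, trivial, fun _ => by omega⟩⟩⟩
  refine Marking.mark h hc (Nat.lt_one_iff.1 h0) (fun x => ?_) (fun x hx => ?_) (Or.inr ?_)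
  · simp
  · simp [hx]
  · simpa [ha, hF] using h1

/-- Either the counter rises, or no mark changes and the closure conditions already hold at `c`. The
second alternative certifies the result when a whole round leaves the counter fixed. -/
theorem markState_spec {s : Store} {n k : ℕ} (h : s.Marks n k) (hc : s.reg .c ≤ n) :
    Wp (markState k) (fun t s' => t ≤ k * 7 + 4 ∧ s'.Marks n k ∧ (s.reg .cnt < s'.reg .cnt ∨
      s'.reg .cnt = s.reg .cnt ∧ s'.arr .rank = s.arr .rank ∧
        (0 < s.arr .fin (s.reg .c) 0 → 0 < s.arr .rank (s.reg .c) 0) ∧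
        ∀ a < k, 0 < s.arr .rank (s.arr .delta (s.reg .c) a) 0 →
          0 < s.arr .rank (s.reg .c) 0)) s := by
  simp only [markState, wp_ite, wp_seq, wp_write, wp_assign, wp_skip, Expr.eval]
  refine ⟨fun h0 => ⟨fun h1 => ⟨by omega, ?_, Or.inl (by simp)⟩, fun h1 => ?_⟩,
    fun h0 => ⟨by omega, h, Or.inr ⟨trivial, trivial, fun _ => by omega, fun _ _ _ => by omega⟩⟩⟩
  · refine Marking.mark h hc (Nat.lt_one_iff.1 h0) (fun x => ?_) (fun x hx => ?_) (Or.inl h1)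
    · simp
    · simp
  · refine Wp.for k 5 (fun i s' => s'.Marks n k ∧ (s.reg .cnt < s'.reg .cnt ∨
      s'.reg .cnt = s.reg .cnt ∧ s'.arr .rank = s.arr .rank ∧
        ∀ a < i, 0 < s.arr .rank (s.arr .delta (s.reg .c) a) 0 →
          0 < s.arr .rank (s.reg .c) 0)) (by simp [Cmd.Mod, markLetter]) ?_ ?_ ?_ ?_
    · exact ⟨h, Or.inr ⟨rfl, rfl, by simp⟩⟩
    · simp
    · rintro i s' hi hf ⟨h₁, h₂⟩ hv
      have ec := hf.reg .c (by simp [Cmd.Mod, Cmd.for, markLetter])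
      have ed := hf.arr .delta (by simp [Cmd.ModArr, Cmd.for, markLetter])
      have ef := hf.arr .fin (by simp [Cmd.ModArr, Cmd.for, markLetter])
      refine (markLetter_spec h₁ (by omega) (by omega) (by rw [ec, ef]; omega)).mono ?_
      rintro t s'' hf' ⟨ht, g₁, g₂⟩
      refine ⟨ht, g₁, ?_⟩
      simp only [Store.setReg_reg, Store.setReg_arr, reduceCtorEq, if_false]
      rcases g₂ with g₂ | ⟨g₂, g₃, g₄⟩ <;> rcases h₂ with h₂ | ⟨h₂, h₃, h₄⟩
      · exact Or.inl (by omega)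
      · exact Or.inl (by omega)
      · exact Or.inl (by omega)
      · refine Or.inr ⟨by omega, g₃.trans h₃, fun b hb => ?_⟩
        by_cases hbi : b = i
        · rw [h₃, ed, ec, hv] at g₄
          rw [hbi]
          exact g₄
        · exact h₄ b (by omega)
    · rintro t s' hf ⟨h₁, h₂⟩ ht
      refine ⟨by omega, h₁, h₂.imp_right fun ⟨h₃, h₄, h₅⟩ => ⟨h₃, h₄, fun h => absurd h h1, h₅⟩⟩

/-- Every round begins with `old < cnt` and ends with `old` equal to the counter at its beginning.
As the counter never exceeds `n + 2`, there are at most `n + 2` linear rounds. -/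
theorem rankStates_spec {s : Store} {n k : ℕ} (hn : s.reg .size = n + 1)
    (h0 : ∀ c, s.arr .rank c 0 = 0) :
    Wp (rankStates k) (fun t s' => t ≤ (n + 2) * ((n + 1) * (k * 7 + 6) + 4) + 3 ∧ s'.Marks n k ∧
      ∀ c ≤ n, (0 < s'.arr .fin c 0 → 0 < s'.arr .rank c 0) ∧
        ∀ a < k, 0 < s'.arr .rank (s'.arr .delta c a) 0 → 0 < s'.arr .rank c 0) s := by
  simp only [rankStates, wp_seq, wp_assign, Expr.eval]
  refine Wp.loop (m₀ := (n + 2) * ((n + 1) * (k * 7 + 6) + 4)) (fun m s' => s'.Marks n k ∧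
    s'.reg .old ≤ s'.reg .cnt ∧ m = (n + 2 - s'.reg .old) * ((n + 1) * (k * 7 + 6) + 4) ∧
    (s'.reg .old = s'.reg .cnt →
    ∀ c ≤ n, (0 < s'.arr .fin c 0 → 0 < s'.arr .rank c 0) ∧
        ∀ a < k, 0 < s'.arr .rank (s'.arr .delta c a) 0 → 0 < s'.arr .rank c 0)) ?_ ?_ ?_
  · refine ⟨⟨?_, ?_, ?_⟩, ?_, ?_, ?_⟩ <;> simp [h0]
  · rintro m s₁ hf ⟨h₁, h₂, rfl, -⟩ hlt
    simp only [Expr.eval] at hlt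
    have esize := hf.reg .size (by simp [Cmd.Mod, Cmd.for, markState, markLetter])
    simp only [Store.setReg_reg, reduceCtorEq, if_false, hn] at esize
    rw [wp_seq, wp_assign]
    refine Wp.for (n + 1) (k * 7 + 4) (fun i s' => s'.Marks n k ∧
      s₁.reg .cnt ≤ s'.reg .cnt ∧ s'.reg .old = s₁.reg .cnt ∧ (s₁.reg .cnt = s'.reg .cnt →
        ∀ c < i, (0 < s'.arr .fin c 0 → 0 < s'.arr .rank c 0) ∧
        ∀ a < k, 0 < s'.arr .rank (s'.arr .delta c a) 0 → 0 < s'.arr .rank c 0))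
      (by simp [Cmd.Mod, Cmd.for, markState, markLetter]) ?_ ?_ ?_ ?_
    · exact ⟨h₁, by simp, by simp, by simp⟩
    · intro s' hf
      simpa [esize] using hf.reg .size (by simp [Cmd.Mod, Cmd.for, markState, markLetter])
    · rintro i s' hi hf' ⟨g₁, g₂, g₃, g₄⟩ hv
      refine (markState_spec g₁ (by omega)).mono ?_
      rintro t s'' hf'' ⟨ht, q₁, q₂⟩
      have ed := hf''.arr .delta (by simp [Cmd.ModArr, Cmd.for, markState, markLetter])
      have ef := hf''.arr .fin (by simp [Cmd.ModArr, Cmd.for, markState, markLetter])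
      have eo := hf''.reg .old (by simp [Cmd.Mod, Cmd.for, markState, markLetter])
      refine ⟨ht, q₁, ?_, by simp [eo, g₃], ?_⟩
      · simp; omega
      · simp only [Store.setReg_reg, Store.setReg_arr, reduceCtorEq, if_false]
        intro heq c hc
        rcases q₂ with q₂ | ⟨q₂, q₃, q₄, q₅⟩
        · omega
        · rw [ed, ef, q₃]
          by_cases hci : c = i
          · rw [hci, ← hv]
            exact ⟨q₄, q₅⟩
          · exact g₄ (by omega) c (by omega)
    · rintro t s' hf' ⟨g₁, g₂, g₃, g₄⟩ ht
      refine ⟨_, ⟨g₁, by omega, rfl, fun he c hc => g₄ (by omega) c (by omega)⟩, ?_⟩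
      rw [g₃]
      have hle := h₁.le
      obtain ⟨d, hd⟩ := Nat.exists_eq_add_of_lt (show s₁.reg .old < n + 2 by omega)
      have e₁ : n + 2 - s₁.reg .old = d + 1 := by omega
      have e₂ : (n + 2 - s₁.reg .cnt) * ((n + 1) * (k * 7 + 6) + 4) ≤
        d * ((n + 1) * (k * 7 + 6) + 4) := Nat.mul_le_mul_right _ (by omega)
      have e₃ : (n + 1) * (k * 7 + 4 + 2) = (n + 1) * (k * 7 + 6) := rfl
      rw [e₃] at ht
      rw [e₁, Nat.succ_mul d]
      generalize (n + 1) * (k * 7 + 6) = A at *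
      omega
  · rintro m t s' hf ⟨h₁, h₂, -, h₃⟩ hlt ht
    simp only [Expr.eval] at hlt
    exact ⟨by omega, h₁, h₃ (by omega)⟩

/-- The words that are spelled by the chosen letters. -/
theorem Marking.exists_words {n k m : ℕ} {δ : ℕ → ℕ → ℕ} {F R N : ℕ → ℕ}
    (h : Marking n k δ F R N m) (hδ : ∀ x ≤ n, ∀ a < k, δ x a ≤ n)
    (hc : ∀ c ≤ n, (0 < F c → 0 < R c) ∧ ∀ a < k, 0 < R (δ c a) → 0 < R c) :
    ∃ X : ℕ → List ℕ, Ranked k n δ F R X ∧ (∀ c ≤ n, 0 < R c → (X c).length < n + 2) ∧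
      ∀ c ≤ n, 0 < R c → F c = 0 → N c < k ∧ 0 < R (δ c (N c)) ∧ X c = N c :: X (δ c (N c)) := by
  -- Recursion on the mark. The guard makes the definition total; by `Marking.step` it is satisfied
  -- at every marked state that is not final.
  obtain ⟨X, hX⟩ : ∃ X : ℕ → List ℕ, ∀ c, X c =
      if F c = 0 ∧ R (δ c (N c)) < R c then N c :: X (δ c (N c)) else [] := by
    refine ⟨WellFounded.fix (measure R).wf fun c ih =>
      if h : F c = 0 ∧ R (δ c (N c)) < R c then N c :: ih _ h.2 else [], fun c => ?_⟩
    rw [WellFounded.fix_eq]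
    split <;> simp_all
  have key : ∀ r, ∀ c ≤ n, 0 < R c → R c ≤ r → (X c).length < R c ∧ Letters k (X c) ∧
      0 < F (run δ c (X c)) := by
    intro r
    induction r with
    | zero => intro c _ h₁ h₂; omega
    | succ r ih =>
      intro c hcn hr hle
      rcases h.step c hcn hr with hf | ⟨hf, hk, hp, hlt⟩
      · rw [hX, if_neg (by omega)]
        exact ⟨hr, by simp [Letters], hf⟩
      · obtain ⟨h₁, h₂, h₃⟩ := ih _ (hδ c hcn _ hk) hp (by omega)
        rw [hX, if_pos ⟨hf, hlt⟩]
        exact ⟨by simp; omega, (Letters.singleton hk).append h₂, h₃⟩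
  refine ⟨X, ⟨?_, ?_, ?_, ?_⟩, ?_, ?_⟩
  · exact fun c hcn hr => (key m c hcn hr (h.lt c).le).2.1
  · exact fun c hcn hr => (key m c hcn hr (h.lt c).le).2.2
  · exact fun c hcn hf => ⟨(hc c hcn).1 hf, by rw [hX, if_neg (by omega)]⟩
  · exact fun c hcn => (hc c hcn).2
  · intro c hcn hr
    have := (key m c hcn hr (h.lt c).le).1
    have := h.lt c
    have := h.le
    omega
  · intro c hcn hr hf
    obtain h₁ | ⟨-, h₁, h₂, h₃⟩ := h.step c hcn hr
    · omega
    · refine ⟨h₁, h₂, ?_⟩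
      conv_lhs => rw [hX, if_pos ⟨hf, h₃⟩]

end RAM

namespace RAM

open Transducer

/-! ## The partition generated by the pair of initial states -/

/-- Load the entry `head` of the queue. -/
def loadEntry : Cmd :=
  .assign .p (.get .wp (.var .head) (.lit 0)) ;; .assign .q (.get .wq (.var .head) (.lit 0)) ;;
  .assign .u₁ (.get .wu₁ (.var .head) (.lit 0)) ;; .assign .v₁ (.get .wv₁ (.var .head) (.lit 0)) ;;
  .assign .u₂ (.get .wu₂ (.var .head) (.lit 0)) ;; .assign .v₂ (.get .wv₂ (.var .head) (.lit 0))

/-- Append an entry to the queue. -/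
def storeEntry : Cmd :=
  .write .wp (.var .tail) (.lit 0) (.var .p) ;; .write .wq (.var .tail) (.lit 0) (.var .q) ;;
  .write .wu₁ (.var .tail) (.lit 0) (.var .u₁) ;; .write .wv₁ (.var .tail) (.lit 0) (.var .v₁) ;;
  .write .wu₂ (.var .tail) (.lit 0) (.var .u₂) ;; .write .wv₂ (.var .tail) (.lit 0) (.var .v₂) ;;
  .assign .tail (.succ (.var .tail))

/-- Append the successors of the entry `head` to the queue. -/
def push (k : ℕ) : Cmd := .for .a (.lit k) (loadEntry ;; stepPair ;; storeEntry)

/-- Give the label in `p` to all states with the label in `q`. -/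
def relabel : Cmd :=
  .for .c (.var .size) (.ite (.get .lab (.var .c) (.lit 0)) (.var .q) .skip
    (.ite (.var .q) (.get .lab (.var .c) (.lit 0)) .skip
      (.write .lab (.var .c) (.lit 0) (.var .p))))

/-- Process the entry `head`. -/
def processEntry (k : ℕ) : Cmd :=
  .assign .p (.get .lab (.get .wp (.var .head) (.lit 0)) (.lit 0)) ;;
  .assign .q (.get .lab (.get .wq (.var .head) (.lit 0)) (.lit 0)) ;;
  .ifNe (.var .p) (.var .q) (relabel ;; push k) ;;
  .assign .head (.succ (.var .head))

/-- The first entry of the queue. -/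
def initQueue : Cmd :=
  .for .c (.var .size) (.write .lab (.var .c) (.lit 0) (.var .c)) ;;
  .assign .p (.var .start₁) ;; .assign .q (.var .start₂) ;;
  .assign .u₁ (.lit 0) ;; .assign .v₁ (.lit 0) ;; .assign .u₂ (.lit 0) ;; .assign .v₂ (.lit 0) ;;
  .assign .head (.lit 0) ;; .assign .tail (.lit 0) ;; storeEntry

/-- The coarsening of the discrete partition, with a queue of pairs of equivalent states. -/
def partition (k : ℕ) : Cmd :=
  initQueue ;; .while (.var .head) (.var .tail) (processEntry k)

/-- The entry `j` of the queue represents the word `w`. -/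
def Store.Entry (s : Store) (i₁ i₂ j : ℕ) (w : List ℕ) : Prop :=
  Track (s.arr .delta) (s.arr .tape) i₁ i₂ (s.arr .child) w (s.arr .wp j 0) (s.arr .wq j 0)
    (s.arr .wu₁ j 0) (s.arr .wv₁ j 0) (s.arr .wu₂ j 0) (s.arr .wv₂ j 0)

theorem loadEntry_spec {s : Store} {i₁ i₂ : ℕ} {w : List ℕ} (h : s.Entry i₁ i₂ (s.reg .head) w) :
    Wp loadEntry (fun t s' => t ≤ 6 ∧ s'.Tracks i₁ i₂ w) s := by
  simp only [loadEntry, wp_seq, wp_assign, Store.Tracks, Expr.eval, Store.setReg_reg,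
    Store.setReg_arr, reduceCtorEq, if_true, if_false]
  exact ⟨by omega, h⟩

theorem storeEntry_spec {s : Store} {i₁ i₂ : ℕ} {w : List ℕ} (h : s.Tracks i₁ i₂ w) :
    Wp storeEntry (fun t s' => t ≤ 7 ∧ s'.reg .tail = s.reg .tail + 1 ∧
      s'.Entry i₁ i₂ (s.reg .tail) w ∧
      ∀ j < s.reg .tail, s'.arr .wp j 0 = s.arr .wp j 0 ∧ s'.arr .wq j 0 = s.arr .wq j 0 ∧
        ∀ w, s.Entry i₁ i₂ j w → s'.Entry i₁ i₂ j w) s := by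
  simp only [storeEntry, wp_seq, wp_write, wp_assign, Store.Entry, Expr.eval, Store.setReg_reg,
    Store.setReg_arr, Store.setArr_arr, Store.setArr_reg, reduceCtorEq, if_true, if_false,
    update₂_apply, and_self]
  refine ⟨by omega, trivial, h, fun j hj => ?_⟩
  have : j ≠ s.reg .tail := hj.ne
  simp [this]

/-- The entry is reloaded for every letter, because reading a letter overwrites the states and the
nodes. -/
theorem push_spec {s : Store} {i₁ i₂ k : ℕ} {w : List ℕ}
    (hT : IsTrie (s.arr .child) (s.reg .ids)) (hlt : s.reg .head < s.reg .tail)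
    (h : s.Entry i₁ i₂ (s.reg .head) w) :
    Wp (push k) (fun t s' => t ≤ k * 27 + 2 ∧ IsTrie (s'.arr .child) (s'.reg .ids) ∧
      s'.reg .tail = s.reg .tail + k ∧
      (∀ a < k, s'.Entry i₁ i₂ (s.reg .tail + a) (w ++ [a])) ∧
      ∀ j < s.reg .tail, s'.arr .wp j 0 = s.arr .wp j 0 ∧ s'.arr .wq j 0 = s.arr .wq j 0 ∧
        ∀ w, s.Entry i₁ i₂ j w → s'.Entry i₁ i₂ j w) s := by
  refine Wp.for k 25 (fun i s' => IsTrie (s'.arr .child) (s'.reg .ids) ∧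
      s'.reg .tail = s.reg .tail + i ∧
      (∀ a < i, s'.Entry i₁ i₂ (s.reg .tail + a) (w ++ [a])) ∧
      ∀ j < s.reg .tail, s'.arr .wp j 0 = s.arr .wp j 0 ∧ s'.arr .wq j 0 = s.arr .wq j 0 ∧
        ∀ w, s.Entry i₁ i₂ j w → s'.Entry i₁ i₂ j w)
      (by simp [Cmd.Mod, loadEntry, stepPair, storeEntry, emit, appendLetter]) ?_ ?_ ?_ ?_
  · exact ⟨hT, by simp, by simp, fun j hj => ⟨rfl, rfl, fun _ => id⟩⟩
  · simp
  · rintro i s₁ hi hf ⟨h₁, h₂, h₃, h₄⟩ hv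
    have eh := hf.reg .head (by
      simp [Cmd.Mod, Cmd.for, loadEntry, stepPair, storeEntry, emit, appendLetter])
    rw [wp_seq]
    have hE : s₁.Entry i₁ i₂ (s₁.reg .head) w := by
      rw [eh]
      exact (h₄ _ hlt).2.2 w h
    refine (loadEntry_spec hE).mono ?_
    rintro t₂ s₂ hf₂ ⟨ht₂, hw₂⟩
    have ids₂ := hf₂.reg .ids (by simp [Cmd.Mod, loadEntry])
    have a₂ := hf₂.reg .a (by simp [Cmd.Mod, loadEntry])
    have tail₂ := hf₂.reg .tail (by simp [Cmd.Mod, loadEntry])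
    have arr₂ : s₂.arr = s₁.arr := by
      funext j
      exact hf₂.arr j (by simp [Cmd.ModArr, loadEntry])
    rw [wp_seq]
    refine (stepPair_spec (by rw [arr₂, ids₂]; exact h₁) hw₂).mono ?_
    rintro t₃ s₃ hf₃ ⟨ht₃, hT₃, hm₃, hw₃⟩
    rw [a₂, hv] at hw₃
    have tail₃ := hf₃.reg .tail (by simp [Cmd.Mod, stepPair, emit, appendLetter])
    have arr₃ : ∀ j, j ≠ .child → s₃.arr j = s₁.arr j := by
      intro j hj
      rw [hf₃.arr j (by simp [Cmd.ModArr, stepPair, emit, appendLetter, hj]), arr₂]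
    rw [arr₂] at hm₃
    have hE₃ : ∀ j v, s₁.Entry i₁ i₂ j v → s₃.Entry i₁ i₂ j v := by
      intro j v hjv
      unfold Store.Entry
      simp only [arr₃ _ (show Arr.delta ≠ .child by simp), arr₃ _ (show Arr.tape ≠ .child by simp),
        arr₃ _ (show Arr.wp ≠ .child by simp), arr₃ _ (show Arr.wq ≠ .child by simp),
        arr₃ _ (show Arr.wu₁ ≠ .child by simp), arr₃ _ (show Arr.wv₁ ≠ .child by simp),
        arr₃ _ (show Arr.wu₂ ≠ .child by simp), arr₃ _ (show Arr.wv₂ ≠ .child by simp)]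
      exact hjv.mono hm₃
    refine (storeEntry_spec hw₃).mono ?_
    rintro t₄ s₄ hf₄ ⟨ht₄, tail₄, hE₄, hm₄⟩
    have child₄ := hf₄.arr .child (by simp [Cmd.ModArr, storeEntry])
    have ids₄ := hf₄.reg .ids (by simp [Cmd.Mod, storeEntry])
    rw [tail₃, tail₂, h₂] at tail₄ hE₄ hm₄
    refine ⟨by omega, ?_, ?_, ?_, ?_⟩
    · simpa [child₄, ids₄] using hT₃
    · simp [tail₄]; omega
    · intro b hb
      by_cases hbi : b = i
      · rw [hbi]; exact hE₄
      · exact (hm₄ _ (by omega)).2.2 _ (hE₃ _ _ (h₃ b (by omega)))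
    · intro j hj
      obtain ⟨q₁, q₂, q₃⟩ := hm₄ j (by omega)
      obtain ⟨p₁, p₂, p₃⟩ := h₄ j hj
      rw [arr₃ _ (by simp)] at q₁ q₂
      exact ⟨q₁.trans p₁, q₂.trans p₂, fun v hv => q₃ v (hE₃ _ _ (p₃ v hv))⟩
  · rintro t s' hf ⟨h₁, h₂, h₃, h₄⟩ ht
    exact ⟨by omega, h₁, h₂, h₃, h₄⟩

theorem relabel_spec (s : Store) :
    Wp relabel (fun t s' => t ≤ s.reg .size * 5 + 2 ∧ ∀ x < s.reg .size,
      s'.arr .lab x 0 = if s.arr .lab x 0 = s.reg .q then s.reg .p else s.arr .lab x 0) s := by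
  refine Wp.for (s.reg .size) 3 (fun i s' => ∀ x, s'.arr .lab x 0 =
    if x < i ∧ s.arr .lab x 0 = s.reg .q then s.reg .p else s.arr .lab x 0)
    (by simp [Cmd.Mod]) ?_ ?_ ?_ ?_
  · simp
  · intro s' hf
    exact hf.reg .size (by simp [Cmd.Mod, Cmd.for])
  · intro i s₁ hi hf h hv
    have eq := hf.reg .q (by simp [Cmd.Mod, Cmd.for])
    have ep := hf.reg .p (by simp [Cmd.Mod, Cmd.for])
    simp only [wp_ite, wp_skip, wp_write, Expr.eval, Store.setReg_arr, Store.setArr_arr, if_true,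
      update₂_apply, and_true, hv, eq, ep, h, lt_irrefl, false_and, if_false]
    have hstep : s.arr .lab i 0 ≠ s.reg .q → ∀ x,
        (if x < i ∧ s.arr .lab x 0 = s.reg .q then s.reg .p else s.arr .lab x 0) =
        if x < i + 1 ∧ s.arr .lab x 0 = s.reg .q then s.reg .p else s.arr .lab x 0 := by
      intro hne x
      by_cases hx : x = i
      · simp [hx, hne]
      · simp only [show x < i + 1 ↔ x < i by omega]
    refine ⟨fun hlt => ⟨by omega, hstep hlt.ne⟩, fun hlt => ⟨fun hlt' => ⟨by omega, hstep hlt'.ne'⟩,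
      fun hlt' => ⟨by omega, fun x => ?_⟩⟩⟩
    by_cases hx : x = i
    · simp [hx, show s.arr .lab i 0 = s.reg .q by omega]
    · simp only [show x < i + 1 ↔ x < i by omega, hx, if_false]
  · intro t s' hf h ht
    refine ⟨by omega, fun x hx => ?_⟩
    rw [h]
    simp [hx]

end RAM

/-! ### Invariants and amortized cost of the partition -/

namespace RAM

open Transducer

/-- The partition `L` of the states `0, …, n` is generated by the pairs for words of `M`. -/
structure Generated (n : ℕ) (δ : ℕ → ℕ → ℕ) (i₁ i₂ : ℕ) (M : Set (List ℕ)) (L : ℕ → ℕ) :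
    Prop where
  lab_le : ∀ x ≤ n, L x ≤ n
  lab_lab : ∀ x ≤ n, L (L x) = L x
  gen : ∀ x ≤ n, ∀ y ≤ n, L x = L y → Relation.EqvGen (Merged δ i₁ i₂ M) x y

/-- The number of classes of a partition. -/
def classes (n : ℕ) (L : ℕ → ℕ) : ℕ := ((Finset.range (n + 1)).image L).card

theorem classes_le (n : ℕ) (L : ℕ → ℕ) : classes n L ≤ n + 1 :=
  Finset.card_image_le.trans (Finset.card_range _).le

/-- The label `L y` disappears and no new label arises. This bounds both the number of merges and
the length of the queue. -/
theorem classes_merge {n x y : ℕ} {L L' : ℕ → ℕ} (hx : x ≤ n) (hy : y ≤ n) (hne : L x ≠ L y)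
    (hL' : ∀ z ≤ n, L' z = if L z = L y then L x else L z) : classes n L' + 1 ≤ classes n L := by
  have hmem : ∀ z ≤ n, L z ∈ (Finset.range (n + 1)).image L := fun z hz =>
    Finset.mem_image_of_mem _ (Finset.mem_range.2 (Nat.lt_succ_of_le hz))
  have hsub : (Finset.range (n + 1)).image L' ⊆ ((Finset.range (n + 1)).image L).erase (L y) := by
    intro l hl
    obtain ⟨z, hz, rfl⟩ := Finset.mem_image.1 hl
    have hz' : z ≤ n := Nat.le_of_lt_succ (Finset.mem_range.1 hz)
    rw [hL' z hz', Finset.mem_erase]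
    split
    · exact ⟨hne, hmem x hx⟩
    · exact ⟨‹_›, hmem z hz'⟩
  have h₁ := Finset.card_le_card hsub
  rw [Finset.card_erase_of_mem (hmem y hy)] at h₁
  have h₂ : 0 < classes n L := Finset.card_pos.2 ⟨_, hmem y hy⟩
  unfold classes at *
  omega

/-- States from the two united classes are connected through the new generating pair, reached from
`i₁` and `i₂` by `w`. -/
theorem Generated.merge {n i₁ i₂ : ℕ} {δ : ℕ → ℕ → ℕ} {M : Set (List ℕ)} {L L' : ℕ → ℕ}
    (h : Generated n δ i₁ i₂ M L) {w : List ℕ} (hx : run δ i₁ w ≤ n) (hy : run δ i₂ w ≤ n)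
    (hne : L (run δ i₁ w) ≠ L (run δ i₂ w))
    (hL' : ∀ z ≤ n, L' z = if L z = L (run δ i₂ w) then L (run δ i₁ w) else L z) :
    Generated n δ i₁ i₂ (insert w M) L' := by
  have hmono : ∀ x y, Relation.EqvGen (Merged δ i₁ i₂ M) x y →
      Relation.EqvGen (Merged δ i₁ i₂ (insert w M)) x y := by
    intro x y hxy
    induction hxy with
    | rel x y h =>
      obtain ⟨u, hu, h⟩ := h
      exact .rel _ _ ⟨u, Or.inr hu, h⟩
    | refl x => exact .refl x
    | symm x y _ ih => exact ih.symm _ _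
    | trans x y z _ _ ih ih' => exact ih.trans _ _ _ ih'
  have hw : Relation.EqvGen (Merged δ i₁ i₂ (insert w M)) (run δ i₁ w) (run δ i₂ w) :=
    .rel _ _ ⟨w, Or.inl rfl, rfl, rfl⟩
  refine ⟨fun x hxn => ?_, fun x hxn => ?_, fun x hxn y hyn hxy => ?_⟩
  · rw [hL' x hxn]
    split
    exacts [h.lab_le _ hx, h.lab_le _ hxn]
  · rw [hL' x hxn]
    split
    · rw [hL' _ (h.lab_le _ hx), h.lab_lab _ hx, if_neg hne]
    · rw [hL' _ (h.lab_le _ hxn), h.lab_lab _ hxn, if_neg ‹_›]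
  · rw [hL' x hxn, hL' y hyn] at hxy
    split at hxy <;> split at hxy
    · exact hmono _ _ (h.gen x hxn y hyn (by omega))
    · have h₁ := hmono _ _ (h.gen x hxn _ hy ‹_›)
      have h₂ := hmono _ _ (h.gen _ hx y hyn hxy)
      exact h₁.trans _ _ _ ((hw.symm _ _).trans _ _ _ h₂)
    · have h₁ := hmono _ _ (h.gen x hxn _ hx hxy)
      have h₂ := hmono _ _ (h.gen _ hy y hyn (by omega))
      exact h₁.trans _ _ _ (hw.trans _ _ _ h₂)
    · exact hmono _ _ (h.gen x hxn y hyn hxy)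

/-- The invariant of the construction of the partition. -/
structure Partitioning (s : Store) (n k i₁ i₂ : ℕ) (M : Set (List ℕ)) : Prop where
  trie : IsTrie (s.arr .child) (s.reg .ids)
  head_le : s.reg .head ≤ s.reg .tail
  entry : ∀ j < s.reg .tail, ∃ w, Letters k w ∧ s.Entry i₁ i₂ j w
  nil : ∃ j < s.reg .tail, s.Entry i₁ i₂ j []
  sub : ∀ w ∈ M, Letters k w ∧ ∃ j < s.reg .tail, s.Entry i₁ i₂ j w
  snoc : ∀ w ∈ M, ∀ a < k, ∃ j < s.reg .tail, s.Entry i₁ i₂ j (w ++ [a])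
  same : ∀ j < s.reg .head, s.arr .lab (s.arr .wp j 0) 0 = s.arr .lab (s.arr .wq j 0) 0
  gen : Generated n (s.arr .delta) i₁ i₂ M (s.arr .lab · 0)
  count : s.reg .tail + k * classes n (s.arr .lab · 0) ≤ 1 + k * (n + 1)

/-- The cost of a merge. -/
def mergeCost (n k : ℕ) : ℕ := (n + 1) * 5 + k * 37 + 10

/-- The steps in reserve during the construction of the partition. -/
def Store.credit (s : Store) (n k : ℕ) : ℕ :=
  10 * (s.reg .tail - s.reg .head) + classes n (s.arr .lab · 0) * mergeCost n k

/-- Amortized analysis: an entry without a merge is paid for by its own `10` credits, and a merge by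
the class that vanishes. -/
theorem processEntry_spec {s : Store} {n k i₁ i₂ : ℕ} {M : Set (List ℕ)}
    (h : Partitioning s n k i₁ i₂ M) (hn : s.reg .size = n + 1)
    (hδ : ∀ x ≤ n, ∀ a < k, s.arr .delta x a ≤ n) (h₁ : i₁ ≤ n) (h₂ : i₂ ≤ n)
    (hlt : s.reg .head < s.reg .tail) :
    Wp (processEntry k) (fun t s' => ∃ M', Partitioning s' n k i₁ i₂ M' ∧
      t + 1 + s'.credit n k ≤ s.credit n k) s := by
  obtain ⟨w, hw, hE⟩ := h.entry _ hlt
  have hp := run_le hδ h₁ hw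
  have hq := run_le hδ h₂ hw
  simp only [processEntry, wp_seq, wp_assign, Expr.eval, Store.setReg_reg, Store.setReg_arr,
    reduceCtorEq, if_false]
  rw [hE.p_eq, hE.q_eq]
  refine wp_ifNe ?_ ?_
  · simp only [Expr.eval, Store.setReg_reg, reduceCtorEq, if_true, if_false]
    intro hne
    rw [wp_seq]
    refine (relabel_spec _).mono ?_
    simp only [Store.setReg_reg, Store.setReg_arr, reduceCtorEq, if_true, if_false, hn]
    rintro t₁ s₁ hf₁ ⟨ht₁, hL₁⟩
    have arr₁ : ∀ j, j ≠ .lab → s₁.arr j = s.arr j := fun j hj =>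
      hf₁.arr j (by simp [Cmd.ModArr, Cmd.for, relabel, hj])
    have reg₁ : ∀ v, v ≠ .c → v ≠ .p → v ≠ .q → s₁.reg v = s.reg v := fun v hv hv' hv'' => by
      simpa [hv', hv''] using hf₁.reg v (by simp [Cmd.Mod, Cmd.for, relabel, hv])
    have hE₁ : ∀ j v, s.Entry i₁ i₂ j v → s₁.Entry i₁ i₂ j v := by
      intro j v hjv
      unfold Store.Entry
      simp only [arr₁ _ (show Arr.delta ≠ .lab by simp), arr₁ _ (show Arr.tape ≠ .lab by simp),
        arr₁ _ (show Arr.wp ≠ .lab by simp), arr₁ _ (show Arr.wq ≠ .lab by simp),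
        arr₁ _ (show Arr.wu₁ ≠ .lab by simp), arr₁ _ (show Arr.wv₁ ≠ .lab by simp),
        arr₁ _ (show Arr.wu₂ ≠ .lab by simp), arr₁ _ (show Arr.wv₂ ≠ .lab by simp),
        arr₁ _ (show Arr.child ≠ .lab by simp)]
      exact hjv
    have head₁ := reg₁ .head (by simp) (by simp) (by simp)
    have tail₁ := reg₁ .tail (by simp) (by simp) (by simp)
    have ids₁ := reg₁ .ids (by simp) (by simp) (by simp)
    refine (push_spec (by rw [arr₁ _ (by simp), ids₁]; exact h.trie) (by omega)
      (by rw [head₁]; exact hE₁ _ _ hE)).mono ?_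
    rintro t₂ s₂ hf₂ ⟨ht₂, hT₂, tail₂, hnew₂, hold₂⟩
    rw [tail₁] at tail₂ hnew₂ hold₂
    have lab₂ := hf₂.arr .lab (by
      simp [Cmd.ModArr, Cmd.for, push, loadEntry, stepPair, storeEntry, emit, appendLetter])
    have delta₂ := (hf₂.arr .delta (by
      simp [Cmd.ModArr, Cmd.for, push, loadEntry, stepPair, storeEntry, emit, appendLetter])).trans
      (arr₁ _ (by simp))
    have head₂ := (hf₂.reg .head (by
      simp [Cmd.Mod, Cmd.for, push, loadEntry, stepPair, storeEntry, emit, appendLetter])).trans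
      head₁
    have hE₂ : ∀ j < s.reg .tail, ∀ v, s.Entry i₁ i₂ j v → s₂.Entry i₁ i₂ j v :=
      fun j hj v hv => (hold₂ j hj).2.2 v (hE₁ j v hv)
    have hL₂ : ∀ z ≤ n, s₂.arr .lab z 0 =
        if s.arr .lab z 0 = s.arr .lab (run (s.arr .delta) i₂ w) 0
        then s.arr .lab (run (s.arr .delta) i₁ w) 0 else s.arr .lab z 0 := by
      intro z hz
      rw [lab₂]
      exact hL₁ z (by omega)
    have hcl := classes_merge (L := (s.arr .lab · 0)) (L' := (s₂.arr .lab · 0)) hp hq hne hL₂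
    have hgen := h.gen.merge (L' := (s₂.arr .lab · 0)) hp hq hne hL₂
    have hpart : Partitioning (s₂.setReg .head (s.reg .head + 1)) n k i₁ i₂ (insert w M) := by
      have htail : (s₂.setReg .head (s.reg .head + 1)).reg .tail = s.reg .tail + k := by
        simp [tail₂]
      constructor
      · simpa using hT₂
      · simp [tail₂]; omega
      · rw [htail]
        intro j hj
        by_cases hjt : j < s.reg .tail
        · obtain ⟨v, hv, hjv⟩ := h.entry j hjt
          exact ⟨v, hv, hE₂ j hjt v hjv⟩
        · have := hnew₂ (j - s.reg .tail) (by omega)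
          rw [show s.reg .tail + (j - s.reg .tail) = j by omega] at this
          exact ⟨_, hw.append (Letters.singleton (by omega)), this⟩
      · rw [htail]
        obtain ⟨j, hj, hjv⟩ := h.nil
        exact ⟨j, by omega, hE₂ j hj _ hjv⟩
      · rw [htail]
        rintro v (rfl | hv)
        · exact ⟨hw, _, by omega, hE₂ _ hlt _ hE⟩
        · obtain ⟨hv', j, hj, hjv⟩ := h.sub v hv
          exact ⟨hv', j, by omega, hE₂ j hj _ hjv⟩
      · rw [htail]
        rintro v (rfl | hv) a ha
        · exact ⟨_, by omega, hnew₂ a ha⟩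
        · obtain ⟨j, hj, hjv⟩ := h.snoc v hv a ha
          exact ⟨j, by omega, hE₂ j hj _ hjv⟩
      -- Relabelling is a function of the old label, so pairs that agreed still agree; the pair at
      -- `head` now agrees because both of its labels become that of its first state.
      · simp only [Store.setReg_reg, Store.setReg_arr, if_true]
        intro j hj
        obtain ⟨e₁, e₂, -⟩ := hold₂ j (by omega)
        rw [arr₁ _ (by simp)] at e₁ e₂
        obtain ⟨v, hv, hjv⟩ := h.entry j (by omega)
        rw [e₁, e₂, hL₂ _ (by rw [hjv.p_eq]; exact run_le hδ h₁ hv),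
          hL₂ _ (by rw [hjv.q_eq]; exact run_le hδ h₂ hv)]
        by_cases hjh : j = s.reg .head
        · rw [hjh, hE.p_eq, hE.q_eq]
          simp
        · rw [h.same j (by omega)]
      · rw [Store.setReg_arr, delta₂]
        exact hgen
      · rw [htail]
        have h₃ := Nat.mul_le_mul_left k hcl
        have h₄ := h.count
        rw [Nat.mul_succ] at h₃
        simp only [Store.setReg_arr]
        omega
    -- The coefficient `37` in `mergeCost` is `27` for creating each new entry plus the `10` credits
    -- deposited on it.
    have hcost : t₁ + t₂ + 8 + (s₂.setReg .head (s.reg .head + 1)).credit n k ≤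
        s.credit n k := by
      simp only [Store.credit, Store.setReg_reg, Store.setReg_arr, reduceCtorEq, if_true,
        if_false, tail₂]
      have h₃ := Nat.mul_le_mul_right (mergeCost n k) hcl
      rw [Nat.succ_mul] at h₃
      have h₄ : mergeCost n k = (n + 1) * 5 + k * 37 + 10 := rfl
      omega
    rw [head₂]
    exact ⟨⟨_, hpart, by omega⟩, ⟨_, hpart, by omega⟩⟩
  · simp only [Expr.eval, Store.setReg_reg, reduceCtorEq, if_true, if_false]
    intro heq
    refine ⟨M, ⟨h.trie, hlt, h.entry, h.nil, h.sub, h.snoc, ?_, h.gen, h.count⟩, ?_⟩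
    · simp only [Store.setReg_reg, Store.setReg_arr, if_true]
      intro j hj
      by_cases hjh : j = s.reg .head
      · rw [hjh, hE.p_eq, hE.q_eq]
        exact heq
      · exact h.same j (by omega)
    · simp only [Store.credit, Store.setReg_reg, Store.setReg_arr, reduceCtorEq, if_true, if_false]
      omega

theorem initQueue_spec {s : Store} {n k : ℕ} (hn : s.reg .size = n + 1)
    (hchild : ∀ x a, s.arr .child x a = 0) :
    Wp initQueue (fun t s' => t ≤ (n + 1) * 3 + 17 ∧
      Partitioning s' n k (s.reg .start₁) (s.reg .start₂) ∅ ∧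
      s'.reg .head = 0 ∧ s'.reg .tail = 1) s := by
  rw [initQueue, wp_seq]
  refine Wp.for (n + 1) 1 (fun i s' => ∀ x < i, s'.arr .lab x 0 = x) (by simp [Cmd.Mod])
    (by simp) ?_ ?_ ?_
  · intro s' hf
    exact (hf.reg .size (by simp [Cmd.Mod, Cmd.for])).trans hn
  · intro i s' hi hf h hv
    simp only [wp_write, Expr.eval, Store.setReg_arr, Store.setArr_arr, if_true, update₂_apply,
      and_true, hv]
    refine ⟨le_rfl, fun x hx => ?_⟩
    split
    · exact Eq.symm ‹_›
    · exact h x (by omega)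
  · intro t₁ s₁ hf h ht₁
    have arr₁ : ∀ j, j ≠ .lab → s₁.arr j = s.arr j := fun j hj =>
      hf.arr j (by simp [Cmd.ModArr, Cmd.for, hj])
    have start₁ := hf.reg .start₁ (by simp [Cmd.Mod, Cmd.for])
    have start₂ := hf.reg .start₂ (by simp [Cmd.Mod, Cmd.for])
    have ids₁ := hf.reg .ids (by simp [Cmd.Mod, Cmd.for])
    simp only [wp_seq, wp_assign, Expr.eval, Store.setReg_reg, reduceCtorEq, if_false, start₁,
      start₂]
    refine (storeEntry_spec (i₁ := s.reg .start₁) (i₂ := s.reg .start₂) (w := []) ?_).mono ?_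
    · constructor <;> simp [Node.root]
    · simp only [Store.setReg_reg, if_true]
      rintro t s' hf' ⟨ht, htl, hE, -⟩
      have child' := hf'.arr .child (by simp [Cmd.ModArr, storeEntry])
      have delta' := hf'.arr .delta (by simp [Cmd.ModArr, storeEntry])
      have lab' := hf'.arr .lab (by simp [Cmd.ModArr, storeEntry])
      have ids' := hf'.reg .ids (by simp [Cmd.Mod, storeEntry])
      have head' := hf'.reg .head (by simp [Cmd.Mod, storeEntry])
      simp only [Store.setReg_reg, Store.setReg_arr, reduceCtorEq, if_true, if_false]
        at child' lab' ids' head' delta'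
      rw [arr₁ _ (by simp)] at child'
      rw [ids₁] at ids'
      have hlab : ∀ x ≤ n, s'.arr .lab x 0 = x := fun x hx => by rw [lab', h x (by omega)]
      refine ⟨by omega, ⟨⟨?_, ?_⟩, by omega, ?_, ⟨0, by omega, hE⟩, by simp, by simp, ?_,
        ⟨?_, ?_, ?_⟩, ?_⟩, head', by omega⟩
      · simp [child', hchild]
      · simp [child', hchild]
      · intro j hj
        obtain rfl : j = 0 := by omega
        exact ⟨[], by simp [Letters], hE⟩
      · intro j hj
        omega
      · intro x hx
        rw [hlab x hx]
        exact hx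
      · intro x hx
        rw [hlab x hx, hlab x hx]
      · intro x hx y hy hxy
        rw [hlab x hx, hlab y hy] at hxy
        exact hxy ▸ .refl x
      · have := Nat.mul_le_mul_left k (classes_le n (s'.arr .lab · 0))
        omega

/-- The initial credit is one queue entry and at most `n + 1` classes. When the loop ends, `head =
tail`, so every queued pair has equal labels. -/
theorem partition_spec {s : Store} {n k : ℕ} (hn : s.reg .size = n + 1)
    (hδ : ∀ x ≤ n, ∀ a < k, s.arr .delta x a ≤ n)
    (h₁ : s.reg .start₁ ≤ n) (h₂ : s.reg .start₂ ≤ n)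
    (hchild : ∀ x a, s.arr .child x a = 0) :
    Wp (partition k) (fun t s' => t ≤ (n + 1) * (mergeCost n k + 3) + 28 ∧
      s'.reg .tail ≤ 1 + k * (n + 1) ∧ s'.reg .head = s'.reg .tail ∧
      ∃ M, Partitioning s' n k (s.reg .start₁) (s.reg .start₂) M) s := by
  rw [partition, wp_seq]
  refine (initQueue_spec (k := k) hn hchild).mono ?_
  rintro t₁ s₁ hf₁ ⟨ht₁, hP₁, hh₁, htl₁⟩
  have delta₁ := hf₁.arr .delta (by simp [Cmd.ModArr, Cmd.for, initQueue, storeEntry])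
  have size₁ := hf₁.reg .size (by simp [Cmd.Mod, Cmd.for, initQueue, storeEntry])
  refine Wp.loop (fun m s' => m = s'.credit n k ∧
    ∃ M, Partitioning s' n k (s.reg .start₁) (s.reg .start₂) M) ⟨rfl, _, hP₁⟩ ?_ ?_
  · rintro m s₂ hf₂ ⟨rfl, M, hM⟩ hlt
    have delta₂ := hf₂.arr .delta (by
      simp [Cmd.ModArr, Cmd.for, Cmd.ifNe, processEntry, relabel, push, loadEntry, stepPair,
        storeEntry, emit, appendLetter])
    have size₂ := hf₂.reg .size (by
      simp [Cmd.Mod, Cmd.for, Cmd.ifNe, processEntry, relabel, push, loadEntry, stepPair,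
        storeEntry, emit, appendLetter])
    refine (processEntry_spec hM (by rw [size₂, size₁, hn]) (by rw [delta₂, delta₁]; exact hδ)
      h₁ h₂ hlt).mono ?_
    rintro t s' hf ⟨M', hM', ht⟩
    exact ⟨_, ⟨rfl, M', hM'⟩, ht⟩
  · rintro m t s' hf ⟨rfl, M, hM⟩ hlt ht
    simp only [Expr.eval] at hlt
    have hc := hM.count
    have hle := hM.head_le
    have hcl := Nat.mul_le_mul_right (mergeCost n k) (classes_le n (s₁.arr .lab · 0))
    rw [Store.credit, Store.credit, hh₁, htl₁] at ht
    refine ⟨?_, by omega, by omega, M, hM⟩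
    rw [Nat.mul_add]
    omega

end RAM

namespace RAM

open Transducer

/-! ## The tests -/

/-- Set `ok` to `0` if two values differ. -/
def check (e e' : Expr) : Cmd := .ifNe e e' (.assign .ok (.lit 0))

theorem check_spec (e e' : Expr) (s : Store) :
    Wp (check e e') (fun t s' => t ≤ 3 ∧
      s' = s.setReg .ok (if e.eval s = e'.eval s then s.reg .ok else 0)) s := by
  refine wp_ifNe (fun h => ?_) fun h => ?_
  · rw [wp_assign, if_neg h]
    exact ⟨⟨by omega, rfl⟩, by omega, rfl⟩
  · rw [if_pos h, Store.setReg, Function.update_eq_self]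
    exact ⟨le_rfl, rfl⟩

/-- From the state in `r`, read the chosen letters until a final state is reached. -/
def followChosen : Cmd :=
  .while (.get .fin (.var .r) (.lit 0)) (.lit 1)
    (.assign .a (.get .next (.var .r) (.lit 0)) ;; stepPair ;;
      .assign .r (.get .delta (.var .r) (.var .a)))

/-- Test the entry `head` of the queue. -/
def testEntry : Cmd :=
  loadEntry ;; check (.get .fin (.var .p) (.lit 0)) (.get .fin (.var .q) (.lit 0)) ;;
  .assign .r (.get .lab (.var .p) (.lit 0)) ;;
  .ite (.lit 0) (.get .rank (.var .r) (.lit 0))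
    (followChosen ;; check (.var .u₁) (.var .u₂) ;; check (.var .v₁) (.var .v₂)) .skip

/-- Test all entries of the queue. -/
def testAll : Cmd := .assign .ok (.lit 1) ;; .for .head (.var .tail) testEntry

/-- `X` gives the words that are spelled by the letters `N`. -/
def Spelled (n k : ℕ) (δ : ℕ → ℕ → ℕ) (F R N : ℕ → ℕ) (X : ℕ → List ℕ) : Prop :=
  ∀ c ≤ n, 0 < R c → F c = 0 → N c < k ∧ 0 < R (δ c (N c)) ∧ X c = N c :: X (δ c (N c))

/-- The letters are dictated by the label in `r`, while the two actual states are carried along by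
`stepPair`. -/
theorem followChosen_spec {s : Store} {n k i₁ i₂ : ℕ} {w : List ℕ} {X : ℕ → List ℕ}
    (hδ : ∀ x ≤ n, ∀ a < k, s.arr .delta x a ≤ n)
    (hR : Ranked k n (s.arr .delta) (s.arr .fin · 0) (s.arr .rank · 0) X)
    (hX : Spelled n k (s.arr .delta) (s.arr .fin · 0) (s.arr .rank · 0) (s.arr .next · 0) X)
    (hT : IsTrie (s.arr .child) (s.reg .ids)) (hw : s.Tracks i₁ i₂ w)
    (hr : s.reg .r ≤ n) (hr' : 0 < s.arr .rank (s.reg .r) 0) :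
    Wp followChosen (fun t s' => t ≤ (X (s.reg .r)).length * 15 + 1 ∧
      IsTrie (s'.arr .child) (s'.reg .ids) ∧
      (∀ x v, Node (s.arr .child) x v → Node (s'.arr .child) x v) ∧
      s'.Tracks i₁ i₂ (w ++ X (s.reg .r))) s := by
  refine Wp.loop (fun m s' => m = (X (s'.reg .r)).length * 15 ∧
    IsTrie (s'.arr .child) (s'.reg .ids) ∧
    (∀ x v, Node (s.arr .child) x v → Node (s'.arr .child) x v) ∧
    s'.reg .r ≤ n ∧ 0 < s.arr .rank (s'.reg .r) 0 ∧
    ∃ v, s'.Tracks i₁ i₂ (w ++ v) ∧ v ++ X (s'.reg .r) = X (s.reg .r))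
    ⟨rfl, hT, fun _ _ => id, hr, hr', [], by simpa using hw, rfl⟩ ?_ ?_
  · rintro m s₁ hf ⟨rfl, h₁, h₂, h₃, h₄, v, h₅, h₆⟩ hlt
    have arr₁ : ∀ j, j ≠ .child → s₁.arr j = s.arr j := fun j hj =>
      hf.arr j (by simp [Cmd.ModArr, stepPair, emit, appendLetter, hj])
    have fin₁ := arr₁ .fin (by simp)
    have next₁ := arr₁ .next (by simp)
    have delta₁ := arr₁ .delta (by simp)
    simp only [Expr.eval, fin₁] at hlt
    obtain ⟨g₁, g₂, g₃⟩ := hX _ h₃ h₄ (Nat.lt_one_iff.1 hlt)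
    rw [wp_seq, wp_assign, wp_seq]
    simp only [Expr.eval, next₁]
    refine Wp.mono (stepPair_spec (i₁ := i₁) (i₂ := i₂) (w := w ++ v) ?_ ?_) ?_
    · simpa using h₁
    · simpa [Store.Tracks] using h₅
    rintro t s₂ hf₂ ⟨ht, q₁, q₂, q₃⟩
    have r₂ := hf₂.reg .r (by simp [Cmd.Mod, stepPair, emit, appendLetter])
    have a₂ := hf₂.reg .a (by simp [Cmd.Mod, stepPair, emit, appendLetter])
    have delta₂ := hf₂.arr .delta (by simp [Cmd.ModArr, stepPair, emit, appendLetter])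
    simp only [Store.setReg_reg, Store.setReg_arr, reduceCtorEq, if_true, if_false]
      at r₂ a₂ q₃ delta₂
    rw [wp_assign]
    simp only [Expr.eval, r₂, a₂, delta₂, delta₁]
    refine ⟨_, ⟨rfl, ?_, ?_, ?_, ?_, v ++ [s.arr .next (s₁.reg .r) 0], ?_, ?_⟩, ?_⟩
    · simpa using q₁
    · exact fun x u hx => q₂ _ _ (h₂ _ _ hx)
    · simpa using hδ _ h₃ _ g₁
    · simpa using g₂
    · rw [← List.append_assoc]
      exact q₃
    · simp only [Store.setReg_reg, if_true]
      rw [List.append_assoc, List.singleton_append, ← g₃, h₆]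
    · simp only [Store.setReg_reg, if_true]
      have := congrArg List.length g₃
      simp only [List.length_cons] at this
      omega
  · rintro m t s₁ hf ⟨rfl, h₁, h₂, h₃, h₄, v, h₅, h₆⟩ hlt ht
    have fin₁ := hf.arr .fin (by simp [Cmd.ModArr, stepPair, emit, appendLetter])
    simp only [Expr.eval, fin₁] at hlt
    have h₇ := (hR.final _ h₃ (Nat.not_lt.1 hlt)).2
    rw [h₇, List.append_nil] at h₆
    rw [h₆] at h₅
    exact ⟨by omega, h₁, h₂, h₅⟩

theorem Track.out_eq_iff {δ τ f : ℕ → ℕ → ℕ} {i₁ i₂ p q u₁ v₁ u₂ v₂ m : ℕ} {w : List ℕ}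
    (hT : IsTrie f m) (h : Track δ τ i₁ i₂ f w p q u₁ v₁ u₂ v₂) :
    (∀ b, out δ τ b i₁ w = out δ τ b i₂ w) ↔ u₁ = u₂ ∧ v₁ = v₂ := by
  constructor
  · intro hb
    have h₁ := h.u₁
    have h₂ := h.v₁
    rw [hb] at h₁ h₂
    exact ⟨h₁.eq h.u₂, h₂.eq h.v₂⟩
  · rintro ⟨rfl, rfl⟩ b
    cases b
    exacts [hT.word_eq h.v₁ h.v₂, hT.word_eq h.u₁ h.u₂]

/-- A queue entry need not determine its word, since interleavings are lost, but the stored states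
and outputs determine the verdict. One test per entry therefore covers all words that it represents.
-/
theorem Track.passes_congr {δ τ f : ℕ → ℕ → ℕ} {i₁ i₂ p q u₁ v₁ u₂ v₂ m : ℕ} {w w' : List ℕ}
    {F L R : ℕ → ℕ} {X : ℕ → List ℕ}
    (hT : IsTrie f m) (h : Track δ τ i₁ i₂ f w p q u₁ v₁ u₂ v₂)
    (h' : Track δ τ i₁ i₂ f w' p q u₁ v₁ u₂ v₂) :
    Passes δ τ F i₁ i₂ L R X w ↔ Passes δ τ F i₁ i₂ L R X w' := by
  have e₁ : ∀ b, out δ τ b i₁ w = out δ τ b i₁ w' := by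
    intro b
    cases b
    exacts [hT.word_eq h.v₁ h'.v₁, hT.word_eq h.u₁ h'.u₁]
  have e₂ : ∀ b, out δ τ b i₂ w = out δ τ b i₂ w' := by
    intro b
    cases b
    exacts [hT.word_eq h.v₂ h'.v₂, hT.word_eq h.u₂ h'.u₂]
  simp only [Passes, out_append, ← h.p_eq, ← h.q_eq, ← h'.p_eq, ← h'.q_eq, e₁, e₂]

/-- The test for the word `w`, with the tables that are stored in `s`. -/
def Store.Passes (s : Store) (i₁ i₂ : ℕ) (X : ℕ → List ℕ) (w : List ℕ) : Prop :=
  Transducer.Passes (s.arr .delta) (s.arr .tape) (s.arr .fin · 0) i₁ i₂ (s.arr .lab · 0)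
    (s.arr .rank · 0) X w

theorem testEntry_spec {s : Store} {n k i₁ i₂ : ℕ} {w : List ℕ} {X : ℕ → List ℕ}
    (hδ : ∀ x ≤ n, ∀ a < k, s.arr .delta x a ≤ n) (h₁ : i₁ ≤ n)
    (hL : ∀ x ≤ n, s.arr .lab x 0 ≤ n)
    (hR : Ranked k n (s.arr .delta) (s.arr .fin · 0) (s.arr .rank · 0) X)
    (hX : Spelled n k (s.arr .delta) (s.arr .fin · 0) (s.arr .rank · 0) (s.arr .next · 0) X)
    (hlen : ∀ c ≤ n, 0 < s.arr .rank c 0 → (X c).length < n + 2)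
    (hT : IsTrie (s.arr .child) (s.reg .ids)) (hw : Letters k w)
    (hE : s.Entry i₁ i₂ (s.reg .head) w) :
    Wp testEntry (fun t s' => t ≤ (n + 1) * 15 + 18 ∧ IsTrie (s'.arr .child) (s'.reg .ids) ∧
      (∀ x v, Node (s.arr .child) x v → Node (s'.arr .child) x v) ∧
      (s.Passes i₁ i₂ X w → s'.reg .ok = s.reg .ok) ∧
      (¬ s.Passes i₁ i₂ X w → s'.reg .ok = 0)) s := by
  have hp := run_le hδ h₁ hw
  rw [testEntry, wp_seq]
  refine (loadEntry_spec hE).mono ?_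
  rintro t₁ s₁ hf₁ ⟨ht₁, hw₁⟩
  have arr₁ : s₁.arr = s.arr := by
    funext j
    exact hf₁.arr j (by simp [Cmd.ModArr, loadEntry])
  have ids₁ := hf₁.reg .ids (by simp [Cmd.Mod, loadEntry])
  have ok₁ := hf₁.reg .ok (by simp [Cmd.Mod, loadEntry])
  have hw₁' := hw₁
  have p₁ : s₁.reg .p = run (s.arr .delta) i₁ w := by rw [hw₁.p_eq, arr₁]
  have q₁ : s₁.reg .q = run (s.arr .delta) i₂ w := by rw [hw₁.q_eq, arr₁]
  rw [wp_seq]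
  refine (check_spec _ _ _).mono ?_
  rintro t₂ _ - ⟨ht₂, rfl⟩
  rw [wp_seq, wp_assign, wp_ite]
  simp only [Expr.eval, Store.setReg_reg, Store.setReg_arr, reduceCtorEq, if_true, if_false, p₁, q₁,
    arr₁, ok₁, wp_skip]
  have hln := hL _ hp
  constructor
  · intro hr
    rw [wp_seq]
    refine Wp.mono (followChosen_spec (n := n) (k := k) (i₁ := i₁) (i₂ := i₂) (w := w) (X := X)
      ?_ ?_ ?_ ?_ ?_ ?_ ?_) ?_
    · simpa [arr₁] using hδ
    · simpa [arr₁] using hR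
    · simpa [arr₁] using hX
    · simpa [arr₁, ids₁] using hT
    · simpa [Store.Tracks] using hw₁
    · simpa using hln
    · simpa [arr₁] using hr
    · simp only [Store.setReg_reg, Store.setReg_arr, if_true, arr₁]
      rintro t₃ s₃ hf₃ ⟨ht₃, hT₃, hm₃, hw₃⟩
      have ok₃ := hf₃.reg .ok (by simp [Cmd.Mod, followChosen, stepPair, emit, appendLetter])
      have delta₃ := hf₃.arr .delta
        (by simp [Cmd.ModArr, followChosen, stepPair, emit, appendLetter])
      have tape₃ := hf₃.arr .tape
        (by simp [Cmd.ModArr, followChosen, stepPair, emit, appendLetter])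
      simp only [Store.setReg_reg, Store.setReg_arr, reduceCtorEq, if_true, if_false, arr₁]
        at ok₃ delta₃ tape₃
      rw [wp_seq]
      refine (check_spec _ _ _).mono ?_
      rintro t₄ _ - ⟨ht₄, rfl⟩
      refine (check_spec _ _ _).mono ?_
      rintro t₅ _ - ⟨ht₅, rfl⟩
      have hiff := Track.out_eq_iff hT₃ hw₃
      rw [delta₃, tape₃] at hiff
      have hlen' := hlen _ hln hr
      have hP : s.Passes i₁ i₂ X w ↔ s.arr .fin (run (s.arr .delta) i₁ w) 0 =
          s.arr .fin (run (s.arr .delta) i₂ w) 0 ∧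
          s₃.reg .u₁ = s₃.reg .u₂ ∧ s₃.reg .v₁ = s₃.reg .v₂ := by
        rw [← hiff]
        exact and_congr_right fun _ => ⟨fun h => h hr, fun h _ => h⟩
      simp only [Expr.eval, Store.setReg_reg, Store.setReg_arr, reduceCtorEq, if_true, if_false,
        ok₃]
      refine ⟨by omega, hT₃, hm₃, fun h => ?_, fun h => ?_⟩
      · obtain ⟨a₁, a₂, a₃⟩ := hP.1 h
        rw [if_pos a₃, if_pos a₂, if_pos a₁]
      · rw [hP] at h
        by_cases a₃ : s₃.reg .v₁ = s₃.reg .v₂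
        · rw [if_pos a₃]
          by_cases a₂ : s₃.reg .u₁ = s₃.reg .u₂
          · rw [if_pos a₂, if_neg fun a₁ => h ⟨a₁, a₂, a₃⟩]
          · rw [if_neg a₂]
        · rw [if_neg a₃]
  · intro hr
    have hP : s.Passes i₁ i₂ X w ↔ s.arr .fin (run (s.arr .delta) i₁ w) 0 =
          s.arr .fin (run (s.arr .delta) i₂ w) 0 :=
      ⟨fun h => h.1, fun h => ⟨h, fun h' => absurd h' hr⟩⟩
    refine ⟨by omega, by simpa [ids₁] using hT, fun _ _ => id, fun h => ?_, fun h => ?_⟩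
    · rw [if_pos (hP.1 h)]
    · rw [if_neg (mt hP.2 h)]

end RAM

/-! ### Running all tests, and the decision procedure -/

namespace RAM

open Transducer

theorem testAll_spec {s : Store} {n k i₁ i₂ : ℕ} {M : Set (List ℕ)} {X : ℕ → List ℕ}
    (hδ : ∀ x ≤ n, ∀ a < k, s.arr .delta x a ≤ n) (h₁ : i₁ ≤ n)
    (hR : Ranked k n (s.arr .delta) (s.arr .fin · 0) (s.arr .rank · 0) X)
    (hX : Spelled n k (s.arr .delta) (s.arr .fin · 0) (s.arr .rank · 0) (s.arr .next · 0) X)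
    (hlen : ∀ c ≤ n, 0 < s.arr .rank c 0 → (X c).length < n + 2)
    (hP : Partitioning s n k i₁ i₂ M) :
    Wp testAll (fun t s' => t ≤ s.reg .tail * ((n + 1) * 15 + 20) + 3 ∧
      (s'.reg .ok = 1 ↔ ∀ w, Letters k w → (∃ j < s.reg .tail, s.Entry i₁ i₂ j w) →
        s.Passes i₁ i₂ X w)) s := by
  rw [testAll, wp_seq, wp_assign]
  have hmod : ∀ j, j ≠ .child → ¬ (Cmd.for .head (.var .tail) testEntry).ModArr j := by
    intro j hj
    simp [Cmd.ModArr, Cmd.for, Cmd.ifNe, check, testEntry, followChosen, loadEntry, stepPair, emit,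
      appendLetter, hj]
  have hmod' : ¬ (Cmd.for .head (.var .tail) testEntry).Mod .tail := by
    simp [Cmd.Mod, Cmd.for, Cmd.ifNe, check, testEntry, followChosen, loadEntry, stepPair, emit,
      appendLetter]
  -- Entries and tests are stated in the fixed store `s`: testing changes only the trie among the
  -- arrays, and monotonically, so they transfer to the current store.
  refine Wp.for (s.reg .tail) ((n + 1) * 15 + 18) (fun i s' =>
    IsTrie (s'.arr .child) (s'.reg .ids) ∧
    (∀ x v, Node (s.arr .child) x v → Node (s'.arr .child) x v) ∧
    ((s'.reg .ok = 1 ∧ ∀ j < i, ∀ w, s.Entry i₁ i₂ j w → s.Passes i₁ i₂ X w) ∨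
      (s'.reg .ok = 0 ∧ ∃ w, Letters k w ∧ (∃ j < s.reg .tail, s.Entry i₁ i₂ j w) ∧
        ¬ s.Passes i₁ i₂ X w))) ?_ ?_ ?_ ?_ ?_
  · simp [Cmd.Mod, Cmd.ifNe, check, testEntry, followChosen, loadEntry, stepPair, emit,
      appendLetter]
  · exact ⟨by simpa using hP.trie, fun _ _ => id, Or.inl ⟨by simp [Expr.eval], by simp⟩⟩
  · intro s' hf
    exact hf.reg .tail hmod'
  · rintro i s₁ hi hf ⟨g₁, g₂, g₃⟩ hv
    have arr₁ : ∀ j, j ≠ .child → s₁.arr j = s.arr j := fun j hj => hf.arr j (hmod j hj)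
    have hpass : ∀ w, s₁.Passes i₁ i₂ X w ↔ s.Passes i₁ i₂ X w := by
      intro w
      unfold Store.Passes
      rw [arr₁ _ (by simp), arr₁ _ (by simp), arr₁ _ (by simp), arr₁ _ (by simp),
        arr₁ _ (by simp)]
    have hE₁ : ∀ j v, s.Entry i₁ i₂ j v → s₁.Entry i₁ i₂ j v := by
      intro j v hjv
      unfold Store.Entry
      rw [arr₁ .delta (by simp), arr₁ .tape (by simp), arr₁ .wp (by simp), arr₁ .wq (by simp),
        arr₁ .wu₁ (by simp), arr₁ .wv₁ (by simp), arr₁ .wu₂ (by simp), arr₁ .wv₂ (by simp)]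
      exact hjv.mono g₂
    obtain ⟨w, hw, hE⟩ := hP.entry i hi
    refine (testEntry_spec (s := s₁) (n := n) (k := k) (i₁ := i₁) (i₂ := i₂) (w := w) (X := X)
      ?_ h₁ ?_ ?_ ?_ ?_ g₁ hw (by rw [hv]; exact hE₁ _ _ hE)).mono ?_
    · rw [arr₁ _ (by simp)]; exact hδ
    · rw [arr₁ _ (by simp)]; exact hP.gen.lab_le
    · rw [arr₁ _ (by simp), arr₁ _ (by simp), arr₁ _ (by simp)]; exact hR
    · rw [arr₁ _ (by simp), arr₁ _ (by simp), arr₁ _ (by simp), arr₁ _ (by simp)]; exact hX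
    · rw [arr₁ _ (by simp)]; exact hlen
    · rintro t s₂ hf₂ ⟨ht, hT₂, hm₂, q₁, q₂⟩
      rw [hpass] at q₁ q₂
      refine ⟨ht, by simpa using hT₂, fun x v hx => hm₂ _ _ (g₂ _ _ hx), ?_⟩
      simp only [Store.setReg_reg, reduceCtorEq, if_false]
      by_cases hp : s.Passes i₁ i₂ X w
      · rw [q₁ hp]
        refine g₃.imp_left fun ⟨hok, hall⟩ => ⟨hok, fun j hj v hjv => ?_⟩
        by_cases hji : j = i
        · subst hji
          exact (Track.passes_congr hP.trie hjv hE).2 hp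
        · exact hall j (by omega) v hjv
      · exact Or.inr ⟨q₂ hp, w, hw, ⟨i, hi, hE⟩, hp⟩
  · rintro t s' hf ⟨g₁, g₂, g₃⟩ ht
    replace ht : t ≤ s.reg .tail * ((n + 1) * 15 + 20) + 2 := ht
    refine ⟨by omega, ?_⟩
    rcases g₃ with ⟨hok, hall⟩ | ⟨hok, w, hw, hE, hp⟩
    · exact ⟨fun _ w _ ⟨j, hj, hE⟩ => hall j hj w hE, fun _ => hok⟩
    · exact ⟨fun h => by omega, fun h => absurd (h w hw hE) hp⟩

/-- The decision procedure for the equivalence of the initial states. -/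
def decideTables (k : ℕ) : Cmd := rankStates k ;; partition k ;; testAll

/-- The queued words serve as `W` in `Closed`. All three phases are quadratic; in the last, the
queue and each test are linear in `n`. -/
theorem decideTables_spec {s : Store} {n k : ℕ} (hn : s.reg .size = n + 1)
    (hδ : ∀ x ≤ n, ∀ a < k, s.arr .delta x a ≤ n) (hF : ∀ x ≤ n, s.arr .fin x 0 ≤ 1)
    (h₁ : s.reg .start₁ ≤ n) (h₂ : s.reg .start₂ ≤ n)
    (hrank : ∀ c, s.arr .rank c 0 = 0) (hchild : ∀ x a, s.arr .child x a = 0) :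
    Wp (decideTables k) (fun t s' => t ≤ (n + 2) ^ 2 * (k * 100 + 100) ∧
      (s'.reg .ok = 1 ↔ Equivalent k (s.arr .delta) (s.arr .tape) (s.arr .fin · 0)
        (s.reg .start₁) (s.reg .start₂))) s := by
  rw [decideTables, wp_seq]
  refine (rankStates_spec hn hrank).mono ?_
  rintro t₁ s₁ hf₁ ⟨ht₁, hM, hclosed⟩
  have arr₁ : ∀ j, j ≠ .rank → j ≠ .next → s₁.arr j = s.arr j := fun j hj hj' =>
    hf₁.arr j (by simp [Cmd.ModArr, Cmd.for, rankStates, markState, markLetter, hj, hj'])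
  have reg₁ : ∀ v, v = .size ∨ v = .start₁ ∨ v = .start₂ → s₁.reg v = s.reg v := by
    intro v hv
    refine hf₁.reg v ?_
    rcases hv with rfl | rfl | rfl <;>
    simp [Cmd.Mod, Cmd.for, rankStates, markState, markLetter]
  have delta₁ := arr₁ .delta (by simp) (by simp)
  have fin₁ := arr₁ .fin (by simp) (by simp)
  have tape₁ := arr₁ .tape (by simp) (by simp)
  have start₁ := reg₁ .start₁ (by simp)
  have start₂ := reg₁ .start₂ (by simp)
  obtain ⟨X, hR, hlen, hX⟩ := hM.exists_words (by rw [delta₁]; exact hδ) hclosed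
  rw [wp_seq]
  refine (partition_spec (s := s₁) (n := n) (by rw [reg₁ _ (by simp), hn])
    (by rw [delta₁]; exact hδ) (by rw [start₁]; exact h₁) (by rw [start₂]; exact h₂)
    (by rw [arr₁ _ (by simp) (by simp)]; exact hchild)).mono ?_
  rintro t₂ s₂ hf₂ ⟨ht₂, htail, hhead, M, hP⟩
  have arr₂ : ∀ j, j = .delta ∨ j = .tape ∨ j = .fin ∨ j = .rank ∨ j = .next →
      s₂.arr j = s₁.arr j := by
    intro j hj
    refine hf₂.arr j ?_
    rcases hj with rfl | rfl | rfl | rfl | rfl <;>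
    simp [Cmd.ModArr, Cmd.for, Cmd.ifNe, partition, initQueue, processEntry, relabel, push,
      loadEntry, stepPair, storeEntry, emit, appendLetter]
  have delta₂ := arr₂ .delta (by simp)
  have tape₂ := arr₂ .tape (by simp)
  have fin₂ := arr₂ .fin (by simp)
  have rank₂ := arr₂ .rank (by simp)
  have next₂ := arr₂ .next (by simp)
  rw [start₁, start₂] at hP
  have hδ₂ : ∀ x ≤ n, ∀ a < k, s₂.arr .delta x a ≤ n := by
    rw [delta₂, delta₁]; exact hδ
  have hR₂ : Ranked k n (s₂.arr .delta) (s₂.arr .fin · 0) (s₂.arr .rank · 0) X := by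
    rw [delta₂, fin₂, rank₂]; exact hR
  refine (testAll_spec (X := X) hδ₂ h₁ hR₂ ?_ ?_ hP).mono ?_
  · rw [delta₂, fin₂, rank₂, next₂]; exact hX
  · rw [rank₂]; exact hlen
  · rintro t₃ s₃ hf₃ ⟨ht₃, hok⟩
    constructor
    · have h₃ := Nat.mul_le_mul_right ((n + 1) * 15 + 20) htail
      have h₄ : mergeCost n k = (n + 1) * 5 + k * 37 + 10 := rfl
      rw [h₄] at ht₂
      have h₅ : 0 ≤ k * n ^ 2 := Nat.zero_le _
      have h₆ : 0 ≤ k * n := Nat.zero_le _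
      have h₇ : 0 ≤ n ^ 2 := Nat.zero_le _
      nlinarith
    · rw [hok, ← delta₁, ← tape₁, ← fin₁, ← delta₂, ← tape₂, ← fin₂]
      have hF₂ : ∀ x ≤ n, s₂.arr .fin x 0 ≤ 1 := by rw [fin₂, fin₁]; exact hF
      have hC : Closed k n (s₂.arr .delta) (s.reg .start₁) (s.reg .start₂) (s₂.arr .lab · 0)
          {w | Letters k w ∧ ∃ j < s₂.reg .tail, s₂.Entry (s.reg .start₁) (s.reg .start₂) j w}
          M := by
        refine ⟨hP.gen.lab_le, hP.gen.lab_lab, ⟨by simp [Letters], hP.nil⟩, hP.sub,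
          fun w hw a ha => ⟨(hP.sub w hw).1.append (Letters.singleton ha), hP.snoc w hw a ha⟩,
          fun w hw => hw.1, ?_, hP.gen.gen⟩
        rintro w ⟨-, j, hj, hE⟩
        have := hP.same j (by omega)
        rw [hE.p_eq, hE.q_eq] at this
        exact this
      constructor
      · exact fun h => equivalent_of_passes hδ₂ h₁ h₂ hC hR₂ fun w hw => h w hw.1 hw.2
      · exact fun h w hw hE => h.passes hF₂ hδ₂ h₁ h₂ hC hR₂ ⟨hw, hE⟩

end RAM

/-! ### Two machines in common state tables -/

namespace RAM

open Transducer

/-- The rows `base + 1, …, base + n` of the state tables are those of a machine. -/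
structure Rows (k n base : ℕ) (δ τ : ℕ → ℕ → ℕ) (F fin : ℕ → ℕ) (lft rgt : ℕ → ℕ → ℕ) :
    Prop where
  fin : ∀ i < n, F (base + i + 1) = fin i
  delta : ∀ i < n, ∀ a < k, δ (base + i + 1) a = target base (lft i a) (rgt i a)
  tape : ∀ i < n, ∀ a < k, τ (base + i + 1) a = side (lft i a)

/-- Read two machines and decide their equivalence. -/
def compareMachines (k : ℕ) : Cmd :=
  loadMachine k .start₁ ;; loadMachine k .start₂ ;; .assign .size (.succ (.var .base)) ;;
    decideTables k

/-- The initial store. -/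
def Store.initial (input : List ℕ) : Store where
  reg _ := 0
  arr _ _ _ := 0
  inp i := input.getD i 0
  len := input.length

theorem target_le {n base l r : ℕ} (hl : l ≤ n) (hr : r ≤ n) : target base l r ≤ base + n := by
  unfold target
  split <;> [skip; split] <;> omega

/-- The machines occupy the codes `1, …, n₁` and `n₁ + 1, …, n₁ + n₂`. Row `0` is never written, so
`0` is a rejecting sink shared by both. -/
theorem compareMachines_spec {input : List ℕ} {k n₁ n₂ : ℕ} {ini₁ fin₁ ini₂ fin₂ : ℕ → ℕ}
    {lft₁ rgt₁ lft₂ rgt₂ : ℕ → ℕ → ℕ}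
    (hT₁ : TableAt (Store.initial input).inp input.length 0 k n₁ ini₁ fin₁ lft₁ rgt₁)
    (hT₂ : TableAt (Store.initial input).inp input.length (0 + 1 + n₁ * (2 * k + 2)) k n₂
      ini₂ fin₂ lft₂ rgt₂)
    (hl₁ : ∀ i < n₁, ∀ a < k, lft₁ i a ≤ n₁) (hr₁ : ∀ i < n₁, ∀ a < k, rgt₁ i a ≤ n₁)
    (hl₂ : ∀ i < n₂, ∀ a < k, lft₂ i a ≤ n₂) (hr₂ : ∀ i < n₂, ∀ a < k, rgt₂ i a ≤ n₂)
    (hf₁ : ∀ i < n₁, fin₁ i ≤ 1) (hf₂ : ∀ i < n₂, fin₂ i ≤ 1) {i₁ i₂ : ℕ}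
    (hi₁ : i₁ < n₁) (hini₁ : 0 < ini₁ i₁) (hini₁' : ∀ i < n₁, 0 < ini₁ i → i = i₁)
    (hi₂ : i₂ < n₂) (hini₂ : 0 < ini₂ i₂) (hini₂' : ∀ i < n₂, 0 < ini₂ i → i = i₂) :
    Wp (compareMachines k) (fun t s' => t ≤ (k + 1) * 1000 * (n₁ + n₂) ^ 2 ∧
      ∃ δ τ F, (∀ a, δ 0 a = 0) ∧ F 0 = 0 ∧ Rows k n₁ 0 δ τ F fin₁ lft₁ rgt₁ ∧
        Rows k n₂ n₁ δ τ F fin₂ lft₂ rgt₂ ∧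
        (s'.reg .ok = 1 ↔ Equivalent k δ τ F (0 + i₁ + 1) (n₁ + i₂ + 1)))
      (Store.initial input) := by
  rw [compareMachines, wp_seq]
  refine Wp.mono (loadMachine_spec (Or.inl rfl) (s := Store.initial input) hT₁ hl₁ hr₁ rfl hi₁
    hini₁ hini₁') ?_
  rintro t₁ s₁ hfr₁ ⟨ht₁, pos₁, base₁, start₁, code₁, row₁, old₁⟩
  replace base₁ : s₁.reg .base = n₁ := base₁.trans (Nat.zero_add _)
  replace pos₁ : s₁.reg .pos = 0 + 1 + n₁ * (2 * k + 2) := pos₁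
  replace start₁ : s₁.reg .start₁ = 0 + i₁ + 1 := start₁
  rw [wp_seq]
  refine (loadMachine_spec (Or.inr rfl) (k := k) (n := n₂)
    (by rw [hfr₁.inp, hfr₁.len, pos₁]; exact hT₂) hl₂ hr₂ code₁ hi₂ hini₂ hini₂').mono ?_
  rw [base₁]
  rintro t₂ s₂ hfr₂ ⟨ht₂, -, base₂, start₂, -, row₂, old₂⟩
  have start₁' := (hfr₂.reg .start₁ (by
    simp [Cmd.Mod, Cmd.for, loadMachine, loadCodes, loadState, loadLetter, next])).trans start₁
  have arr₂ : ∀ j, j = .rank ∨ j = .child → s₂.arr j = fun _ _ => 0 := by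
    intro j hj
    refine (hfr₂.arr j ?_).trans (hfr₁.arr j ?_) <;> rcases hj with rfl | rfl <;>
    simp [Cmd.ModArr, Cmd.for, loadMachine, loadCodes, loadState, loadLetter, next]
  have z₁ : ∀ c, c = 0 ∨ n₁ < c → s₁.arr .fin c 0 = 0 ∧ ∀ a, s₁.arr .delta c a = 0 := by
    intro c hc
    have h := old₁ c (by
      change c ≤ 0 ∨ 0 + n₁ < c
      omega)
    exact ⟨h.1, fun a => congrFun h.2.1 a⟩
  have hz : s₂.arr .fin 0 0 = 0 ∧ ∀ a, s₂.arr .delta 0 a = 0 := by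
    have h := old₂ 0 (Or.inl (Nat.zero_le _))
    have h' := z₁ 0 (Or.inl rfl)
    exact ⟨h.1.trans h'.1, fun a => (congrFun h.2.1 a).trans (h'.2 a)⟩
  have hR₁ : Rows k n₁ 0 (s₂.arr .delta) (s₂.arr .tape) (s₂.arr .fin · 0) fin₁ lft₁ rgt₁ := by
    have h := fun i (hi : i < n₁) => old₂ (0 + i + 1) (Or.inl (by omega))
    exact ⟨fun i hi => (h i hi).1.trans (row₁ i hi).fin,
      fun i hi a ha => (congrFun (h i hi).2.1 a).trans ((row₁ i hi).delta a ha),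
      fun i hi a ha => (congrFun (h i hi).2.2 a).trans ((row₁ i hi).tape a ha)⟩
  have hR₂ : Rows k n₂ n₁ (s₂.arr .delta) (s₂.arr .tape) (s₂.arr .fin · 0) fin₂ lft₂ rgt₂ :=
    ⟨fun i hi => (row₂ i hi).fin, fun i hi => (row₂ i hi).delta, fun i hi => (row₂ i hi).tape⟩
  have hcode : ∀ x ≤ n₁ + n₂, x = 0 ∨ (∃ i < n₁, x = 0 + i + 1) ∨ ∃ i < n₂, x = n₁ + i + 1 := by
    intro x hx
    rcases Nat.eq_zero_or_pos x with h | h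
    · exact Or.inl h
    · by_cases hx' : x ≤ n₁
      · exact Or.inr (Or.inl ⟨x - 1, by omega, by omega⟩)
      · exact Or.inr (Or.inr ⟨x - n₁ - 1, by omega, by omega⟩)
  rw [wp_seq, wp_assign]
  refine Wp.mono (decideTables_spec (n := n₁ + n₂) (k := k) ?_ ?_ ?_ ?_ ?_ ?_ ?_) ?_
  · simp [base₂]
  · intro x hx a ha
    simp only [Store.setReg_arr]
    obtain rfl | ⟨i, hi, rfl⟩ | ⟨i, hi, rfl⟩ := hcode x hx
    · rw [hz.2]; omega
    · rw [hR₁.delta i hi a ha]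
      have := target_le (base := 0) (hl₁ i hi a ha) (hr₁ i hi a ha)
      omega
    · rw [hR₂.delta i hi a ha]
      exact target_le (hl₂ i hi a ha) (hr₂ i hi a ha)
  · intro x hx
    simp only [Store.setReg_arr]
    obtain rfl | ⟨i, hi, rfl⟩ | ⟨i, hi, rfl⟩ := hcode x hx
    · rw [hz.1]; omega
    · exact (hR₁.fin i hi).le.trans (hf₁ i hi)
    · exact (hR₂.fin i hi).le.trans (hf₂ i hi)
  · simp [start₁']; omega
  · simp [start₂]; omega
  · simp [arr₂]
  · simp [arr₂]
  · rintro t₃ s₃ hfr₃ ⟨ht₃, hok⟩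
    refine ⟨?_, s₂.arr .delta, s₂.arr .tape, (s₂.arr .fin · 0), hz.2, hz.1, hR₁, hR₂, ?_⟩
    -- Each machine has at least one state, which lets the lower-order terms be absorbed into the
    -- square.
    · obtain ⟨m, hm⟩ : ∃ m, n₁ + n₂ = m + 2 := ⟨n₁ + n₂ - 2, by omega⟩
      have h₁ : n₁ * (k * 9 + 16) + n₂ * (k * 9 + 16) = (m + 2) * (k * 9 + 16) := by
        rw [← hm, Nat.add_mul]
      rw [hm] at ht₃ ⊢
      have h₅ : 0 ≤ k * m ^ 2 := Nat.zero_le _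
      have h₆ : 0 ≤ k * m := Nat.zero_le _
      have h₇ : 0 ≤ m ^ 2 := Nat.zero_le _
      nlinarith
    · simpa [start₁', start₂] using hok

end RAM

/-! ## Behaviours in terms of state tables -/

namespace Spliffer

open Transducer RAM

variable {A Q : Type*} {k n : ℕ}

/-- A word as a list of letter numbers. -/
def num (α : A ≃ Fin k) (w : FreeMonoid A) : List ℕ := (FreeMonoid.toList w).map fun a => (α a : ℕ)

theorem num_one (α : A ≃ Fin k) : num α 1 = [] := rfl

theorem num_of (α : A ≃ Fin k) (a : A) : num α (FreeMonoid.of a) = [(α a : ℕ)] := rfl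

theorem num_mul (α : A ≃ Fin k) (w w' : FreeMonoid A) :
    num α (w * w') = num α w ++ num α w' := by
  simp [num]

theorem num_injective (α : A ≃ Fin k) : Function.Injective (num α) := by
  intro w w' h
  refine FreeMonoid.toList.injective (List.map_injective_iff.2 (fun a b hab => ?_) h)
  exact α.injective (Fin.ext hab)

theorem letters_num (α : A ≃ Fin k) (w : FreeMonoid A) : Letters k (num α w) := by
  intro a ha
  obtain ⟨b, -, rfl⟩ := List.mem_map.1 ha
  exact (α b).isLt

/-- The number of a state in the tables. -/
def stateCode (e : Q ≃ Fin n) (base : ℕ) (q : Q) : ℕ := base + (e q : ℕ) + 1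

/-- The tables `δ`, `τ`, `F` describe the transitions and final states of `S`. -/
structure Tabulated (S : Spliffer A Q) (α : A ≃ Fin k) (e : Q ≃ Fin n) (base : ℕ)
    (δ τ : ℕ → ℕ → ℕ) (F : ℕ → ℕ) : Prop where
  fin : ∀ q, 0 < F (stateCode e base q) ↔ q ∈ S.final
  left : ∀ q a p, (q, ShufflingMonoid.left a, p) ∈ S.trans →
    δ (stateCode e base q) (α a) = stateCode e base p ∧ τ (stateCode e base q) (α a) = 0
  right : ∀ q a p, (q, ShufflingMonoid.right a, p) ∈ S.trans →
    δ (stateCode e base q) (α a) = stateCode e base p ∧ τ (stateCode e base q) (α a) = 1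
  dead : ∀ q a, (∀ p, (q, ShufflingMonoid.left a, p) ∉ S.trans) →
    (∀ p, (q, ShufflingMonoid.right a, p) ∉ S.trans) → δ (stateCode e base q) (α a) = 0

variable {S : Spliffer A Q} {α : A ≃ Fin k} {e : Q ≃ Fin n} {base : ℕ} {δ τ : ℕ → ℕ → ℕ}
  {F : ℕ → ℕ}

theorem eq_left_or_right {g : ShufflingMonoid A} (hg : (g : Triple A) ∈ shufflingGenerators A) :
    (∃ a, g = ShufflingMonoid.left a) ∨ ∃ a, g = ShufflingMonoid.right a := by
  rcases hg with ⟨a, ha⟩ | ⟨a, ha⟩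
  · exact Or.inl ⟨a, Subtype.ext ha⟩
  · exact Or.inr ⟨a, Subtype.ext ha⟩

theorem Tabulated.path (hS : Tabulated S α e base δ τ F) {q p : Q} {u : ShufflingMonoid A}
    (h : S.Path q u p) :
    run δ (stateCode e base q) (num α (u : Triple A).2.2) = stateCode e base p ∧
    num α (u : Triple A).1 =
      out δ τ true (stateCode e base q) (num α (u : Triple A).2.2) ∧
    num α (u : Triple A).2.1 =
      out δ τ false (stateCode e base q) (num α (u : Triple A).2.2) := by
  induction h with
  | nil p => exact ⟨rfl, rfl, rfl⟩
  | @cons p q r g u ht _ ih =>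
    obtain ⟨ih₁, ih₂, ih₃⟩ := ih
    rcases eq_left_or_right (S.label_mem _ ht) with ⟨a, rfl⟩ | ⟨a, rfl⟩
    · obtain ⟨h₁, h₂⟩ := hS.left _ _ _ ht
      simp only [ShufflingMonoid.left, Submonoid.coe_mul, Prod.fst_mul, Prod.snd_mul, num_mul,
        num_of, num_one, List.singleton_append, List.nil_append, run_cons, out_cons, chunk, h₁, h₂,
        decide_true, if_true, reduceCtorEq, if_false]
      exact ⟨ih₁, by rw [ih₂], ih₃⟩
    · obtain ⟨h₁, h₂⟩ := hS.right _ _ _ ht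
      simp only [ShufflingMonoid.right, Submonoid.coe_mul, Prod.fst_mul, Prod.snd_mul, num_mul,
        num_of, num_one, List.singleton_append, List.nil_append, run_cons, out_cons, chunk, h₁, h₂,
        one_ne_zero, decide_false, if_true, reduceCtorEq, if_false]
      exact ⟨ih₁, ih₂, by rw [ih₃]⟩

theorem run_zero (h0 : ∀ a, δ 0 a = 0) (w : List ℕ) : run δ 0 w = 0 := by
  induction w with
  | nil => rfl
  | cons a w ih => rw [run_cons, h0, ih]

/-- A run follows transitions until one is missing; from then on it stays in the dead state. -/
theorem Tabulated.exists_path (hS : Tabulated S α e base δ τ F) (h0 : ∀ a, δ 0 a = 0) {w : List ℕ}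
    (hw : Letters k w) (q : Q) : run δ (stateCode e base q) w = 0 ∨
      ∃ u p, S.Path q u p ∧ num α (u : Triple A).2.2 = w ∧
        run δ (stateCode e base q) w = stateCode e base p := by
  induction w generalizing q with
  | nil => exact Or.inr ⟨1, q, .nil q, rfl, rfl⟩
  | cons b w ih =>
    have hw' : Letters k w := fun x hx => hw x (List.mem_cons_of_mem _ hx)
    obtain ⟨a, rfl⟩ : ∃ a, (α a : ℕ) = b :=
      ⟨α.symm ⟨b, hw b (by simp)⟩, by simp⟩
    by_cases hl : ∃ p, (q, ShufflingMonoid.left a, p) ∈ S.trans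
    · obtain ⟨p, hp⟩ := hl
      rw [run_cons, (hS.left _ _ _ hp).1]
      refine (ih hw' p).imp_right fun ⟨u, r, hu, hn, hr⟩ => ⟨_, r, .cons hp hu, ?_, hr⟩
      rw [Submonoid.coe_mul, Prod.snd_mul, Prod.snd_mul, num_mul, hn]
      rfl
    · by_cases hr : ∃ p, (q, ShufflingMonoid.right a, p) ∈ S.trans
      · obtain ⟨p, hp⟩ := hr
        rw [run_cons, (hS.right _ _ _ hp).1]
        refine (ih hw' p).imp_right fun ⟨u, r, hu, hn, hr⟩ => ⟨_, r, .cons hp hu, ?_, hr⟩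
        rw [Submonoid.coe_mul, Prod.snd_mul, Prod.snd_mul, num_mul, hn]
        rfl
      · left
        rw [run_cons, hS.dead q a (fun p hp => hl ⟨p, hp⟩) fun p hp => hr ⟨p, hp⟩,
          run_zero h0]

/-- An accepting run on the third coordinate yields a path with some label `v`. The outputs of the
run fix the other two coordinates of `v`, so `u = v`. -/
theorem Tabulated.mem_behaviour_iff (hS : Tabulated S α e base δ τ F) (h0 : ∀ a, δ 0 a = 0)
    (hF : F 0 = 0) {i : Q} (hi : S.init = {i}) (u : ShufflingMonoid A) :
    u ∈ S.behaviour ↔ 0 < F (run δ (stateCode e base i) (num α (u : Triple A).2.2)) ∧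
      num α (u : Triple A).1 =
        out δ τ true (stateCode e base i) (num α (u : Triple A).2.2) ∧
      num α (u : Triple A).2.1 =
        out δ τ false (stateCode e base i) (num α (u : Triple A).2.2) := by
  constructor
  · rintro ⟨j, hj, t, ht, hp⟩
    rw [hi] at hj
    obtain rfl : j = i := hj
    obtain ⟨h₁, h₂, h₃⟩ := hS.path hp
    exact ⟨by rw [h₁]; exact (hS.fin t).2 ht, h₂, h₃⟩
  · rintro ⟨h₁, h₂, h₃⟩
    rcases hS.exists_path h0 (letters_num α (u : Triple A).2.2) i with h | ⟨v, p, hv, hn, hr⟩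
    · rw [h, hF] at h₁
      exact absurd h₁ (lt_irrefl 0)
    · obtain ⟨-, g₂, g₃⟩ := hS.path hv
      rw [hn] at g₂ g₃
      have huv : u = v := Subtype.ext (Prod.ext (num_injective α (h₂.trans g₂.symm))
        (Prod.ext (num_injective α (h₃.trans g₃.symm)) (num_injective α hn.symm)))
      rw [hr] at h₁
      exact ⟨i, by rw [hi]; rfl, p, (hS.fin p).1 h₁, huv ▸ hv⟩

theorem Tabulated.exists_mem_behaviour (hS : Tabulated S α e base δ τ F) (h0 : ∀ a, δ 0 a = 0)
    (hF : F 0 = 0) {i : Q} (hi : S.init = {i}) {w : List ℕ} (hw : Letters k w)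
    (h : 0 < F (run δ (stateCode e base i) w)) :
    ∃ u ∈ S.behaviour, num α (u : Triple A).2.2 = w := by
  rcases hS.exists_path h0 hw i with h' | ⟨v, p, hv, hn, hr⟩
  · rw [h', hF] at h
    exact absurd h (lt_irrefl 0)
  · rw [hr] at h
    exact ⟨v, ⟨i, by rw [hi]; rfl, p, (hS.fin p).1 h, hv⟩, hn⟩

/-- Each behaviour is the graph of the partial map from accepted words to their two outputs, so
equal behaviours mean equal domains and equal values. -/
theorem behaviour_eq_iff {Q₁ Q₂ : Type*} {n₁ n₂ base₁ base₂ : ℕ} {S₁ : Spliffer A Q₁}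
    {S₂ : Spliffer A Q₂} {e₁ : Q₁ ≃ Fin n₁} {e₂ : Q₂ ≃ Fin n₂}
    (hS₁ : Tabulated S₁ α e₁ base₁ δ τ F) (hS₂ : Tabulated S₂ α e₂ base₂ δ τ F)
    (h0 : ∀ a, δ 0 a = 0) (hF : F 0 = 0) {i₁ : Q₁} (hi₁ : S₁.init = {i₁}) {i₂ : Q₂}
    (hi₂ : S₂.init = {i₂}) :
    S₁.behaviour = S₂.behaviour ↔
      Equivalent k δ τ F (stateCode e₁ base₁ i₁) (stateCode e₂ base₂ i₂) := by
  constructor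
  · intro h w hw
    have h₁ : 0 < F (run δ (stateCode e₁ base₁ i₁) w) → 0 < F (run δ (stateCode e₂ base₂ i₂) w) ∧
        ∀ b, out δ τ b (stateCode e₁ base₁ i₁) w = out δ τ b (stateCode e₂ base₂ i₂) w := by
      intro hf
      obtain ⟨u, hu, rfl⟩ := hS₁.exists_mem_behaviour h0 hF hi₁ hw hf
      obtain ⟨-, g₁, g₂⟩ := (hS₁.mem_behaviour_iff h0 hF hi₁ u).1 hu
      rw [h] at hu
      obtain ⟨hf', g₃, g₄⟩ := (hS₂.mem_behaviour_iff h0 hF hi₂ u).1 hu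
      refine ⟨hf', fun b => ?_⟩
      cases b
      exacts [g₂.symm.trans g₄, g₁.symm.trans g₃]
    refine ⟨⟨fun hf => (h₁ hf).1, fun hf => ?_⟩, fun hf => (h₁ hf).2⟩
    obtain ⟨u, hu, rfl⟩ := hS₂.exists_mem_behaviour h0 hF hi₂ hw hf
    rw [← h] at hu
    exact ((hS₁.mem_behaviour_iff h0 hF hi₁ u).1 hu).1
  · intro h
    ext u
    rw [hS₁.mem_behaviour_iff h0 hF hi₁, hS₂.mem_behaviour_iff h0 hF hi₂]
    obtain ⟨h₁, h₂⟩ := h _ (letters_num α (u : Triple A).2.2)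
    constructor
    · rintro ⟨g₁, g₂, g₃⟩
      exact ⟨h₁.1 g₁, g₂.trans (h₂ g₁ _), g₃.trans (h₂ g₁ _)⟩
    · rintro ⟨g₁, g₂, g₃⟩
      exact ⟨h₁.2 g₁, g₂.trans (h₂ (h₁.2 g₁) _).symm, g₃.trans (h₂ (h₁.2 g₁) _).symm⟩

end Spliffer

/-! ### Indexing into a concatenation of blocks of equal length -/

namespace List

theorem length_flatten_ofFn {n m : ℕ} (f : Fin n → List ℕ) (hf : ∀ i, (f i).length = m) :
    (List.ofFn f).flatten.length = n * m := by
  induction n with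
  | zero => simp
  | succ n ih =>
    rw [List.ofFn_succ, List.flatten_cons, List.length_append, hf, ih _ fun i => hf _, Nat.succ_mul,
      Nat.add_comm]

theorem getD_flatten_ofFn {n m : ℕ} (f : Fin n → List ℕ) (hf : ∀ i, (f i).length = m)
    (i : Fin n) {r : ℕ} (hr : r < m) :
    (List.ofFn f).flatten.getD (i * m + r) 0 = (f i).getD r 0 := by
  induction n with
  | zero => exact i.elim0
  | succ n ih =>
    rw [List.ofFn_succ, List.flatten_cons]
    refine Fin.cases ?_ (fun j => ?_) i
    · rw [List.getD_append _ _ _ _ (by simpa [hf] using hr)]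
      simp
    · have e : ((j.succ : Fin (n + 1)) : ℕ) * m + r = m + (j * m + r) := by
        rw [Fin.val_succ, Nat.succ_mul]
        omega
      rw [e, List.getD_append_right _ _ _ _ (by rw [hf]; omega), hf, Nat.add_sub_cancel_left]
      exact ih (fun j => f j.succ) (fun j => hf _) j

end List

namespace Spliffer

open Transducer RAM

variable {A Q : Type*} {k n : ℕ}

/-! ## The encoding -/

theorem length_stateRecord (α : A ≃ Fin k) (e : Q ≃ Fin n) (S : Spliffer A Q) (q : Q) :
    (S.stateRecord α e q).length = 2 * k + 2 := by
  rw [stateRecord, List.length_append, List.length_flatten_ofFn (m := 2) _ fun _ => rfl]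
  simp
  ring

theorem stateRecord_getD (α : A ≃ Fin k) (e : Q ≃ Fin n) (S : Spliffer A Q) (q : Q) (a : A) :
    (S.stateRecord α e q).getD (2 + 2 * (α a : ℕ)) 0 = S.entry e q (ShufflingMonoid.left a) ∧
    (S.stateRecord α e q).getD (2 + 2 * (α a : ℕ) + 1) 0 =
      S.entry e q (ShufflingMonoid.right a) := by
  have h := fun r (hr : r < 2) => List.getD_flatten_ofFn (m := 2) (fun a : Fin k =>
      [S.entry e q (ShufflingMonoid.left (α.symm a)),
        S.entry e q (ShufflingMonoid.right (α.symm a))]) (fun _ => rfl) (α a) hr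
  constructor
  · rw [stateRecord, List.getD_append_right _ _ _ _ (by simp)]
    have := h 0 (by omega)
    simp only [Equiv.symm_apply_apply] at this
    refine Eq.trans ?_ this
    congr 1
    simp; omega
  · rw [stateRecord, List.getD_append_right _ _ _ _ (by simp; omega)]
    have := h 1 (by omega)
    simp only [Equiv.symm_apply_apply] at this
    refine Eq.trans ?_ this
    congr 1
    simp; omega

/-- The record of the state number `i`. -/
noncomputable def record (α : A ≃ Fin k) (e : Q ≃ Fin n) (S : Spliffer A Q) (i : ℕ) : List ℕ :=
  if h : i < n then S.stateRecord α e (e.symm ⟨i, h⟩) else []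

theorem record_apply (α : A ≃ Fin k) (e : Q ≃ Fin n) (S : Spliffer A Q) (q : Q) :
    S.record α e (e q) = S.stateRecord α e q := by
  simp [record]

theorem length_encode (α : A ≃ Fin k) (e : Q ≃ Fin n) (S : Spliffer A Q) :
    (S.encode α e).length = 1 + n * (2 * k + 2) := by
  rw [encode, List.length_cons, List.length_flatten_ofFn _ fun i => S.length_stateRecord α e _,
    Nat.add_comm]

/-- The surrounding lists `l` and `l'` allow one statement to serve both machines in the
concatenated input. -/
theorem tableAt_encode (α : A ≃ Fin k) (e : Q ≃ Fin n) (S : Spliffer A Q) (l l' : List ℕ) :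
    TableAt (Store.initial (l ++ (S.encode α e ++ l'))).inp (l ++ (S.encode α e ++ l')).length
      l.length k n (fun i => (S.record α e i).getD 0 0) (fun i => (S.record α e i).getD 1 0)
      (fun i a => (S.record α e i).getD (2 + 2 * a) 0)
      (fun i a => (S.record α e i).getD (2 + 2 * a + 1) 0) := by
  have h₁ : ∀ j < 1 + n * (2 * k + 2), (Store.initial (l ++ (S.encode α e ++ l'))).inp
      (l.length + j) = (S.encode α e).getD j 0 := by
    intro j hj
    change (l ++ (S.encode α e ++ l')).getD (l.length + j) 0 = _
    rw [List.getD_append_right _ _ _ _ (by omega), Nat.add_sub_cancel_left,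
      List.getD_append _ _ _ _ (by rw [length_encode]; exact hj)]
  have h₂ : ∀ i < n, ∀ r < 2 * k + 2, (Store.initial (l ++ (S.encode α e ++ l'))).inp
      (l.length + 1 + i * (2 * k + 2) + r) = (S.record α e i).getD r 0 := by
    intro i hi r hr
    have hle : (i + 1) * (2 * k + 2) ≤ n * (2 * k + 2) := Nat.mul_le_mul_right _ hi
    rw [Nat.succ_mul] at hle
    rw [show l.length + 1 + i * (2 * k + 2) + r = l.length + (i * (2 * k + 2) + r + 1) by ring,
      h₁ _ (by omega), encode, List.getD_cons_succ, record, dif_pos hi]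
    exact List.getD_flatten_ofFn _ (fun i => S.length_stateRecord α e _) ⟨i, hi⟩ hr
  refine ⟨?_, ?_, ?_, ?_, ?_, ?_⟩
  · exact h₁ 0 (by omega)
  · exact fun i hi => h₂ i hi 0 (by omega)
  · exact fun i hi => h₂ i hi 1 (by omega)
  · exact fun i hi a ha => (congrArg _ (by omega)).trans (h₂ i hi (2 + 2 * a) (by omega))
  · exact fun i hi a ha => (congrArg _ (by omega)).trans (h₂ i hi (2 + 2 * a + 1) (by omega))
  · rw [List.length_append, List.length_append, length_encode]
    omega

theorem entry_le (e : Q ≃ Fin n) (S : Spliffer A Q) (q : Q) (g : ShufflingMonoid A) :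
    S.entry e q g ≤ n := by
  unfold entry
  split
  · exact (e _).isLt
  · exact Nat.zero_le _

theorem stateRecord_le (α : A ≃ Fin k) (e : Q ≃ Fin n) (S : Spliffer A Q) (q : Q) {x : ℕ}
    (hx : x ∈ S.stateRecord α e q) : x ≤ n := by
  have hn : 0 < n := (e q).pos
  rw [stateRecord, List.mem_append] at hx
  rcases hx with hx | hx
  · simp only [List.mem_cons, List.not_mem_nil, or_false] at hx
    rcases hx with rfl | rfl <;> split <;> omega
  · obtain ⟨l, hl, hx⟩ := List.mem_flatten.1 hx
    obtain ⟨a, rfl⟩ := List.mem_ofFn.1 hl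
    simp only [List.mem_cons, List.not_mem_nil, or_false] at hx
    rcases hx with rfl | rfl <;> exact entry_le _ _ _ _

theorem encode_le (α : A ≃ Fin k) (e : Q ≃ Fin n) (S : Spliffer A Q) {x : ℕ}
    (hx : x ∈ S.encode α e) : x ≤ n := by
  rw [encode, List.mem_cons] at hx
  rcases hx with rfl | hx
  · exact le_rfl
  · obtain ⟨l, hl, hx⟩ := List.mem_flatten.1 hx
    obtain ⟨a, rfl⟩ := List.mem_ofFn.1 hl
    exact stateRecord_le _ _ _ _ hx

theorem record_getD_le (α : A ≃ Fin k) (e : Q ≃ Fin n) (S : Spliffer A Q) (i r : ℕ) :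
    (S.record α e i).getD r 0 ≤ n := by
  unfold record
  split
  · rcases lt_or_ge r (S.stateRecord α e (e.symm ⟨i, ‹_›⟩)).length with h | h
    · rw [List.getD_eq_getElem _ _ h]
      exact stateRecord_le _ _ _ _ (List.getElem_mem _)
    · rw [List.getD_eq_default _ _ h]
      exact Nat.zero_le _
  · exact Nat.zero_le _

open Classical in
theorem record_getD_zero (α : A ≃ Fin k) (e : Q ≃ Fin n) (S : Spliffer A Q) (q : Q) :
    (S.record α e (e q)).getD 0 0 = if q ∈ S.init then 1 else 0 := by
  rw [record_apply]
  rfl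

theorem record_getD_init (α : A ≃ Fin k) (e : Q ≃ Fin n) (S : Spliffer A Q) {q : Q}
    (hq : S.init = {q}) : 0 < (S.record α e (e q)).getD 0 0 ∧
      ∀ i < n, 0 < (S.record α e i).getD 0 0 → i = e q := by
  refine ⟨by rw [record_getD_zero, hq]; simp, fun i hi h => ?_⟩
  obtain ⟨p, rfl⟩ : ∃ p, (e p : ℕ) = i := ⟨e.symm ⟨i, hi⟩, by simp⟩
  rw [record_getD_zero, hq] at h
  split at h
  · next hp => rw [Set.mem_singleton_iff.1 hp]
  · exact absurd h (lt_irrefl 0)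

open Classical in
theorem record_getD_one (α : A ≃ Fin k) (e : Q ≃ Fin n) (S : Spliffer A Q) (q : Q) :
    (S.record α e (e q)).getD 1 0 = if q ∈ S.final then 1 else 0 := by
  rw [record_apply]
  rfl

theorem record_getD_one_le (α : A ≃ Fin k) (e : Q ≃ Fin n) (S : Spliffer A Q) {i : ℕ}
    (hi : i < n) : (S.record α e i).getD 1 0 ≤ 1 := by
  have h := record_getD_one α e S (e.symm ⟨i, hi⟩)
  rw [Equiv.apply_symm_apply] at h
  rw [h]
  split <;> omega

theorem IsDeterministic.entry_eq {S : Spliffer A Q} (hS : S.IsDeterministic) (e : Q ≃ Fin n)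
    {q p : Q} {g : ShufflingMonoid A} {a : A} (hg : (g : Triple A).2.2 = FreeMonoid.of a)
    (h : (q, g, p) ∈ S.trans) : S.entry e q g = e p + 1 := by
  have hex : ∃ p, (q, g, p) ∈ S.trans := ⟨p, h⟩
  rw [entry, dif_pos hex, (hS.unique_trans q a g g _ p hex.choose_spec h hg hg).2]

theorem entry_eq_zero {S : Spliffer A Q} (e : Q ≃ Fin n) {q : Q} {g : ShufflingMonoid A}
    (h : ∀ p, (q, g, p) ∉ S.trans) : S.entry e q g = 0 := by
  rw [entry, dif_neg fun ⟨p, hp⟩ => h p hp]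

theorem left_ne_right (a b : A) : ShufflingMonoid.left a ≠ ShufflingMonoid.right b := by
  intro h
  have h' : (FreeMonoid.of a : FreeMonoid A) = 1 :=
    congrArg (fun g : ShufflingMonoid A => (g : Triple A).1) h
  exact FreeMonoid.of_ne_one a h'

/-- The single slot for a state and a letter loses nothing: by determinism, left and right
transitions with the same letter cannot leave the same state, and targets are unique. -/
theorem IsDeterministic.tabulated {S : Spliffer A Q} (hS : S.IsDeterministic) {α : A ≃ Fin k}
    {e : Q ≃ Fin n} {base : ℕ} {δ τ : ℕ → ℕ → ℕ} {F : ℕ → ℕ}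
    (h : Rows k n base δ τ F (fun i => (S.record α e i).getD 1 0)
      (fun i a => (S.record α e i).getD (2 + 2 * a) 0)
      (fun i a => (S.record α e i).getD (2 + 2 * a + 1) 0)) :
    Tabulated S α e base δ τ F := by
  have hδ : ∀ q a, δ (stateCode e base q) (α a) = target base
      (S.entry e q (ShufflingMonoid.left a)) (S.entry e q (ShufflingMonoid.right a)) := by
    intro q a
    have := h.delta (e q) (e q).isLt (α a) (α a).isLt
    rw [record_apply, (stateRecord_getD α e S q a).1, (stateRecord_getD α e S q a).2] at this
    exact this
  have hτ : ∀ q a, τ (stateCode e base q) (α a) =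
      side (S.entry e q (ShufflingMonoid.left a)) := by
    intro q a
    have := h.tape (e q) (e q).isLt (α a) (α a).isLt
    rw [record_apply, (stateRecord_getD α e S q a).1] at this
    exact this
  constructor
  · intro q
    have := h.fin (e q) (e q).isLt
    rw [record_getD_one] at this
    rw [stateCode, this]
    split <;> simp [*]
  · intro q a p hp
    rw [hδ, hτ, hS.entry_eq e rfl hp]
    simp [target, side, stateCode, Nat.add_assoc]
  · intro q a p hp
    have hl : ∀ p', (q, ShufflingMonoid.left a, p') ∉ S.trans := fun p' hp' =>
      left_ne_right a a (hS.unique_trans q a _ _ _ _ hp' hp rfl rfl).1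
    rw [hδ, hτ, entry_eq_zero e hl, hS.entry_eq e rfl hp]
    simp [target, side, stateCode, Nat.add_assoc]
  · intro q a hl hr
    rw [hδ, entry_eq_zero e hl, entry_eq_zero e hr]
    rfl

end Spliffer

/-! ### Word size and the complete machine program -/

namespace RAM

open Spliffer

/-- For positive numbers, `pair V V + V ≤ 6 * V ^ 2` and `pair U U ≤ 5 * U ^ 2`, whence `5 * 36 =
180` and a quartic bound in `V`. Substituting `V ≤ c * m ^ 2` gives degree `8`. -/
theorem wordBound_le {o V m c a : ℕ} (hV : V ≤ c * m ^ 2) (ho : o ≤ a * m) (hm : 1 ≤ m)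
    (hc : 1 ≤ c) : wordBound o V ≤ (180 * c ^ 4 + a + c) * m ^ 8 := by
  refine (wordBound_mono hV).trans ?_
  have h₁ : 1 ≤ c * m ^ 2 := Nat.mul_pos hc (Nat.pow_pos hm)
  have h₂ : m ≤ m ^ 8 := Nat.le_self_pow (by omega) m
  have h₃ : m ^ 2 ≤ m ^ 8 := Nat.pow_le_pow_right hm (by omega)
  have h₄ : a * m ≤ a * m ^ 8 := Nat.mul_le_mul_left _ h₂
  have h₅ : c * m ^ 2 ≤ c * m ^ 8 := Nat.mul_le_mul_left _ h₃
  have h₆ : 180 * c ^ 4 * m ^ 8 = 180 * (c * m ^ 2) ^ 4 := by ring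
  have key : ∀ V, 1 ≤ V → pair (pair V V + V) (pair V V + V) ≤ 180 * V ^ 4 := by
    intro V hV
    have h₇ : pair V V + V ≤ 6 * V ^ 2 := by
      unfold pair
      nlinarith
    have h₈ : ∀ U, 1 ≤ U → pair U U ≤ 5 * U ^ 2 := by
      intro U hU
      unfold pair
      nlinarith
    refine (pair_mono h₇ h₇).trans ((h₈ _ (Nat.mul_pos (by omega) (Nat.pow_pos hV))).trans ?_)
    exact le_of_eq (by ring)
  have h₉ := key _ h₁
  rw [Nat.add_mul, Nat.add_mul, h₆]
  unfold wordBound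
  omega

/-- The part of the program that computes the address of the first cell after the input. -/
def prologue (k : ℕ) : Program :=
  .seq (.load 5 3) (.seq (.const 7 (2 * k + 2)) (.seq (.mul 5 5 7) (.seq (.const 9 1)
    (.seq (.add 5 5 9) (.seq (.load 3 5) (.seq (.mul 3 3 7) (.seq (.add 3 3 5) (.add 1 3 9))))))))

/-- The program: find the first cell after the input, run the compiled comparison, and copy the
answer to register `0`. -/
def mainProgram (k : ℕ) : Program :=
  .seq (prologue k) (.seq (compareMachines k).compile
    (.seq (.const 0 0) (.add 0 0 (Var.loc .ok))))

/-- The length of the input is not given to the machine. It is computed from the two state counts,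
the second of which lies right after the first table. Only odd registers are used, so all variables
are still `0`. -/
theorem exec_prologue {W k n₁ n₂ : ℕ} {input : List ℕ} (h₁ : input.getD 0 0 = n₁)
    (h₂ : input.getD (n₁ * (2 * k + 2) + 1) 0 = n₂) (hn₁ : 1 ≤ n₁)
    (hlen : input.length = n₂ * (2 * k + 2) + (n₁ * (2 * k + 2) + 1) + 1)
    (hW : input.length ≤ W) :
    ∃ σ, Exec W (prologue k) (initial input) 9 σ ∧
      Rep input.length (Store.initial input) σ := by
  have h₃ : 2 * k + 2 ≤ n₁ * (2 * k + 2) := Nat.le_mul_of_pos_left _ hn₁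
  have h₄ : n₁ ≤ n₁ * (2 * k + 2) := Nat.le_mul_of_pos_right _ (by omega)
  have h₅ : n₂ ≤ n₂ * (2 * k + 2) := Nat.le_mul_of_pos_right _ (by omega)
  have hmem : (initial input).mem = fun i => input.getD i 0 := rfl
  have hreg : ∀ r, (initial input).reg r = 0 := fun _ => rfl
  refine ⟨_, .seq (.load _ _ _ ?_) (.seq (t' := 7) (.const _ _ _ ?_) (.seq (t' := 6)
    (.mul _ _ _ _ ?_) (.seq (t' := 5) (.const _ _ _ ?_) (.seq (t' := 4) (.add _ _ _ _ ?_)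
    (.seq (t' := 3) (.load _ _ _ ?_) (.seq (t' := 2) (.mul _ _ _ _ ?_) (.seq (t' := 1)
    (.add _ _ _ _ ?_) (.add _ _ _ _ ?_)))))))), ?_⟩
  iterate 9
    try simp [-List.getD_eq_getElem?_getD, hreg, hmem, h₁, h₂]
    omega
  constructor
  · simp [-List.getD_eq_getElem?_getD, hreg, hmem, h₁, h₂, hlen]
  · exact le_rfl
  · intro v
    have hv : ∀ r, Var.loc v ≠ 2 * r + 1 := fun r h => by
      unfold Var.loc at h
      omega
    simp [hreg, Store.initial, hv 0, hv 1, hv 2, hv 3, hv 4]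
  · intro j x y
    -- Array addresses start after the input, where the memory is `0`; so all arrays start out zero.
    exact List.getD_eq_default _ _ (Nat.le_add_left _ _)
  · intro i hi
    rfl

theorem exec_mainProgram {W k n₁ n₂ t : ℕ} {input : List ℕ} {s : Store}
    (h₁ : input.getD 0 0 = n₁) (h₂ : input.getD (n₁ * (2 * k + 2) + 1) 0 = n₂) (hn₁ : 1 ≤ n₁)
    (hlen : input.length = n₂ * (2 * k + 2) + (n₁ * (2 * k + 2) + 1) + 1)
    (hx : ∀ x ∈ input, x ≤ n₁ + n₂)
    (he : (compareMachines k).Exec (Store.initial input) t s)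
    (hW : wordBound input.length (n₁ + n₂ + (compareMachines k).cost * t) ≤ W) :
    ∃ t' σ, Exec W (mainProgram k) (initial input) t' σ ∧
      t' ≤ (compareMachines k).cost * t + 11 ∧ σ.reg 0 = s.reg .ok := by
  have hle : (Store.initial input).Le (n₁ + n₂) := by
    refine ⟨fun _ => Nat.zero_le _, fun _ _ _ => Nat.zero_le _, fun i hi => ?_⟩
    change input.getD i 0 ≤ _
    rw [List.getD_eq_getElem _ _ hi]
    exact hx _ (List.getElem_mem _)
  have hV := (le_wordBound input.length (n₁ + n₂ + (compareMachines k).cost * t)).trans hW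
  obtain ⟨σ₁, he₁, hr₁⟩ := exec_prologue h₁ h₂ hn₁ hlen (W := W) (by
    refine le_trans ?_ hW
    unfold wordBound
    omega)
  obtain ⟨hle', t₂, σ₂, he₂, ht₂, hr₂⟩ := Cmd.exec_compile he le_rfl hle hW hr₁
  have hok := hle'.reg .ok
  have hloc : Var.loc .ok ≠ 0 := by simp [Var.loc]
  refine ⟨_, _, .seq he₁ (.seq he₂ (.seq (.const _ _ _ (Nat.zero_le _)) (.add _ _ _ _ ?_))),
    by omega, ?_⟩
  · simp [hloc, hr₂.reg]
    omega
  · simp [hloc, hr₂.reg]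

end RAM

theorem mainTheorem4 {A : Type*} {k : ℕ} (α : A ≃ Fin k) :
    ∃ (P : RAM.Program) (C d : ℕ),
      ∀ {Q₁ Q₂ : Type*} {n₁ n₂ : ℕ} (e₁ : Q₁ ≃ Fin n₁) (e₂ : Q₂ ≃ Fin n₂)
        (S₁ : Spliffer A Q₁) (S₂ : Spliffer A Q₂),
        S₁.IsDeterministic → S₂.IsDeterministic →
        ∃ (t : ℕ) (s : RAM.State),
          RAM.Exec (C * (n₁ + n₂) ^ d) P
            (RAM.initial (S₁.encode α e₁ ++ S₂.encode α e₂)) t s ∧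
          t ≤ C * (n₁ + n₂) ^ 2 ∧
          (s.reg 0 = 1 ↔ S₁.behaviour = S₂.behaviour) := by
  obtain ⟨Z, hZ⟩ : ∃ Z, Z = (RAM.compareMachines k).cost := ⟨_, rfl⟩
  -- Chosen so that `c * m ^ 2`, with `m = n₁ + n₂`, bounds all numbers: the input entries are at
  -- most `m`, and each of the at most `(k + 1) * 1000 * m ^ 2` source steps adds at most `Z`.
  obtain ⟨c, hc⟩ : ∃ c, c = 1 + Z * ((k + 1) * 1000) := ⟨_, rfl⟩
  -- The first summand is the word-size constant of `wordBound_le`, with input length at most `(2 *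
  -- k + 4) * m`. The second is for the time; `11` counts the prologue and the copying of the
  -- answer.
  refine ⟨RAM.mainProgram k, (180 * c ^ 4 + (2 * k + 4) + c) + (c + 11), 8,
    fun {Q₁ Q₂ n₁ n₂} e₁ e₂ S₁ S₂ hS₁ hS₂ => ?_⟩
  obtain ⟨i₁, hi₁⟩ := hS₁.unique_init
  obtain ⟨i₂, hi₂⟩ := hS₂.unique_init
  have hn₁ : 1 ≤ n₁ := (e₁ i₁).pos
  have hn₂ : 1 ≤ n₂ := (e₂ i₂).pos
  have hT₁ := S₁.tableAt_encode α e₁ [] (S₂.encode α e₂)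
  have hT₂ := S₂.tableAt_encode α e₂ (S₁.encode α e₁) []
  rw [List.append_nil] at hT₂
  rw [List.nil_append] at hT₁
  have hlen₁ := S₁.length_encode α e₁
  have hlen : (S₁.encode α e₁ ++ S₂.encode α e₂).length =
      n₂ * (2 * k + 2) + (n₁ * (2 * k + 2) + 1) + 1 := by
    rw [List.length_append, hlen₁, S₂.length_encode]
    omega
  obtain ⟨hini₁, hini₁'⟩ := S₁.record_getD_init α e₁ hi₁
  obtain ⟨hini₂, hini₂'⟩ := S₂.record_getD_init α e₂ hi₂
  rw [hlen₁, show 1 + n₁ * (2 * k + 2) = 0 + 1 + n₁ * (2 * k + 2) by omega] at hT₂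
  obtain ⟨t, s, he, ht, δ, τ, F, h0, hF, hR₁, hR₂, hok⟩ := RAM.compareMachines_spec hT₁ hT₂
    (fun _ _ _ _ => Spliffer.record_getD_le ..) (fun _ _ _ _ => Spliffer.record_getD_le ..)
    (fun _ _ _ _ => Spliffer.record_getD_le ..) (fun _ _ _ _ => Spliffer.record_getD_le ..)
    (fun _ hi => Spliffer.record_getD_one_le _ _ _ hi)
    (fun _ hi => Spliffer.record_getD_one_le _ _ _ hi)
    (e₁ i₁).isLt hini₁ hini₁' (e₂ i₂).isLt hini₂ hini₂'
  have h₁ : (S₁.encode α e₁ ++ S₂.encode α e₂).getD 0 0 = n₁ := hT₁.num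
  have h₂ : (S₁.encode α e₁ ++ S₂.encode α e₂).getD (n₁ * (2 * k + 2) + 1) 0 = n₂ := by
    rw [Nat.add_comm]
    simpa [RAM.Store.initial] using hT₂.num
  obtain ⟨m, hm⟩ : ∃ m, m = n₁ + n₂ := ⟨_, rfl⟩
  rw [← hm] at ht ⊢
  have hm₁ : 1 ≤ m := by omega
  have hm₂ : m ≤ m ^ 2 := Nat.le_self_pow (by omega) m
  have hZt : Z * t ≤ Z * ((k + 1) * 1000) * m ^ 2 := by
    rw [Nat.mul_assoc]
    exact Nat.mul_le_mul_left _ ht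
  have hV : n₁ + n₂ + Z * t ≤ c * m ^ 2 := by
    rw [hc, Nat.add_mul]
    omega
  have ho : (S₁.encode α e₁ ++ S₂.encode α e₂).length ≤ (2 * k + 4) * m := by
    rw [hlen, hm]
    nlinarith
  have hle : ∀ x ∈ S₁.encode α e₁ ++ S₂.encode α e₂, x ≤ n₁ + n₂ := by
    intro x hx
    rcases List.mem_append.1 hx with hx | hx
    · exact (Spliffer.encode_le _ _ _ hx).trans (Nat.le_add_right _ _)
    · exact (Spliffer.encode_le _ _ _ hx).trans (Nat.le_add_left _ _)
  have hW := RAM.wordBound_le hV ho hm₁ (by omega)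
  obtain ⟨t', σ, he', ht', hσ⟩ := RAM.exec_mainProgram
    (W := ((180 * c ^ 4 + (2 * k + 4) + c) + (c + 11)) * m ^ 8) h₁ h₂ hn₁ hlen hle he
    (by
      rw [← hZ]
      exact hW.trans (Nat.mul_le_mul_right _ (Nat.le_add_right _ _)))
  · refine ⟨t', σ, he', ?_, ?_⟩
    · rw [← hZ] at ht'
      have h₃ : (c + 11) * m ^ 2 ≤
          ((180 * c ^ 4 + (2 * k + 4) + c) + (c + 11)) * m ^ 2 :=
        Nat.mul_le_mul_right _ (Nat.le_add_left _ _)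
      rw [Nat.add_mul c] at h₃
      omega
    · rw [hσ, Spliffer.behaviour_eq_iff (hS₁.tabulated hR₁) (hS₂.tabulated hR₂) h0 hF hi₁ hi₂]
      exact hok
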